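/- Let $X=[\underline x,\overline x]$ and $Y=[\underline y,\overline y]$ be intervals with $\underline x<\overline x$ and $\underline y<\overline y$. Firm types are distributed on $X$ with cdf $F$ and worker types on $Y$ with cdf $G$; all such type distributions are assumed to have continuous, strictly positive densities on $X$ and $Y$, respectively. A production function is a twice continuously differentiable $v:X\times Y\to\mathbb R$ with $v_{xz}>0$ and $v_{zz}<0$ everywhere on $X\times Y$; $v(x,z)$ is the value generated by a firm of type $x$ whose workforce has mean skill $z$. An assignment is a probability distribution $J$ of pairs $(x,z)\in X\times Y$ whose $X$-marginal is $F$ and whose $Y$-marginal $J_Y$ is the distribution of the means $\int y\,\eta(dy)$ for some probability distribution of workforces $\eta$ (probability measures on $Y$) whose average is $G$. A competitive equilibrium for $(v,F,G)$ is an assignment $J$ with Lipschitz functions $p:X\to\mathbb R$, $q:Y\to\mathbb R$ such that $p(x)+q(z)=v(x,z)$ on $\operatorname{supp}(J)$, $p(x)+q(z)\ge v(x,z)$ on $X\times Y$, $q$ is convex, and $\mathbb E_{J_Y}[q(z)]=\mathbb E_G[q(y)]$. Its workforce distribution is $H=J_Y$. For distributions on $Y$, write $H\succeq G$ if $\int_{\underline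 y}^{y}H(\tilde y)\,d\tilde y\le\int_{\underline y}^{y}G(\tilde y)\,d\tilde y$ for all $y\in Y$ (in terms of cdfs), with equality at $y=\overline y$; $G\preceq H$ means $H\succeq G$. For production functions $v,\hat v$, write $\hat v_z\unrhd v_z$ if for all $x\le x'$ in $X$ and $z\le z'$ in $Y$, $v_z(x',z')\ge v_z(x,z)$ implies $\hat v_z(x',z')\ge\hat v_z(x,z)$. **Theorem.** For all $v,F,G$ as above, the equilibrium workforce distribution $H_{v,F,G}$ is well defined: there is exactly one distribution that is the workforce distribution of a competitive equilibrium for $(v,F,G)$. Moreover: 1. For all production functions $v,\hat v$: $H_{\hat v,F,G}\preceq H_{v,F,G}$ for all $(F,G)$ if and only if $\hat v_z\unrhd v_z$. 2. For all worker type distributions $G,\hat G$ on $Y$: $H_{v,F,\hat G}\preceq H_{v,F,G}$ for all $(v,F)$ if and only if $\hat G\preceq G$. -/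

import Mathlib

open MeasureTheory Set

noncomputable section

/-- `μ` is a probability distribution on `[a, b]` with a density that is continuous and strictly
positive on `[a, b]`. -/
def IsTypeDistribution (a b : ℝ) (μ : Measure ℝ) : Prop :=
  IsProbabilityMeasure μ ∧ ∃ f : ℝ → ℝ, ContinuousOn f (Icc a b) ∧ (∀ t ∈ Icc a b, 0 < f t) ∧
    μ = (volume.restrict (Icc a b)).withDensity (fun t => ENNReal.ofReal (f t))

/-- `H ⪰ G` for distributions on `[a, b]`: the integrated cdf of `H` lies below that of `G`, with
equality at the right end point (so `G` is a mean-preserving spread of `H`). -/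
def Majorizes (a b : ℝ) (H G : Measure ℝ) : Prop :=
  (∀ y ∈ Icc a b, ∫ t in a..y, ProbabilityTheory.cdf H t ≤ ∫ t in a..y, ProbabilityTheory.cdf G t) ∧
    ∫ t in a..b, ProbabilityTheory.cdf H t = ∫ t in a..b, ProbabilityTheory.cdf G t

/-- The marginal return to skill `v_z(x, z)` on `X × Y`, where `Y = [c, d]`. -/
def marginalReturn (c d : ℝ) (v : ℝ → ℝ → ℝ) (x z : ℝ) : ℝ :=
  derivWithin (fun t => v x t) (Icc c d) z

/-- A production function on `X × Y = [a, b] × [c, d]`: twice continuously differentiable (hence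
Lipschitz), with strictly increasing differences `v_xz > 0` and strictly decreasing returns to
workforce skill `v_zz < 0`. Derivatives are one-sided at the boundary. -/
structure IsProductionFunction (a b c d : ℝ) (v : ℝ → ℝ → ℝ) : Prop where
  contDiffOn : ContDiffOn ℝ 2 (fun w : ℝ × ℝ => v w.1 w.2) (Icc a b ×ˢ Icc c d)
  increasing_differences : ∀ x ∈ Icc a b, ∀ z ∈ Icc c d,
    0 < derivWithin (fun s => marginalReturn c d v s z) (Icc a b) x
  decreasing_returns : ∀ x ∈ Icc a b, ∀ z ∈ Icc c d,
    derivWithin (fun t => marginalReturn c d v x t) (Icc c d) z < 0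

/-- `H` is obtained by splitting the worker distribution `G` on `[c, d]` into a distribution `τ` of
workforces `η` (probability measures on `[c, d]`) whose average is `G`, and taking the distribution
of the mean skill of the workforce. -/
def IsSplittingMeans (c d : ℝ) (G H : Measure ℝ) : Prop :=
  ∃ τ : Measure (Measure ℝ), IsProbabilityMeasure τ ∧
    (∀ᵐ η ∂τ, IsProbabilityMeasure η ∧ η (Icc c d)ᶜ = 0) ∧
    τ.join = G ∧ τ.map (fun η => ∫ y, y ∂η) = H

/-- A joint distribution `J` of (firm, workforce mean) pairs is an assignment for firm distribution
`F` and worker distribution `G` on `[c, d]`. -/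
def IsAssignment (c d : ℝ) (F G : Measure ℝ) (J : Measure (ℝ × ℝ)) : Prop :=
  J.map Prod.fst = F ∧ IsSplittingMeans c d G (J.map Prod.snd)

/-- `(J; p, q)` is a competitive equilibrium on `X × Y = [a, b] × [c, d]`, with profits `p` and
wages `q`. -/
structure IsCompetitiveEquilibrium (a b c d : ℝ) (v : ℝ → ℝ → ℝ) (F G : Measure ℝ)
    (J : Measure (ℝ × ℝ)) (p q : ℝ → ℝ) : Prop where
  assignment : IsAssignment c d F G J
  lipschitz_profit : ∃ K, LipschitzOnWith K p (Icc a b)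
  lipschitz_wage : ∃ K, LipschitzOnWith K q (Icc c d)
  eq_on_support : ∀ w ∈ J.support, p w.1 + q w.2 = v w.1 w.2
  no_profitable_deviation : ∀ x ∈ Icc a b, ∀ z ∈ Icc c d, v x z ≤ p x + q z
  convex_wage : ConvexOn ℝ (Icc c d) q
  wage_balance : ∫ z, q z ∂(J.map Prod.snd) = ∫ y, q y ∂G

/-- `H` is the workforce distribution (the distribution of workforce means) of some competitive
equilibrium. -/
def IsEquilibriumWorkforceDistribution (a b c d : ℝ) (v : ℝ → ℝ → ℝ) (F G H : Measure ℝ) : Prop :=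
  ∃ (J : Measure (ℝ × ℝ)) (p q : ℝ → ℝ),
    IsCompetitiveEquilibrium a b c d v F G J p q ∧ J.map Prod.snd = H

/-- The marginal return to skill under `w` has a higher marginal rate of substitution between firm
productivity and workforce skill than that under `v`, written `w_z ⊵ v_z`. -/
def HigherMRS (a b c d : ℝ) (w v : ℝ → ℝ → ℝ) : Prop :=
  ∀ x ∈ Icc a b, ∀ x' ∈ Icc a b, ∀ z ∈ Icc c d, ∀ z' ∈ Icc c d, x ≤ x' → z ≤ z' →
    marginalReturn c d v x z ≤ marginalReturn c d v x' z' →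
    marginalReturn c d w x z ≤ marginalReturn c d w x' z'

end

/-! At wages q a firm of type x seeks the skill maximizing v(x, z) - q(z). Since q is convex and
v_zz < 0, missing the optimum Z(x) costs at least a multiple of the squared distance, and v_xz > 0
makes Z increasing. An equilibrium thus amounts to a convex wage q for which the law H of Z under F
is the distribution of means of a splitting of G, with equal integrals of q under H and G
(`IsSorting`).

Existence comes from minimizing ∫ q dG + ∫ profit dF over convex q. Perturbing the minimizer by a
convex h gives ∫ h dH ≤ ∫ h dG, hence a splitting by Strassen's theorem; perturbing by -q gives the
wage balance (`exists_isSorting`). For uniqueness, each of two equilibrium demands is affordable at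
the wages of the other, so neither produces more, and the quadratic loss makes them agree almost
everywhere (`IsSorting.unique`).

The comparative statics rest on one fact: q is affine wherever the integrated cdf of H lies strictly
below that of G (`IsSplitting.exists_common_subgradient`). If H' were not more dispersed than H,
then on some interval the integrated cdf of H' would lie strictly below that of H, hence of G', so
q' would have a single slope l there. A crossing of the cdfs yields firms x₁ ≤ x₂ with Z(x₁) <
Z'(x₁) and Z'(x₂) < Z(x₂). Marginal returns increase along Z because q is convex; the relation ⊵
carries this to v', and concavity makes v'_z(x₁, Z'(x₁)) < v'_z(x₂, Z'(x₂)). The single slope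
demands v'_z(x₂, Z'(x₂)) ≤ l ≤ v'_z(x₁, Z'(x₁)), a contradiction (`IsSorting.majorizes`).

Conversely, if ⊵ fails at two pairs, types concentrated near these pairs are almost completely
sorted under v; an outcome at least as dispersed under v' would violate the monotonicity of v'_z
along its own demand (`exists_not_majorizes`). For worker distributions, a quadratic v with strong
complementarity and uniform F leaves no pooling, so H keeps the dispersion of G
(`IsTypeDistribution.exists_forall_integral_max_le`). -/

section Partial

variable {A B : Set ℝ} {u : ℝ × ℝ → ℝ}

lemma hasDerivWithinAt_snd (hu : DifferentiableOn ℝ u (A ×ˢ B)) {x z : ℝ} (hx : x ∈ A)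
    (hz : z ∈ B) :
    HasDerivWithinAt (fun t => u (x, t)) (fderivWithin ℝ u (A ×ˢ B) (x, z) (0, 1)) B z := by
  have h1 := (hu (x, z) ⟨hx, hz⟩).hasFDerivWithinAt
  have h2 : HasDerivWithinAt (fun t : ℝ => (x, t)) ((0 : ℝ), (1 : ℝ)) B z :=
    (hasDerivWithinAt_const z B x).prodMk (hasDerivWithinAt_id z B)
  exact h1.comp_hasDerivWithinAt (f := fun t : ℝ => (x, t)) z h2 fun t ht => ⟨hx, ht⟩

lemma hasDerivWithinAt_fst (hu : DifferentiableOn ℝ u (A ×ˢ B)) {x z : ℝ} (hx : x ∈ A)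
    (hz : z ∈ B) :
    HasDerivWithinAt (fun s => u (s, z)) (fderivWithin ℝ u (A ×ˢ B) (x, z) (1, 0)) A x := by
  have h1 := (hu (x, z) ⟨hx, hz⟩).hasFDerivWithinAt
  have h2 : HasDerivWithinAt (fun s : ℝ => (s, z)) ((1 : ℝ), (0 : ℝ)) A x :=
    (hasDerivWithinAt_id x A).prodMk (hasDerivWithinAt_const x A z)
  exact h1.comp_hasDerivWithinAt (f := fun s : ℝ => (s, z)) x h2 fun t ht => ⟨ht, hz⟩

lemma HasDerivWithinAt.deriv_eq_of_mem_Ioo {f : ℝ → ℝ} {f' r s t : ℝ}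
    (h : HasDerivWithinAt f f' (Icc r s) t) (ht : t ∈ Ioo r s) : HasDerivAt f f' t :=
  h.hasDerivAt (Icc_mem_nhds ht.1 ht.2)

end Partial

/-! ### Marginal returns to skill and uniform concavity. -/

namespace IsProductionFunction

variable {a b c d : ℝ} {v : ℝ → ℝ → ℝ}

lemma exists_lipschitzOnWith (hv : IsProductionFunction a b c d v) :
    ∃ K, LipschitzOnWith K (fun w : ℝ × ℝ => v w.1 w.2) (Icc a b ×ˢ Icc c d) :=
  LocallyLipschitzOn.exists_lipschitzOnWith_of_compact (isCompact_Icc.prod isCompact_Icc)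
    ((hv.contDiffOn.of_le (by norm_num)).locallyLipschitzOn
      ((convex_Icc a b).prod (convex_Icc c d)))

/-- Production functions are Lipschitz, separately in both arguments. -/
lemma exists_lipschitz_const (hv : IsProductionFunction a b c d v) :
    ∃ K : ℝ, 0 < K ∧ (∀ x ∈ Icc a b, ∀ z ∈ Icc c d, ∀ z' ∈ Icc c d,
      |v x z - v x z'| ≤ K * |z - z'|) ∧
      (∀ x ∈ Icc a b, ∀ x' ∈ Icc a b, ∀ z ∈ Icc c d, |v x z - v x' z| ≤ K * |x - x'|) := by
  obtain ⟨K, hK⟩ := hv.exists_lipschitzOnWith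
  have hK0 : (0 : ℝ) ≤ K := K.2
  refine ⟨K + 1, by positivity, fun x hx z hz z' hz' => ?_, fun x hx x' hx' z hz => ?_⟩
  · have := hK.dist_le_mul (x, z) ⟨hx, hz⟩ (x, z') ⟨hx, hz'⟩
    simp only [Real.dist_eq, Prod.dist_eq, sub_self, abs_zero] at this
    rw [max_eq_right (abs_nonneg _)] at this
    nlinarith [abs_nonneg (z - z')]
  · have := hK.dist_le_mul (x, z) ⟨hx, hz⟩ (x', z) ⟨hx', hz⟩
    simp only [Real.dist_eq, Prod.dist_eq, sub_self, abs_zero] at this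
    rw [max_eq_left (abs_nonneg _)] at this
    nlinarith [abs_nonneg (x - x')]

variable (hab : a < b) (hcd : c < d)

include hab hcd in
lemma uniqueDiffOn_box : UniqueDiffOn ℝ (Icc a b ×ˢ Icc c d) :=
  (uniqueDiffOn_Icc hab).prod (uniqueDiffOn_Icc hcd)

include hcd in
lemma marginalReturn_eq (hv : IsProductionFunction a b c d v) {x z : ℝ} (hx : x ∈ Icc a b)
    (hz : z ∈ Icc c d) : marginalReturn c d v x z =
      fderivWithin ℝ (fun w : ℝ × ℝ => v w.1 w.2) (Icc a b ×ˢ Icc c d) (x, z) (0, 1) :=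
  (hasDerivWithinAt_snd (hv.contDiffOn.differentiableOn (by norm_num)) hx hz).derivWithin
    (uniqueDiffOn_Icc hcd z hz)

include hcd in
lemma hasDerivWithinAt (hv : IsProductionFunction a b c d v) {x z : ℝ} (hx : x ∈ Icc a b)
    (hz : z ∈ Icc c d) :
    HasDerivWithinAt (fun t => v x t) (marginalReturn c d v x z) (Icc c d) z := by
  rw [marginalReturn_eq hcd hv hx hz]
  exact hasDerivWithinAt_snd (u := fun w : ℝ × ℝ => v w.1 w.2)
    (hv.contDiffOn.differentiableOn (by norm_num)) hx hz

include hab hcd in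
lemma contDiffOn_marginalReturn (hv : IsProductionFunction a b c d v) :
    ContDiffOn ℝ 1 (fun w : ℝ × ℝ => marginalReturn c d v w.1 w.2) (Icc a b ×ˢ Icc c d) := by
  have h := (hv.contDiffOn.fderivWithin (m := 1) (uniqueDiffOn_box hab hcd)
    (by norm_num)).clm_apply (contDiffOn_const (c := ((0 : ℝ), (1 : ℝ))))
  exact h.congr fun w hw => marginalReturn_eq hcd hv hw.1 hw.2

include hab hcd in
lemma continuousOn_marginalReturn (hv : IsProductionFunction a b c d v) :
    ContinuousOn (fun w : ℝ × ℝ => marginalReturn c d v w.1 w.2) (Icc a b ×ˢ Icc c d) :=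
  (contDiffOn_marginalReturn hab hcd hv).continuousOn

include hab hcd in
lemma marginalReturn_lt (hv : IsProductionFunction a b c d v) {x x' z : ℝ} (hx : x ∈ Icc a b)
    (hx' : x' ∈ Icc a b) (hz : z ∈ Icc c d) (h : x < x') :
    marginalReturn c d v x z < marginalReturn c d v x' z := by
  have hd : ∀ s ∈ Icc a b, HasDerivWithinAt (fun s => marginalReturn c d v s z)
      (derivWithin (fun s => marginalReturn c d v s z) (Icc a b) s) (Icc a b) s := fun s hs =>
    (hasDerivWithinAt_fst ((contDiffOn_marginalReturn hab hcd hv).differentiableOn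
      (by norm_num)) hs hz).differentiableWithinAt.hasDerivWithinAt
  refine strictMonoOn_of_deriv_pos (convex_Icc a b) (fun s hs => (hd s hs).continuousWithinAt)
    (fun s hs => ?_) hx hx' h
  rw [interior_Icc] at hs
  rw [((hd s (Ioo_subset_Icc_self hs)).deriv_eq_of_mem_Ioo hs).deriv]
  exact hv.increasing_differences s (Ioo_subset_Icc_self hs) z hz

include hab hcd in
/-- The marginal return to skill decreases at a uniformly positive rate. -/
lemma exists_marginalReturn_le (hv : IsProductionFunction a b c d v) :
    ∃ κ : ℝ, 0 < κ ∧ ∀ x ∈ Icc a b, ∀ z ∈ Icc c d, ∀ z' ∈ Icc c d, z ≤ z' →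
      marginalReturn c d v x z' ≤ marginalReturn c d v x z - κ * (z' - z) := by
  set S := Icc a b ×ˢ Icc c d
  set g : ℝ × ℝ → ℝ := fun w =>
    fderivWithin ℝ (fun w : ℝ × ℝ => marginalReturn c d v w.1 w.2) S w (0, 1)
  have hm := contDiffOn_marginalReturn hab hcd hv
  have hd : ∀ x ∈ Icc a b, ∀ z ∈ Icc c d, HasDerivWithinAt (fun t => marginalReturn c d v x t)
      (g (x, z)) (Icc c d) z := fun x hx z hz =>
    hasDerivWithinAt_snd (hm.differentiableOn (by norm_num)) hx hz
  have hg : ContinuousOn g S :=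
    ((hm.fderivWithin (m := 0) (uniqueDiffOn_box hab hcd) (by norm_num)).clm_apply
      (contDiffOn_const (c := ((0 : ℝ), (1 : ℝ))))).continuousOn
  -- The continuous function v_zz attains a negative maximum on the compact box; its absolute value
  -- is the uniform rate.
  obtain ⟨w, hw, hmax⟩ := (isCompact_Icc.prod isCompact_Icc).exists_isMaxOn
    (⟨(a, c), ⟨left_mem_Icc.2 hab.le, left_mem_Icc.2 hcd.le⟩⟩ : S.Nonempty) hg
  have hneg : ∀ x ∈ Icc a b, ∀ z ∈ Icc c d, g (x, z) < 0 := fun x hx z hz => by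
    rw [← (hd x hx z hz).derivWithin (uniqueDiffOn_Icc hcd z hz)]
    exact hv.decreasing_returns x hx z hz
  refine ⟨-g w, neg_pos.2 (hneg w.1 hw.1 w.2 hw.2), fun x hx z hz z' hz' h => ?_⟩
  have := (convex_Icc c d).image_sub_le_mul_sub_of_deriv_le
    (fun t ht => (hd x hx t ht).continuousWithinAt) (f := fun t => marginalReturn c d v x t)
    (C := g w) (fun t ht => ?_) (fun t ht => ?_) z hz z' hz' h
  · linarith
  · rw [interior_Icc] at ht
    exact ((hd x hx t (Ioo_subset_Icc_self ht)).deriv_eq_of_mem_Ioo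
      ht).differentiableAt.differentiableWithinAt
  · rw [interior_Icc] at ht
    rw [((hd x hx t (Ioo_subset_Icc_self ht)).deriv_eq_of_mem_Ioo ht).deriv]
    exact hmax (⟨hx, Ioo_subset_Icc_self ht⟩ : (x, t) ∈ S)

include hab hcd in
lemma marginalReturn_lt_of_lt (hv : IsProductionFunction a b c d v) {x z z' : ℝ}
    (hx : x ∈ Icc a b) (hz : z ∈ Icc c d) (hz' : z' ∈ Icc c d) (h : z < z') :
    marginalReturn c d v x z' < marginalReturn c d v x z := by
  obtain ⟨κ, hκ, H⟩ := hv.exists_marginalReturn_le hab hcd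
  nlinarith [H x hx z hz z' hz' h.le]

include hab hcd in
lemma marginalReturn_anti (hv : IsProductionFunction a b c d v) {x z z' : ℝ}
    (hx : x ∈ Icc a b) (hz : z ∈ Icc c d) (hz' : z' ∈ Icc c d) (h : z ≤ z') :
    marginalReturn c d v x z' ≤ marginalReturn c d v x z := by
  rcases h.eq_or_lt with rfl | h
  · exact le_rfl
  · exact (hv.marginalReturn_lt_of_lt hab hcd hx hz hz' h).le

include hab hcd in
/-- Production functions are uniformly strongly concave in workforce skill. -/
lemma exists_strongly_concave (hv : IsProductionFunction a b c d v) :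
    ∃ κ : ℝ, 0 < κ ∧ ∀ x ∈ Icc a b, ∀ z ∈ Icc c d, ∀ y ∈ Icc c d,
      v x y ≤ v x z + marginalReturn c d v x z * (y - z) - κ * (y - z) ^ 2 := by
  obtain ⟨κ, hκ, H⟩ := hv.exists_marginalReturn_le hab hcd
  refine ⟨κ / 2, by positivity, fun x hx z hz y hy => ?_⟩
  set m := marginalReturn c d v x z with hm
  -- The uniform decrease of v_z makes g increase up to z and decrease after it, so g is maximal at
  -- z.
  set g : ℝ → ℝ := fun t => v x t - m * (t - z) + κ / 2 * (t - z) ^ 2 with hg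
  have hgd : ∀ t ∈ Icc c d, HasDerivWithinAt g
      (marginalReturn c d v x t - m + κ * (t - z)) (Icc c d) t := fun t ht => by
    have h1 : HasDerivWithinAt (fun t : ℝ => m * (t - z)) m (Icc c d) t := by
      simpa using ((hasDerivWithinAt_id t (Icc c d)).sub_const z).const_mul m
    have h2 : HasDerivWithinAt (fun t : ℝ => κ / 2 * (t - z) ^ 2) (κ * (t - z)) (Icc c d) t := by
      have := (((hasDerivWithinAt_id t (Icc c d)).sub_const z).pow 2).const_mul (κ / 2)
      refine this.congr_deriv ?_
      simp only [Nat.cast_ofNat, id]; ring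
    exact ((hv.hasDerivWithinAt hcd hx ht).sub h1).add h2
  have hcont : ContinuousOn g (Icc c d) := fun t ht => (hgd t ht).continuousWithinAt
  have key : g y ≤ g z := by
    rcases le_total z y with h | h
    · have hsub : Icc z y ⊆ Icc c d := Icc_subset_Icc hz.1 hy.2
      refine antitoneOn_of_deriv_nonpos (convex_Icc z y) (hcont.mono hsub) (fun t ht => ?_)
        (fun t ht => ?_) (left_mem_Icc.2 h) (right_mem_Icc.2 h) h <;> rw [interior_Icc] at ht
      · exact ((hgd t (hsub (Ioo_subset_Icc_self ht))).deriv_eq_of_mem_Ioo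
          ⟨hz.1.trans_lt ht.1, ht.2.trans_le hy.2⟩).differentiableAt.differentiableWithinAt
      · rw [((hgd t (hsub (Ioo_subset_Icc_self ht))).deriv_eq_of_mem_Ioo
          ⟨hz.1.trans_lt ht.1, ht.2.trans_le hy.2⟩).deriv]
        linarith [H x hx z hz t (hsub (Ioo_subset_Icc_self ht)) ht.1.le]
    · have hsub : Icc y z ⊆ Icc c d := Icc_subset_Icc hy.1 hz.2
      refine monotoneOn_of_deriv_nonneg (convex_Icc y z) (hcont.mono hsub) (fun t ht => ?_)
        (fun t ht => ?_) (left_mem_Icc.2 h) (right_mem_Icc.2 h) h <;> rw [interior_Icc] at ht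
      · exact ((hgd t (hsub (Ioo_subset_Icc_self ht))).deriv_eq_of_mem_Ioo
          ⟨hy.1.trans_lt ht.1, ht.2.trans_le hz.2⟩).differentiableAt.differentiableWithinAt
      · rw [((hgd t (hsub (Ioo_subset_Icc_self ht))).deriv_eq_of_mem_Ioo
          ⟨hy.1.trans_lt ht.1, ht.2.trans_le hz.2⟩).deriv]
        linarith [H x hx t (hsub (Ioo_subset_Icc_self ht)) z hz ht.2.le]
  simp only [hg] at key
  nlinarith [key]

include hab hcd in
lemma increasing_diff (hv : IsProductionFunction a b c d v) {x x' z z' : ℝ}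
    (hx : x ∈ Icc a b) (hx' : x' ∈ Icc a b) (hz : z ∈ Icc c d) (hz' : z' ∈ Icc c d)
    (h : x < x') (h' : z < z') : v x z' + v x' z < v x' z' + v x z := by
  have hd : ∀ t ∈ Icc c d, HasDerivWithinAt (fun t => v x' t - v x t)
      (marginalReturn c d v x' t - marginalReturn c d v x t) (Icc c d) t := fun t ht =>
    (hv.hasDerivWithinAt hcd hx' ht).sub (hv.hasDerivWithinAt hcd hx ht)
  have := strictMonoOn_of_deriv_pos (convex_Icc c d)
    (fun t ht => (hd t ht).continuousWithinAt) (fun t ht => ?_) hz hz' h'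
  · linarith
  · rw [interior_Icc] at ht
    rw [((hd t (Ioo_subset_Icc_self ht)).deriv_eq_of_mem_Ioo ht).deriv]
    linarith [hv.marginalReturn_lt hab hcd hx hx' (Ioo_subset_Icc_self ht) h]

lemma continuousOn_snd (hv : IsProductionFunction a b c d v) {x : ℝ} (hx : x ∈ Icc a b) :
    ContinuousOn (fun z => v x z) (Icc c d) :=
  hv.contDiffOn.continuousOn.comp (f := fun z => (x, z)) (by fun_prop) fun _ hz => ⟨hx, hz⟩

end IsProductionFunction

/-! ### Optimal demand for workforce skill at given wages. -/

section Maximizers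

variable {a b c d : ℝ} {v : ℝ → ℝ → ℝ} {q : ℝ → ℝ}

/-- First-order condition: the marginal return at a maximizer of `v x - q` is a subgradient
of `q`. -/
lemma marginalReturn_mul_le (hcd : c < d) (hv : IsProductionFunction a b c d v)
    (hq : ConvexOn ℝ (Icc c d) q) {x z : ℝ} (hx : x ∈ Icc a b) (hz : z ∈ Icc c d)
    (hmax : ∀ y ∈ Icc c d, v x y - q y ≤ v x z - q z) {y : ℝ} (hy : y ∈ Icc c d) :
    marginalReturn c d v x z * (y - z) ≤ q y - q z := by
  have hmaps : MapsTo (fun t : ℝ => z + t * (y - z)) (Icc 0 1) (Icc c d) := fun t ht => by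
    have := (convex_Icc c d) hz hy (sub_nonneg.2 ht.2) ht.1 (by ring)
    simp only [smul_eq_mul] at this
    convert this using 1
    ring
  have hlin : HasDerivWithinAt (fun t : ℝ => z + t * (y - z)) (y - z) (Icc 0 1) 0 := by
    simpa using ((hasDerivWithinAt_id (0 : ℝ) (Icc 0 1)).mul_const (y - z)).const_add z
  have hd : HasDerivWithinAt (fun t : ℝ => v x (z + t * (y - z)))
      (marginalReturn c d v x z * (y - z)) (Icc 0 1) 0 := by
    have h0 : HasDerivWithinAt (fun t => v x t) (marginalReturn c d v x z) (Icc c d)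
        (z + 0 * (y - z)) := by simpa using hv.hasDerivWithinAt hcd hx hz
    exact h0.comp (0 : ℝ) hlin hmaps
  -- Only skills on the segment from z to y enter the quotient, so endpoints of the skill interval
  -- need no separate case. Optimality bounds the change of output by that of wages, and convexity
  -- bounds the latter by t (q y - q z).
  have hlim := (hasDerivWithinAt_iff_tendsto_slope.1 hd).mono_left
    (nhdsWithin_mono (0 : ℝ) (fun t (ht : t ∈ Ioc (0 : ℝ) 1) => ⟨⟨ht.1.le, ht.2⟩, ht.1.ne'⟩))
  have hne : (nhdsWithin (0 : ℝ) (Ioc 0 1)).NeBot := by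
    rw [nhdsWithin_Ioc_eq_nhdsGT one_pos]; infer_instance
  refine le_of_tendsto hlim (eventually_nhdsWithin_of_forall fun t ht => ?_)
  have h1 := hmax _ (hmaps ⟨ht.1.le, ht.2⟩)
  have h2 := hq.2 hz hy (sub_nonneg.2 ht.2) ht.1.le (by ring)
  simp only [smul_eq_mul] at h2
  have h3 : (1 - t) * z + t * y = z + t * (y - z) := by ring
  rw [h3] at h2
  rw [slope_def_field, div_le_iff₀ (by linarith [ht.1])]
  simp only [zero_mul, add_zero, sub_zero]
  nlinarith

/-- Both marginal returns are subgradients of q, and subgradients of a convex function increase. -/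
lemma marginalReturn_le_of_lt (hcd : c < d) (hv : IsProductionFunction a b c d v)
    (hq : ConvexOn ℝ (Icc c d) q) {x z x' z' : ℝ} (hx : x ∈ Icc a b) (hz : z ∈ Icc c d)
    (hx' : x' ∈ Icc a b) (hz' : z' ∈ Icc c d)
    (hmax : ∀ y ∈ Icc c d, v x y - q y ≤ v x z - q z)
    (hmax' : ∀ y ∈ Icc c d, v x' y - q y ≤ v x' z' - q z') (h : z < z') :
    marginalReturn c d v x z ≤ marginalReturn c d v x' z' := by
  have h1 := marginalReturn_mul_le hcd hv hq hx hz hmax hz'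
  have h2 := marginalReturn_mul_le hcd hv hq hx' hz' hmax' hz
  nlinarith

/-- `Z` assigns to every firm in `[a, b]` an optimal workforce skill at wages `q`, monotonically. -/
structure IsDemand (a b c d : ℝ) (v : ℝ → ℝ → ℝ) (q Z : ℝ → ℝ) : Prop where
  mono : Monotone Z
  mem : ∀ x, Z x ∈ Icc c d
  max : ∀ x ∈ Icc a b, ∀ y ∈ Icc c d, v x y - q y ≤ v x (Z x) - q (Z x)

/-- If a higher type chose a lower skill, strictly increasing differences would make a swap raise
joint output, against both optimality conditions. -/
lemma exists_isDemand (hab : a < b) (hcd : c < d) (hv : IsProductionFunction a b c d v)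
    (hq : ContinuousOn q (Icc c d)) : ∃ Z, IsDemand a b c d v q Z := by
  have hex : ∀ x : Icc a b, ∃ z ∈ Icc c d, ∀ y ∈ Icc c d, v x y - q y ≤ v x z - q z := fun x =>
    isCompact_Icc.exists_isMaxOn (nonempty_Icc.2 hcd.le) ((hv.continuousOn_snd x.2).sub hq)
  choose Z hZ hmax using hex
  have hmono : ∀ x x' : Icc a b, x ≤ x' → Z x ≤ Z x' := fun x x' h => by
    rcases h.eq_or_lt with rfl | h
    · exact le_rfl
    by_contra! hlt
    have h1 := hmax x _ (hZ x')
    have h2 := hmax x' _ (hZ x)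
    have h3 := hv.increasing_diff hab hcd x.2 x'.2 (hZ x') (hZ x) h hlt
    linarith
  -- The constant extension beyond [a, b] is monotone on all of ℝ, hence measurable.
  refine ⟨fun x => Z (projIcc a b hab.le x), fun x x' h => hmono _ _ (monotone_projIcc hab.le h),
    fun x => hZ _, fun x hx y hy => ?_⟩
  simpa [projIcc_of_mem hab.le hx] using hmax ⟨x, hx⟩ y hy

/-- Deviations from the optimal workforce skill are quadratically costly. -/
lemma exists_isDemand_gap (hab : a < b) (hcd : c < d) (hv : IsProductionFunction a b c d v) :
    ∃ κ : ℝ, 0 < κ ∧ ∀ q Z : ℝ → ℝ, ConvexOn ℝ (Icc c d) q → IsDemand a b c d v q Z →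
      ∀ x ∈ Icc a b, ∀ y ∈ Icc c d,
        v x y - q y + κ * (y - Z x) ^ 2 ≤ v x (Z x) - q (Z x) := by
  obtain ⟨κ, hκ, H⟩ := hv.exists_strongly_concave hab hcd
  refine ⟨κ, hκ, fun q Z hq hZ x hx y hy => ?_⟩
  have h1 := H x hx _ (hZ.mem x) y hy
  have h2 := marginalReturn_mul_le hcd hv hq hx (hZ.mem x) (hZ.max x hx) hy
  linarith

end Maximizers

/-! ### Integrated cdfs as expected shortfalls. -/

section OnInterval

variable {c d : ℝ} {μ : Measure ℝ}

lemma ae_mem_Icc (hμ : μ (Icc c d)ᶜ = 0) : ∀ᵐ t ∂μ, t ∈ Icc c d := by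
  rw [ae_iff]; exact hμ

lemma ContinuousOn.integrable_of_compl_Icc [IsFiniteMeasure μ] {f : ℝ → ℝ}
    (hf : ContinuousOn f (Icc c d)) (hμ : μ (Icc c d)ᶜ = 0) : Integrable f μ := by
  have h := hf.integrableOn_compact (μ := μ) isCompact_Icc
  rwa [IntegrableOn, Measure.restrict_eq_self_of_ae_mem (ae_mem_Icc hμ)] at h

/-- Fubini: the cdf at t is the mean of the indicator of s ≤ t, and integrating that indicator over
t in (c, y] leaves the positive part of y - s. -/
lemma integral_cdf_eq [IsProbabilityMeasure μ] (hμ : μ (Icc c d)ᶜ = 0) {y : ℝ} (hy : c ≤ y) :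
    ∫ t in c..y, ProbabilityTheory.cdf μ t = ∫ s, max (y - s) 0 ∂μ := by
  rw [intervalIntegral.integral_of_le hy]
  have h1 : ∀ t, ProbabilityTheory.cdf μ t = ∫ s, (Iic t).indicator (fun _ => (1 : ℝ)) s ∂μ := by
    intro t
    rw [ProbabilityTheory.cdf_eq_real, integral_indicator measurableSet_Iic]
    simp
  simp_rw [h1]
  rw [integral_integral_swap]
  · refine integral_congr_ae ?_
    filter_upwards [ae_mem_Icc hμ] with s hs
    have h2 : ∀ t, (Iic t).indicator (fun _ => (1 : ℝ)) s = (Ici s).indicator 1 t := by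
      intro t
      by_cases h : s ≤ t <;> simp [indicator, h]
    simp_rw [h2]
    rw [integral_indicator measurableSet_Ici, Measure.restrict_restrict measurableSet_Ici]
    simp only [Pi.one_apply, integral_const, MeasurableSet.univ, measureReal_restrict_apply,
      univ_inter, smul_eq_mul, mul_one]
    rcases hs.1.eq_or_lt with rfl | hcs
    · have : Ici c ∩ Ioc c y = Ioc c y := by
        ext t; simp only [mem_inter_iff, mem_Ici, mem_Ioc]; constructor
        · exact fun h => h.2
        · exact fun h => ⟨h.1.le, h⟩
      rw [this, Real.volume_real_Ioc]
    · have : Ici s ∩ Ioc c y = Icc s y := by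
        ext t; simp only [mem_inter_iff, mem_Ici, mem_Ioc, mem_Icc]; constructor
        · exact fun h => ⟨h.1, h.2.2⟩
        · exact fun h => ⟨h.1, hcs.trans_le h.1, h.2⟩
      rw [this, Real.volume_real_Icc]
  · refine Integrable.of_bound (C := 1) ?_ (ae_of_all _ fun p => ?_)
    · refine Measurable.aestronglyMeasurable ?_
      have : Function.uncurry (fun (t s : ℝ) => (Iic t).indicator (fun _ => (1 : ℝ)) s) =
          {p : ℝ × ℝ | p.2 ≤ p.1}.indicator (fun _ => (1 : ℝ)) := by
        ext p; simp [indicator, Function.uncurry]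
      rw [this]
      exact measurable_const.indicator (measurableSet_le measurable_snd measurable_fst)
    · simp only [Function.uncurry, indicator]
      split_ifs <;> simp

end OnInterval

/-! ### Splittings of a distribution into workforces. -/

section Splitting

variable {c d : ℝ} {G H : Measure ℝ}

lemma measurable_lintegral_real (f : ℝ → ℝ) (hf : Measurable f) :
    Measurable fun η : Measure ℝ => (∫⁻ y, ENNReal.ofReal (f y) ∂η).toReal :=
  (Measure.measurable_lintegral hf.ennreal_ofReal).ennreal_toReal

/-- Integration against the average of a distribution of measures. -/
lemma integral_join_of_nonneg_bounded {τ : Measure (Measure ℝ)} [IsFiniteMeasure τ]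
    (hτ : ∀ᵐ η ∂τ, IsProbabilityMeasure η) {f : ℝ → ℝ} (hf : Measurable f) {C : ℝ}
    (h0 : ∀ y, 0 ≤ f y) (hC : ∀ y, f y ≤ C) :
    Integrable (fun η => ∫ y, f y ∂η) τ ∧ ∫ η, ∫ y, f y ∂η ∂τ = ∫ y, f y ∂τ.join := by
  have hreal : ∀ η : Measure ℝ, ∫ y, f y ∂η = (∫⁻ y, ENNReal.ofReal (f y) ∂η).toReal := fun η =>
    integral_eq_lintegral_of_nonneg_ae (ae_of_all _ h0) hf.aestronglyMeasurable
  have hle : ∀ᵐ η ∂τ, ∫⁻ y, ENNReal.ofReal (f y) ∂η ≤ ENNReal.ofReal C := by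
    filter_upwards [hτ] with η hη
    calc ∫⁻ y, ENNReal.ofReal (f y) ∂η ≤ ∫⁻ _, ENNReal.ofReal C ∂η :=
          lintegral_mono fun y => ENNReal.ofReal_le_ofReal (hC y)
      _ = ENNReal.ofReal C := by simp
  simp_rw [hreal]
  constructor
  · refine Integrable.of_bound (C := (ENNReal.ofReal C).toReal)
      (measurable_lintegral_real f hf).aestronglyMeasurable ?_
    filter_upwards [hle] with η hη
    rw [Real.norm_of_nonneg ENNReal.toReal_nonneg]
    exact ENNReal.toReal_mono ENNReal.ofReal_ne_top hη
  · rw [integral_toReal (Measure.measurable_lintegral hf.ennreal_ofReal).aemeasurable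
      (hle.mono fun η hη => hη.trans_lt ENNReal.ofReal_lt_top),
      Measure.lintegral_join hf.ennreal_ofReal.aemeasurable]

/-- A splitting of `G` with distribution of means `H`, in terms of integrals of continuous
functions. -/
structure IsSplitting (c d : ℝ) (G H : Measure ℝ) (τ : Measure (Measure ℝ)) : Prop where
  ae_mem : ∀ᵐ η ∂τ, IsProbabilityMeasure η ∧ η (Icc c d)ᶜ = 0 ∧ ∫ y, y ∂η ∈ Icc c d
  integrable : ∀ f : ℝ → ℝ, ContinuousOn f (Icc c d) → Integrable (fun η => ∫ y, f y ∂η) τ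
  integral_eq : ∀ f : ℝ → ℝ, ContinuousOn f (Icc c d) →
    ∫ η, ∫ y, f y ∂η ∂τ = ∫ y, f y ∂G
  integrable_mean : ∀ f : ℝ → ℝ, ContinuousOn f (Icc c d) →
    Integrable (fun η => f (∫ y, y ∂η)) τ
  integral_mean : ∀ f : ℝ → ℝ, ContinuousOn f (Icc c d) →
    ∫ η, f (∫ y, y ∂η) ∂τ = ∫ y, f y ∂H

lemma integral_mem_Icc {η : Measure ℝ} [IsProbabilityMeasure η] (hη : η (Icc c d)ᶜ = 0) :
    ∫ y, y ∂η ∈ Icc c d :=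
  (convex_Icc c d).integral_mem isClosed_Icc (ae_mem_Icc hη)
    (continuousOn_id.integrable_of_compl_Icc hη)

lemma IsSplittingMeans.compl_eq_zero (h : IsSplittingMeans c d G H) [IsProbabilityMeasure H] :
    G (Icc c d)ᶜ = 0 ∧ H (Icc c d)ᶜ = 0 := by
  obtain ⟨τ, hτ, hae, hG, hH⟩ := h
  -- `Measure.map` along a map that is not a.e. measurable is the zero measure, which cannot be a
  -- probability.
  have hmeas : AEMeasurable (fun η : Measure ℝ => ∫ y, y ∂η) τ := by
    by_contra hn
    rw [Measure.map_of_not_aemeasurable hn] at hH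
    exact IsProbabilityMeasure.ne_zero H hH.symm
  constructor
  · rw [← hG, Measure.join_apply measurableSet_Icc.compl, lintegral_eq_zero_iff
      (Measure.measurable_coe measurableSet_Icc.compl)]
    exact hae.mono fun η hη => hη.2
  · rw [← hH, Measure.map_apply_of_aemeasurable hmeas measurableSet_Icc.compl]
    change τ {η | ¬ (∫ y, y ∂η ∈ Icc c d)} = 0
    rw [← ae_iff]
    exact hae.mono fun η hη => haveI := hη.1; integral_mem_Icc hη.2

lemma IsSplittingMeans.exists_isSplitting (hcd : c ≤ d) (h : IsSplittingMeans c d G H)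
    [IsProbabilityMeasure H] : ∃ τ, IsProbabilityMeasure τ ∧ IsSplitting c d G H τ := by
  obtain ⟨hG0, hH0⟩ := h.compl_eq_zero
  obtain ⟨τ, hτ, hae, hG, hH⟩ := h
  have hmeas : AEMeasurable (fun η : Measure ℝ => ∫ y, y ∂η) τ := by
    by_contra hn
    rw [Measure.map_of_not_aemeasurable hn] at hH
    exact IsProbabilityMeasure.ne_zero H hH.symm
  have hae' : ∀ᵐ η ∂τ, IsProbabilityMeasure η ∧ η (Icc c d)ᶜ = 0 ∧ ∫ y, y ∂η ∈ Icc c d :=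
    hae.mono fun η hη => ⟨hη.1, hη.2, haveI := hη.1; integral_mem_Icc hη.2⟩
  have hGp : IsProbabilityMeasure G := by
    refine ⟨?_⟩
    rw [← hG, Measure.join_apply MeasurableSet.univ]
    calc ∫⁻ η, η univ ∂τ = ∫⁻ _, 1 ∂τ :=
          lintegral_congr_ae (hae.mono fun η hη => haveI := hη.1; measure_univ)
      _ = 1 := by simp
  have key : ∀ f : ℝ → ℝ, ContinuousOn f (Icc c d) →
      Integrable (fun η => ∫ y, f y ∂η) τ ∧ ∫ η, ∫ y, f y ∂η ∂τ = ∫ y, f y ∂G := by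
    intro f hf
    obtain ⟨C, hC⟩ := isCompact_Icc.exists_bound_of_continuousOn hf
    -- Extending f constantly beyond [c, d] and lifting it by its bound C gives the nonnegative
    -- bounded function that `integral_join_of_nonneg_bounded` requires.
    set g : ℝ → ℝ := fun y => f (projIcc c d hcd y) + C with hg
    have hgc : Continuous g := (hf.domRestrict.comp continuous_projIcc).add continuous_const
    have hCg : ∀ y, |f (projIcc c d hcd y)| ≤ C := fun y =>
      hC _ (projIcc c d hcd y).2
    have hgf : ∀ y ∈ Icc c d, g y = f y + C := fun y hy => by
      simp only [hg, projIcc_of_mem hcd hy]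
    have hgη : ∀ η : Measure ℝ, IsProbabilityMeasure η → η (Icc c d)ᶜ = 0 →
        ∫ y, g y ∂η = ∫ y, f y ∂η + C := fun η _ hη => by
      rw [integral_congr_ae ((ae_mem_Icc hη).mono hgf),
        integral_add (hf.integrable_of_compl_Icc hη) (integrable_const C)]
      simp
    obtain ⟨h1, h2⟩ := integral_join_of_nonneg_bounded (τ := τ) (hae.mono fun η hη => hη.1)
      hgc.measurable (C := 2 * C) (fun y => by simp only [hg]; linarith [neg_le_of_abs_le (hCg y)])
      (fun y => by simp only [hg]; linarith [le_of_abs_le (hCg y)])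
    have hcongr : (fun η => ∫ y, f y ∂η) =ᵐ[τ] fun η => ∫ y, g y ∂η - C :=
      hae.mono fun η hη => by
        have := hgη η hη.1 hη.2
        simp only; linarith
    refine ⟨(h1.sub (integrable_const C)).congr hcongr.symm, ?_⟩
    rw [integral_congr_ae hcongr, integral_sub h1 (integrable_const C), h2, hG, hgη G hGp hG0]
    simp
  refine ⟨τ, hτ, hae', fun f hf => (key f hf).1, fun f hf => (key f hf).2, fun f hf => ?_,
    fun f hf => ?_⟩
  · have := hf.integrable_of_compl_Icc hH0
    rw [← hH] at this
    exact this.comp_aemeasurable hmeas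
  · have := hf.integrable_of_compl_Icc hH0
    rw [← hH] at this ⊢
    exact (integral_map hmeas this.aestronglyMeasurable).symm

end Splitting

/-! ### Jensen's inequality and affine wages on pooling regions. -/

section Jensen

variable {c d : ℝ} {G H : Measure ℝ} {τ : Measure (Measure ℝ)} {q : ℝ → ℝ}

lemma IsSplitting.ae_jensen (h : IsSplitting c d G H τ) (hq : ConvexOn ℝ (Icc c d) q)
    (hc : ContinuousOn q (Icc c d)) : ∀ᵐ η ∂τ, q (∫ y, y ∂η) ≤ ∫ y, q y ∂η := by
  filter_upwards [h.ae_mem] with η ⟨hη, hη0, _⟩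
  exact hq.map_integral_le hc isClosed_Icc (ae_mem_Icc hη0)
    (continuousOn_id.integrable_of_compl_Icc hη0) (hc.integrable_of_compl_Icc hη0)

lemma IsSplitting.integral_le (h : IsSplitting c d G H τ) (hq : ConvexOn ℝ (Icc c d) q)
    (hc : ContinuousOn q (Icc c d)) : ∫ y, q y ∂H ≤ ∫ y, q y ∂G := by
  rw [← h.integral_mean q hc, ← h.integral_eq q hc]
  exact integral_mono_ae (h.integrable_mean q hc) (h.integrable q hc) (h.ae_jensen hq hc)

/-- The Jensen gap of each workforce is nonnegative, and these gaps average to zero. -/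
lemma IsSplitting.ae_eq_of_integral_eq (h : IsSplitting c d G H τ)
    (hq : ConvexOn ℝ (Icc c d) q) (hc : ContinuousOn q (Icc c d))
    (heq : ∫ y, q y ∂H = ∫ y, q y ∂G) : ∀ᵐ η ∂τ, ∫ y, q y ∂η = q (∫ y, y ∂η) := by
  have h0 : ∫ η, (∫ y, q y ∂η - q (∫ y, y ∂η)) ∂τ = 0 := by
    rw [integral_sub (h.integrable q hc) (h.integrable_mean q hc), h.integral_mean q hc,
      h.integral_eq q hc, heq, sub_self]
  have hnn : 0 ≤ᵐ[τ] fun η => ∫ y, q y ∂η - q (∫ y, y ∂η) :=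
    (h.ae_jensen hq hc).mono fun η hη => sub_nonneg.2 hη
  filter_upwards [(integral_eq_zero_iff_of_nonneg_ae hnn
    ((h.integrable q hc).sub (h.integrable_mean q hc))).1 h0] with η hη
  simpa [sub_eq_zero] using hη

lemma convexOn_max_sub (s : Set ℝ) (hs : Convex ℝ s) (y : ℝ) :
    ConvexOn ℝ s fun t => max (y - t) 0 :=
  ((convexOn_const y hs).sub (concaveOn_id hs)).sup (convexOn_const 0 hs)

lemma continuous_max_sub (y : ℝ) : Continuous fun t : ℝ => max (y - t) 0 := by fun_prop

lemma IsSplitting.integral_id (h : IsSplitting c d G H τ) : ∫ y, y ∂H = ∫ y, y ∂G := by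
  rw [← h.integral_mean (fun y => y) continuousOn_id, ← h.integral_eq (fun y => y) continuousOn_id]

/-- A Lipschitz convex function on an interval has a subgradient at every point. -/
lemma ConvexOn.exists_subgradient {K : NNReal} (hq : ConvexOn ℝ (Icc c d) q)
    (hK : LipschitzOnWith K q (Icc c d)) {m : ℝ} (hm : m ∈ Icc c d) :
    ∃ l : ℝ, ∀ y ∈ Icc c d, q m + l * (y - m) ≤ q y := by
  have habs : ∀ y ∈ Icc c d, |q y - q m| ≤ K * |y - m| := fun y hy => by
    simpa [Real.dist_eq] using hK.dist_le_mul y hy m hm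
  rcases hm.1.eq_or_lt with rfl | hcm
  · refine ⟨-K, fun y hy => ?_⟩
    have := neg_le_of_abs_le (habs y hy)
    rw [abs_of_nonneg (sub_nonneg.2 hy.1)] at this
    linarith
  rcases hm.2.eq_or_lt with rfl | hmd
  · refine ⟨K, fun y hy => ?_⟩
    have := neg_le_of_abs_le (habs y hy)
    rw [abs_of_nonpos (sub_nonpos.2 hy.2)] at this
    linarith
  have hkey : ∀ y ∈ Ioc m d, ∀ x ∈ Ico c m, slope q m x ≤ slope q m y := fun y hy x hx => by
    rw [slope_comm q m x]
    simp only [slope_def_field]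
    exact hq.slope_mono_adjacent ⟨hx.1, hx.2.le.trans hm.2⟩ ⟨hm.1.trans hy.1.le, hy.2⟩ hx.2 hy.1
  have hbdd : BddAbove (slope q m '' Ico c m) :=
    ⟨slope q m d, by rintro _ ⟨x, hx, rfl⟩; exact hkey d ⟨hmd, le_rfl⟩ x hx⟩
  -- The supremum of the slopes to the left of m is below every slope to its right.
  refine ⟨sSup (slope q m '' Ico c m), fun y hy => ?_⟩
  rcases lt_trichotomy y m with h | rfl | h
  · have := le_csSup hbdd (mem_image_of_mem (slope q m) (⟨hy.1, h⟩ : y ∈ Ico c m))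
    rw [slope_def_field, div_le_iff_of_neg (by linarith)] at this
    linarith
  · simp
  · have : sSup (slope q m '' Ico c m) ≤ slope q m y :=
      csSup_le ⟨_, mem_image_of_mem _ ⟨le_rfl, hcm⟩⟩
        (by rintro _ ⟨x, hx, rfl⟩; exact hkey y ⟨h, hy.2⟩ x hx)
    rw [slope_def_field, le_div_iff₀ (by linarith)] at this
    linarith

/-- If the convex function `q` has the same integral under `G` and its mean-preserving
contraction `H`, then it is affine around every point where the integrated cdfs differ. -/
lemma IsSplitting.exists_affine_piece [IsProbabilityMeasure τ] {K : NNReal}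
    (h : IsSplitting c d G H τ)
    (hq : ConvexOn ℝ (Icc c d) q) (hK : LipschitzOnWith K q (Icc c d))
    (heq : ∫ y, q y ∂H = ∫ y, q y ∂G) {w : ℝ}
    (hw : ∫ y, max (w - y) 0 ∂H < ∫ y, max (w - y) 0 ∂G) :
    ∃ s t l m : ℝ, w ∈ Ioo s t ∧ (∀ y ∈ Icc c d, q m + l * (y - m) ≤ q y) ∧
      ∀ y ∈ Icc s t, q y = q m + l * (y - m) := by
  have hk : ContinuousOn (fun t : ℝ => max (w - t) 0) (Icc c d) :=
    (continuous_max_sub w).continuousOn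
  -- Jensen is an equality for q in almost every workforce, while the strict inequality at w says
  -- that for a non-null set of workforces it is strict for the kinked function. One η has both
  -- properties.
  obtain ⟨η, ⟨hη, hη0, hm⟩, hηq, hηw⟩ : ∃ η : Measure ℝ,
      (IsProbabilityMeasure η ∧ η (Icc c d)ᶜ = 0 ∧ ∫ y, y ∂η ∈ Icc c d) ∧
      ∫ y, q y ∂η = q (∫ y, y ∂η) ∧ max (w - ∫ y, y ∂η) 0 < ∫ y, max (w - y) 0 ∂η := by
    by_contra! hcon
    refine hw.not_ge ?_
    rw [← h.integral_mean _ hk, ← h.integral_eq _ hk]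
    refine integral_mono_ae (h.integrable _ hk) (h.integrable_mean _ hk) ?_
    filter_upwards [h.ae_mem, h.ae_eq_of_integral_eq hq hK.continuousOn heq] with η h1 h2
    exact hcon η h1 h2
  set m := ∫ y, y ∂η with hmdef
  obtain ⟨l, hl⟩ := hq.exists_subgradient hK hm
  have hqi := hK.continuousOn.integrable_of_compl_Icc hη0
  have hidi : Integrable (fun y : ℝ => y) η := continuousOn_id.integrable_of_compl_Icc hη0
  have hlm : Integrable (fun y => l * (y - m)) η := (hidi.sub (integrable_const m)).const_mul l
  have hli : Integrable (fun y => q m + l * (y - m)) η :=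
    (integrable_const _).add hlm
  have hlint : ∫ y, (q m + l * (y - m)) ∂η = q m := by
    rw [integral_add (integrable_const _) hlm, integral_const_mul,
      integral_sub hidi (integrable_const m), ← hmdef]
    simp
  -- The distance from q to its supporting line at the mean is nonnegative with zero η-integral, so
  -- η lives on the contact set.
  have hae : ∀ᵐ y ∂η, q y = q m + l * (y - m) := by
    have h0 : ∫ y, (q y - (q m + l * (y - m))) ∂η = 0 := by
      rw [integral_sub hqi hli, hlint, hηq, sub_self]
    have hnn : 0 ≤ᵐ[η] fun y => q y - (q m + l * (y - m)) :=
      (ae_mem_Icc hη0).mono fun y hy => sub_nonneg.2 (hl y hy)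
    filter_upwards [(integral_eq_zero_iff_of_nonneg_ae hnn (hqi.sub hli)).1 h0] with y hy
    simpa [sub_eq_zero] using hy
  -- Without contact points below w the kinked function would vanish η-a.e.; without contact points
  -- above w it would be affine η-a.e. Neither allows strict Jensen.
  obtain ⟨s, hs, hsw, hsq⟩ : ∃ s ∈ Icc c d, s < w ∧ q s = q m + l * (s - m) := by
    by_contra! hcon
    have : ∫ y, max (w - y) 0 ∂η = 0 := by
      refine integral_eq_zero_of_ae ?_
      filter_upwards [ae_mem_Icc hη0, hae] with y hy hyq
      have : w ≤ y := not_lt.1 fun hlt => hcon y hy hlt hyq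
      simpa using this
    rw [this] at hηw
    exact (le_max_right _ _).not_gt hηw
  obtain ⟨t, ht, htw, htq⟩ : ∃ t ∈ Icc c d, w < t ∧ q t = q m + l * (t - m) := by
    by_contra! hcon
    have : ∫ y, max (w - y) 0 ∂η = w - m := by
      rw [hmdef, integral_congr_ae (g := fun y => w - y), integral_sub (integrable_const _) hidi]
      · simp
      filter_upwards [ae_mem_Icc hη0, hae] with y hy hyq
      have : y ≤ w := not_lt.1 fun hlt => hcon y hy hlt hyq
      simpa using this
    rw [this] at hηw
    exact (le_max_left _ _).not_gt hηw
  refine ⟨s, t, l, m, ⟨hsw, htw⟩, hl, fun y hy => le_antisymm ?_ (hl y ⟨hs.1.trans hy.1,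
    hy.2.trans ht.2⟩)⟩
  -- Convexity keeps q below the chord from s to t, and this chord is the supporting line.
  have hst : 0 < t - s := by linarith
  have h1 := hq.2 hs ht (div_nonneg (sub_nonneg.2 hy.2) hst.le)
    (div_nonneg (sub_nonneg.2 hy.1) hst.le) (by field_simp; ring)
  have h2 : (t - y) / (t - s) * s + (y - s) / (t - s) * t = y := by field_simp; ring
  simp only [smul_eq_mul] at h1
  rw [h2, hsq, htq] at h1
  calc q y ≤ _ := h1
    _ = q m + l * (y - m) := by field_simp; ring

/-- Around each point of the interval q is affine, so `deriv q` is locally constant there and, by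
connectedness, constant. -/
lemma IsSplitting.exists_common_subgradient [IsProbabilityMeasure τ] {K : NNReal}
    (h : IsSplitting c d G H τ)
    (hq : ConvexOn ℝ (Icc c d) q) (hK : LipschitzOnWith K q (Icc c d))
    (heq : ∫ y, q y ∂H = ∫ y, q y ∂G) {y₀ y₁ : ℝ}
    (hw : ∀ w ∈ Ioo y₀ y₁, ∫ y, max (w - y) 0 ∂H < ∫ y, max (w - y) 0 ∂G) :
    ∃ l : ℝ, ∀ w ∈ Ioo y₀ y₁, ∀ y ∈ Icc c d, q w + l * (y - w) ≤ q y := by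
  have hloc : ∀ w ∈ Ioo y₀ y₁, (∀ᶠ w' in nhds w, deriv q w' = deriv q w) ∧
      ∀ y ∈ Icc c d, q w + deriv q w * (y - w) ≤ q y := fun w hwI => by
    obtain ⟨s, t, l, m, hwst, hl, haff⟩ := h.exists_affine_piece hq hK heq (hw w hwI)
    have hd : ∀ w' ∈ Ioo s t, deriv q w' = l := fun w' hw' => by
      have h1 : HasDerivAt (fun y => q m + l * (y - m)) l w' := by
        simpa using (((hasDerivAt_id w').sub_const m).const_mul l).const_add (q m)
      exact (h1.congr_of_eventuallyEq ((Ioo_mem_nhds hw'.1 hw'.2 : Ioo s t ∈ nhds w')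
        |> Filter.eventually_of_mem <| fun y hy => haff y (Ioo_subset_Icc_self hy))).deriv
    refine ⟨Filter.eventually_of_mem (Ioo_mem_nhds hwst.1 hwst.2) fun w' hw' => by
      rw [hd w' hw', hd w hwst], fun y hy => ?_⟩
    have h1 := haff w (Ioo_subset_Icc_self hwst)
    rw [hd w hwst, h1]
    linarith [hl y hy]
  have hdd : ∀ w ∈ Ioo y₀ y₁, HasDerivAt (deriv q) 0 w := fun w hwI =>
    (hasDerivAt_const w (deriv q w)).congr_of_eventuallyEq (hloc w hwI).1
  rcases (Ioo y₀ y₁).eq_empty_or_nonempty with he | ⟨w₀, hw₀⟩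
  · exact ⟨0, fun w hwI => by simp [he] at hwI⟩
  refine ⟨deriv q w₀, fun w hwI => ?_⟩
  rw [isOpen_Ioo.is_const_of_deriv_eq_zero isPreconnected_Ioo
    (fun w hwI => (hdd w hwI).differentiableAt.differentiableWithinAt)
    (fun w hwI => (hdd w hwI).deriv) hw₀ hwI]
  exact (hloc w hwI).2

end Jensen

/-! ### Majorization as an order on expected shortfalls, and crossings of cdfs. -/

section Majorization

variable {c d : ℝ} {A B : Measure ℝ}

lemma integral_max_right [IsProbabilityMeasure A] (hA : A (Icc c d)ᶜ = 0) :
    ∫ s, max (d - s) 0 ∂A = d - ∫ s, s ∂A := by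
  have hidi : Integrable (fun y : ℝ => y) A := continuousOn_id.integrable_of_compl_Icc hA
  rw [integral_congr_ae (g := fun s => d - s), integral_sub (integrable_const _) hidi]
  · simp
  filter_upwards [ae_mem_Icc hA] with s hs
  simpa using hs.2

/-- The integrated cdf at d equals d minus the mean, so the endpoint condition is equality of means.
-/
lemma majorizes_iff (hcd : c ≤ d) [IsProbabilityMeasure A] [IsProbabilityMeasure B]
    (hA : A (Icc c d)ᶜ = 0) (hB : B (Icc c d)ᶜ = 0) :
    Majorizes c d A B ↔ (∀ y ∈ Icc c d, ∫ s, max (y - s) 0 ∂A ≤ ∫ s, max (y - s) 0 ∂B) ∧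
      ∫ s, s ∂A = ∫ s, s ∂B := by
  unfold Majorizes
  rw [integral_cdf_eq hA hcd, integral_cdf_eq hB hcd, integral_max_right hA, integral_max_right hB,
    sub_right_inj]
  refine and_congr_left fun _ => forall₂_congr fun y hy => ?_
  rw [integral_cdf_eq hA hy.1, integral_cdf_eq hB hy.1]

/-- Two distributions with equal means whose integrated cdfs are not ordered one way have cdfs that
cross the other way in an interval on which the integrated cdfs are strictly ordered. -/
lemma exists_crossing [IsProbabilityMeasure A] [IsProbabilityMeasure B]
    (hA : A (Icc c d)ᶜ = 0) (hB : B (Icc c d)ᶜ = 0) (hmean : ∫ s, s ∂A = ∫ s, s ∂B) {w : ℝ}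
    (hwI : w ∈ Icc c d) (hw : ∫ s, max (w - s) 0 ∂A < ∫ s, max (w - s) 0 ∂B) :
    ∃ y₀ y₁ y y' : ℝ, y₀ < y ∧ y < y' ∧ y' < y₁ ∧ c ≤ y₀ ∧ y₁ ≤ d ∧
      (∀ t ∈ Ioo y₀ y₁, ∫ s, max (t - s) 0 ∂A < ∫ s, max (t - s) 0 ∂B) ∧
      ProbabilityTheory.cdf A y < ProbabilityTheory.cdf B y ∧
      ProbabilityTheory.cdf B y' < ProbabilityTheory.cdf A y' := by
  have hint : ∀ (μ : Measure ℝ) (r s : ℝ),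
      IntervalIntegrable (ProbabilityTheory.cdf μ) volume r s := fun μ r s =>
    (ProbabilityTheory.monotone_cdf μ).intervalIntegrable
  set D : ℝ → ℝ := fun y => ∫ t in c..y, (ProbabilityTheory.cdf B t - ProbabilityTheory.cdf A t)
    with hD
  have hDeq : ∀ y, c ≤ y → D y = ∫ s, max (y - s) 0 ∂B - ∫ s, max (y - s) 0 ∂A := fun y hy => by
    simp only [hD]
    rw [intervalIntegral.integral_sub (hint B c y) (hint A c y), integral_cdf_eq hA hy,
      integral_cdf_eq hB hy]
  have hDc : Continuous D :=
    intervalIntegral.continuous_primitive (fun r s => (hint B r s).sub (hint A r s)) c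
  have hcd : c ≤ d := hwI.1.trans hwI.2
  have hDw : 0 < D w := by rw [hDeq w hwI.1]; linarith
  have hD0 : D c = 0 := by simp [hD]
  have hD1 : D d = 0 := by
    rw [hDeq d hcd, integral_max_right hA, integral_max_right hB, hmean]; ring
  -- The endpoints y₀ and y₁ are the points nearest to w on either side with D ≤ 0. D gains from y₀
  -- to w and loses from w to y₁, so its integrand takes each sign on the corresponding side.
  set S := {t | t ∈ Icc c w ∧ D t ≤ 0}
  have hSc : IsCompact S := isCompact_Icc.inter_right (isClosed_le hDc continuous_const)
  obtain ⟨y₀, ⟨hy₀, hDy₀⟩, hmax⟩ := hSc.exists_isGreatest ⟨c, ⟨le_rfl, hwI.1⟩, hD0.le⟩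
  set S' := {t | t ∈ Icc w d ∧ D t ≤ 0}
  have hSc' : IsCompact S' := isCompact_Icc.inter_right (isClosed_le hDc continuous_const)
  obtain ⟨y₁, ⟨hy₁, hDy₁⟩, hmin⟩ := hSc'.exists_isLeast ⟨d, ⟨hwI.2, le_rfl⟩, hD1.le⟩
  have h0w : y₀ < w := lt_of_le_of_ne hy₀.2 fun h => by rw [h] at hDy₀; linarith
  have hw1 : w < y₁ := lt_of_le_of_ne hy₁.1 fun h => by rw [← h] at hDy₁; linarith
  have hpos : ∀ t ∈ Ioo y₀ y₁, 0 < D t := fun t ht => by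
    by_contra! hneg
    rcases le_total t w with h | h
    · exact ht.1.not_ge (hmax ⟨⟨hy₀.1.trans ht.1.le, h⟩, hneg⟩)
    · exact ht.2.not_ge (hmin ⟨⟨h, ht.2.le.trans hy₁.2⟩, hneg⟩)
  have hsub : ∀ r s, D s - D r =
      ∫ t in r..s, (ProbabilityTheory.cdf B t - ProbabilityTheory.cdf A t) := fun r s => by
    simp only [hD]
    rw [intervalIntegral.integral_interval_sub_left] <;>
      exact (hint B _ _).sub (hint A _ _)
  obtain ⟨y, hy, hyc⟩ : ∃ y ∈ Ioo y₀ w,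
      ProbabilityTheory.cdf A y < ProbabilityTheory.cdf B y := by
    by_contra! hcon
    have : D w - D y₀ ≤ 0 := by
      rw [hsub, intervalIntegral.integral_of_le h0w.le, integral_Ioc_eq_integral_Ioo]
      exact setIntegral_nonpos measurableSet_Ioo fun t ht => by linarith [hcon t ht]
    linarith
  obtain ⟨y', hy', hyc'⟩ : ∃ y ∈ Ioo w y₁,
      ProbabilityTheory.cdf B y < ProbabilityTheory.cdf A y := by
    by_contra! hcon
    have : 0 ≤ D y₁ - D w := by
      rw [hsub, intervalIntegral.integral_of_le hw1.le, integral_Ioc_eq_integral_Ioo]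
      exact setIntegral_nonneg measurableSet_Ioo fun t ht => by linarith [hcon t ht]
    linarith
  refine ⟨y₀, y₁, y, y', hy.1, hy.2.trans hy'.1, hy'.2, hy₀.1, hy₁.2, fun t ht => ?_, hyc, hyc'⟩
  have := hpos t ht
  rw [hDeq t (hy₀.1.trans ht.1.le)] at this
  linarith

end Majorization

/-! ### Equilibria described by demand, and sufficiency of the two orders. -/

lemma IsTypeDistribution.compl_eq_zero {a b : ℝ} {μ : Measure ℝ}
    (h : IsTypeDistribution a b μ) : μ (Icc a b)ᶜ = 0 := by
  obtain ⟨_, f, _, _, rfl⟩ := h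
  exact withDensity_absolutelyContinuous _ _ (by simp)

/-- A description of equilibrium in terms of wages and the demand for workforce skill. -/
structure IsSorting (a b c d : ℝ) (v : ℝ → ℝ → ℝ) (F G H : Measure ℝ) (q Z : ℝ → ℝ) : Prop where
  demand : IsDemand a b c d v q Z
  convex : ConvexOn ℝ (Icc c d) q
  lipschitz : ∃ K, LipschitzOnWith K q (Icc c d)
  law : F.map Z = H
  splitting : IsSplittingMeans c d G H
  balance : ∫ z, q z ∂H = ∫ y, q y ∂G

section Sorting

variable {a b c d : ℝ} {v v' : ℝ → ℝ → ℝ} {F G G' H H' : Measure ℝ} {q Z q' Z' : ℝ → ℝ}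

lemma IsDemand.measurable (h : IsDemand a b c d v q Z) : Measurable Z := h.mono.measurable

namespace IsSorting

lemma isProbabilityMeasure [IsProbabilityMeasure F] (h : IsSorting a b c d v F G H q Z) :
    IsProbabilityMeasure H :=
  h.law ▸ Measure.isProbabilityMeasure_map h.demand.measurable.aemeasurable

lemma continuousOn (h : IsSorting a b c d v F G H q Z) : ContinuousOn q (Icc c d) := by
  obtain ⟨K, hK⟩ := h.lipschitz
  exact hK.continuousOn

lemma integral_law (h : IsSorting a b c d v F G H q Z) (f : ℝ → ℝ) (hf : ContinuousOn f (Icc c d))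
    [IsProbabilityMeasure F] : ∫ z, f z ∂H = ∫ x, f (Z x) ∂F := by
  have := h.isProbabilityMeasure
  have hi := hf.integrable_of_compl_Icc h.splitting.compl_eq_zero.2
  rw [← h.law] at hi ⊢
  exact integral_map h.demand.measurable.aemeasurable hi.aestronglyMeasurable

lemma integrable_law (h : IsSorting a b c d v F G H q Z) (f : ℝ → ℝ)
    (hf : ContinuousOn f (Icc c d)) [IsProbabilityMeasure F] :
    Integrable (fun x => f (Z x)) F := by
  have := h.isProbabilityMeasure
  have hi := hf.integrable_of_compl_Icc h.splitting.compl_eq_zero.2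
  rw [← h.law] at hi
  exact hi.comp_aemeasurable h.demand.measurable.aemeasurable

lemma integral_le (hcd : c ≤ d) [IsProbabilityMeasure F] (h : IsSorting a b c d v F G H q Z)
    {k : ℝ → ℝ} (hk : ConvexOn ℝ (Icc c d) k) (hc : ContinuousOn k (Icc c d)) :
    ∫ z, k z ∂H ≤ ∫ y, k y ∂G := by
  have := h.isProbabilityMeasure
  obtain ⟨τ, _, hτ⟩ := h.splitting.exists_isSplitting hcd
  exact hτ.integral_le hk hc

lemma integral_id (hcd : c ≤ d) [IsProbabilityMeasure F] (h : IsSorting a b c d v F G H q Z) :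
    ∫ z, z ∂H = ∫ y, y ∂G := by
  have := h.isProbabilityMeasure
  obtain ⟨τ, _, hτ⟩ := h.splitting.exists_isSplitting hcd
  exact hτ.integral_id

lemma exists_common_subgradient (hcd : c ≤ d) [IsProbabilityMeasure F]
    (h : IsSorting a b c d v F G H q Z) {y₀ y₁ : ℝ}
    (hw : ∀ w ∈ Ioo y₀ y₁, ∫ y, max (w - y) 0 ∂H < ∫ y, max (w - y) 0 ∂G) :
    ∃ l : ℝ, ∀ w ∈ Ioo y₀ y₁, ∀ y ∈ Icc c d, q w + l * (y - w) ≤ q y := by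
  have := h.isProbabilityMeasure
  obtain ⟨τ, _, hτ⟩ := h.splitting.exists_isSplitting hcd
  obtain ⟨K, hK⟩ := h.lipschitz
  exact hτ.exists_common_subgradient h.convex hK h.balance hw

lemma cdf_eq [IsProbabilityMeasure F] (h : IsSorting a b c d v F G H q Z) (y : ℝ) :
    ProbabilityTheory.cdf H y = F.real {x | Z x ≤ y} := by
  have := h.isProbabilityMeasure
  rw [ProbabilityTheory.cdf_eq_real, ← h.law, measureReal_def, measureReal_def,
    Measure.map_apply h.demand.measurable measurableSet_Iic]
  rfl

/-- The slope of wages on an interval of pooled workers bounds the marginal returns of the firms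
demanding higher, respectively lower, skills. -/
lemma le_marginalReturn (hcd : c < d) (hv : IsProductionFunction a b c d v)
    (h : IsSorting a b c d v F G H q Z) {l w x : ℝ} (hw : w ∈ Icc c d)
    (hl : ∀ y ∈ Icc c d, q w + l * (y - w) ≤ q y) (hx : x ∈ Icc a b) (hwx : w < Z x) :
    l ≤ marginalReturn c d v x (Z x) := by
  have h1 := marginalReturn_mul_le hcd hv h.convex hx (h.demand.mem x) (h.demand.max x hx) hw
  nlinarith [hl _ (h.demand.mem x)]

lemma marginalReturn_le (hcd : c < d) (hv : IsProductionFunction a b c d v)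
    (h : IsSorting a b c d v F G H q Z) {l w x : ℝ} (hw : w ∈ Icc c d)
    (hl : ∀ y ∈ Icc c d, q w + l * (y - w) ≤ q y) (hx : x ∈ Icc a b) (hwx : Z x < w) :
    marginalReturn c d v x (Z x) ≤ l := by
  have h1 := marginalReturn_mul_le hcd hv h.convex hx (h.demand.mem x) (h.demand.max x hx) hw
  nlinarith [hl _ (h.demand.mem x)]

end IsSorting

lemma exists_mem_of_measureReal_lt [IsProbabilityMeasure F] (hF : F (Icc a b)ᶜ = 0) {S T : Set ℝ}
    (h : F.real S < F.real T) : ∃ x ∈ Icc a b, x ∈ T ∧ x ∉ S := by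
  by_contra! hcon
  refine h.not_ge ?_
  rw [measureReal_def, measureReal_def]
  refine ENNReal.toReal_mono (measure_ne_top F S) (measure_mono_ae ?_)
  filter_upwards [ae_mem_Icc hF] with x hx hxT using hcon x hx hxT

/-- A more complementary production technology, or a more dispersed worker distribution, leads to a
more dispersed workforce distribution. -/
theorem IsSorting.majorizes (hab : a < b) (hcd : c < d) (hv : IsProductionFunction a b c d v)
    (hv' : IsProductionFunction a b c d v') (hmrs : HigherMRS a b c d v' v)
    [IsProbabilityMeasure F] (hF : F (Icc a b)ᶜ = 0) [IsProbabilityMeasure G]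
    [IsProbabilityMeasure G'] (hG : Majorizes c d G G')
    (h : IsSorting a b c d v F G H q Z) (h' : IsSorting a b c d v' F G' H' q' Z') :
    Majorizes c d H H' := by
  have := h.isProbabilityMeasure
  have := h'.isProbabilityMeasure
  obtain ⟨hG0, hH0⟩ := h.splitting.compl_eq_zero
  obtain ⟨hG0', hH0'⟩ := h'.splitting.compl_eq_zero
  rw [majorizes_iff hcd.le hG0 hG0'] at hG
  rw [majorizes_iff hcd.le hH0 hH0']
  have hmean : ∫ s, s ∂H = ∫ s, s ∂H' := by
    rw [h.integral_id hcd.le, h'.integral_id hcd.le, hG.2]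
  refine ⟨fun w hw => ?_, hmean⟩
  by_contra! hlt
  obtain ⟨y₀, y₁, y, y', hy₀, hyy, hy₁, hc, hd, hslack, hcdf, hcdf'⟩ :=
    exists_crossing hH0' hH0 hmean.symm hw hlt
  -- Integrated cdfs satisfy H' < H ≤ G ≤ G' on the interval, so the constraint of the primed
  -- equilibrium is slack and q' has a single slope there.
  obtain ⟨l, hl⟩ := h'.exists_common_subgradient hcd.le (y₀ := y₀) (y₁ := y₁) fun w hw =>
    (hslack w hw).trans_le ((h.integral_le hcd.le (convexOn_max_sub _ (convex_Icc c d) w)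
      (continuous_max_sub w).continuousOn).trans
      (hG.1 w ⟨hc.trans hw.1.le, hw.2.le.trans hd⟩))
  rw [h.cdf_eq, h'.cdf_eq] at hcdf hcdf'
  -- The two cdf gaps give firms with Z x₁ ≤ y < Z' x₁ and Z' x₂ ≤ y' < Z x₂.
  obtain ⟨x₁, hx₁, hZ₁, hZ₁'⟩ := exists_mem_of_measureReal_lt hF hcdf
  obtain ⟨x₂, hx₂, hZ₂', hZ₂⟩ := exists_mem_of_measureReal_lt hF hcdf'
  simp only [mem_ofPred_eq, not_le] at hZ₁ hZ₁' hZ₂ hZ₂'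
  have hZ : Z x₁ < Z x₂ := by linarith
  have hx : x₁ ≤ x₂ := le_of_lt (h.demand.mono.reflect_lt hZ)
  have e1 : marginalReturn c d v x₁ (Z x₁) ≤ marginalReturn c d v x₂ (Z x₂) :=
    marginalReturn_le_of_lt hcd hv h.convex hx₁ (h.demand.mem _) hx₂ (h.demand.mem _)
      (h.demand.max x₁ hx₁) (h.demand.max x₂ hx₂) hZ
  have e2 := hmrs x₁ hx₁ x₂ hx₂ _ (h.demand.mem x₁) _ (h.demand.mem x₂) hx hZ.le e1
  have e3 := hv'.marginalReturn_lt_of_lt hab hcd hx₁ (h.demand.mem x₁) (h'.demand.mem x₁)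
    (by linarith)
  have e4 := hv'.marginalReturn_lt_of_lt hab hcd hx₂ (h'.demand.mem x₂) (h.demand.mem x₂)
    (by linarith)
  have hyI : y ∈ Ioo y₀ y₁ := ⟨hy₀, hyy.trans hy₁⟩
  -- `marginalReturn_le` needs a point strictly above Z' x₂, which may equal y'; the midpoint
  -- serves.
  have hyI' : (y' + y₁) / 2 ∈ Ioo y₀ y₁ := ⟨by linarith, by linarith⟩
  have e5 := h'.le_marginalReturn hcd hv' ⟨by linarith, by linarith⟩ (hl y hyI) hx₁ hZ₁'
  have e6 := h'.marginalReturn_le hcd hv' ⟨by linarith, by linarith⟩ (hl _ hyI') hx₂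
    (by linarith)
  linarith

lemma HigherMRS.refl (a b c d : ℝ) (v : ℝ → ℝ → ℝ) : HigherMRS a b c d v v :=
  fun _ _ _ _ _ _ _ _ _ _ h => h

lemma Majorizes.refl (c d : ℝ) (G : Measure ℝ) : Majorizes c d G G := ⟨fun _ _ => le_rfl, rfl⟩

end Sorting

/-! ### Passage between equilibria and demand; uniqueness. -/

section Equilibrium

variable {a b c d : ℝ} {v : ℝ → ℝ → ℝ} {F G H : Measure ℝ} {q Z q' Z' : ℝ → ℝ}

lemma ae_mem_box {J : Measure (ℝ × ℝ)} [IsProbabilityMeasure J]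
    (h₁ : (J.map Prod.fst) (Icc a b)ᶜ = 0) (h₂ : (J.map Prod.snd) (Icc c d)ᶜ = 0) :
    ∀ᵐ w ∂J, w ∈ Icc a b ×ˢ Icc c d := by
  rw [Measure.map_apply measurable_fst measurableSet_Icc.compl] at h₁
  rw [Measure.map_apply measurable_snd measurableSet_Icc.compl] at h₂
  have e1 : ∀ᵐ w ∂J, w.1 ∈ Icc a b := by rw [ae_iff]; exact h₁
  have e2 : ∀ᵐ w ∂J, w.2 ∈ Icc c d := by rw [ae_iff]; exact h₂
  filter_upwards [e1, e2] with w h1 h2 using ⟨h1, h2⟩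

lemma ContinuousOn.integrable_of_ae_mem_box {J : Measure (ℝ × ℝ)} [IsFiniteMeasure J]
    {u : ℝ × ℝ → ℝ} (hu : ContinuousOn u (Icc a b ×ˢ Icc c d))
    (hJ : ∀ᵐ w ∂J, w ∈ Icc a b ×ˢ Icc c d) : Integrable u J := by
  have h := hu.integrableOn_compact (μ := J) (isCompact_Icc.prod isCompact_Icc)
  rwa [IntegrableOn, Measure.restrict_eq_self_of_ae_mem hJ] at h

/-- On the support of J both w.2 and Z w.1 are optimal for the firm w.1, so the quadratic gap
identifies them and J is carried by the graph of Z. -/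
theorem IsEquilibriumWorkforceDistribution.exists_isSorting (hab : a < b) (hcd : c < d)
    (hv : IsProductionFunction a b c d v) [IsProbabilityMeasure F] (hF : F (Icc a b)ᶜ = 0)
    (h : IsEquilibriumWorkforceDistribution a b c d v F G H) :
    ∃ q Z, IsSorting a b c d v F G H q Z := by
  obtain ⟨J, p, q, hJ, hH⟩ := h
  obtain ⟨hJF, hJG⟩ := hJ.assignment
  obtain ⟨K, hK⟩ := hJ.lipschitz_wage
  obtain ⟨Z, hZ⟩ := exists_isDemand hab hcd hv hK.continuousOn
  obtain ⟨κ, hκ, hgap⟩ := exists_isDemand_gap hab hcd hv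
  have hJp : IsProbabilityMeasure J := by
    refine ⟨?_⟩
    have : F univ = 1 := measure_univ
    rwa [← hJF, Measure.map_apply measurable_fst MeasurableSet.univ] at this
  have hHp : IsProbabilityMeasure H :=
    hH ▸ Measure.isProbabilityMeasure_map measurable_snd.aemeasurable
  rw [hH] at hJG
  have hbox : ∀ᵐ w ∂J, w ∈ Icc a b ×ˢ Icc c d :=
    ae_mem_box (by rwa [hJF]) (by rw [hH]; exact hJG.compl_eq_zero.2)
  have hae : Prod.snd =ᵐ[J] fun w => Z w.1 := by
    filter_upwards [hbox, Measure.support_mem_ae (μ := J)] with w hw hws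
    have h1 := hJ.eq_on_support w hws
    have h2 := hJ.no_profitable_deviation w.1 hw.1 _ (hZ.mem w.1)
    have h3 := hgap q Z hJ.convex_wage hZ w.1 hw.1 w.2 hw.2
    have h4 : (w.2 - Z w.1) ^ 2 = 0 := le_antisymm (by nlinarith) (sq_nonneg _)
    have := pow_eq_zero_iff (two_ne_zero) |>.1 h4
    linarith
  refine ⟨q, Z, hZ, hJ.convex_wage, ⟨K, hK⟩, ?_, hJG, ?_⟩
  · rw [← hJF, Measure.map_map hZ.measurable measurable_fst, ← hH]
    exact Measure.map_congr hae.symm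
  · rw [← hH]; exact hJ.wage_balance

theorem IsSorting.isEquilibriumWorkforceDistribution
    (hv : IsProductionFunction a b c d v) [IsProbabilityMeasure F] (hF : F (Icc a b)ᶜ = 0)
    (h : IsSorting a b c d v F G H q Z) :
    IsEquilibriumWorkforceDistribution a b c d v F G H := by
  obtain ⟨L, hL, -, hLx⟩ := hv.exists_lipschitz_const
  have hZm := h.demand.measurable
  have hm : Measurable fun x => (x, Z x) := measurable_id.prodMk hZm
  set p : ℝ → ℝ := fun x => v x (Z x) - q (Z x) with hp
  have hfst : (F.map fun x => (x, Z x)).map Prod.fst = F := by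
    rw [Measure.map_map measurable_fst hm]; exact Measure.map_id
  have hsnd : (F.map fun x => (x, Z x)).map Prod.snd = H := by
    rw [Measure.map_map measurable_snd hm]; exact h.law
  -- Envelope argument: firm y can copy the skill chosen by firm x.
  have hplip : LipschitzOnWith ⟨L, hL.le⟩ p (Icc a b) := by
    refine LipschitzOnWith.of_le_add_mul _ fun x hx y hy => ?_
    have h1 := h.demand.max y hy _ (h.demand.mem x)
    have h2 := (abs_le.1 (hLx x hx y hy _ (h.demand.mem x))).2
    change v x (Z x) - q (Z x) ≤ v y (Z y) - q (Z y) + L * |x - y|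
    linarith
  refine ⟨F.map fun x => (x, Z x), p, q, ⟨⟨hfst, by rw [hsnd]; exact h.splitting⟩, ⟨_, hplip⟩,
    h.lipschitz, ?_, fun x hx z hz => ?_, h.convex, by rw [hsnd]; exact h.balance⟩, hsnd⟩
  -- The zero set of p + q - v in the box is closed and of full measure, hence contains the support;
  -- closedness of the graph of Z is not needed.
  · have hclosed : IsClosed {w | w ∈ Icc a b ×ˢ Icc c d ∧ p w.1 + q w.2 - v w.1 w.2 = 0} := by
      have hc : ContinuousOn (fun w : ℝ × ℝ => p w.1 + q w.2 - v w.1 w.2)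
          (Icc a b ×ˢ Icc c d) :=
        ((hplip.continuousOn.comp continuousOn_fst fun w hw => hw.1).add
          (h.continuousOn.comp (continuousOn_snd) fun w hw => hw.2)).sub hv.contDiffOn.continuousOn
      exact hc.preimage_isClosed_of_isClosed (isClosed_Icc.prod isClosed_Icc) isClosed_singleton
    have hsub := Measure.support_subset_of_isClosed (μ := F.map fun x => (x, Z x)) hclosed (by
      refine (ae_map_iff hm.aemeasurable hclosed.measurableSet).2 ?_
      filter_upwards [ae_mem_Icc hF] with x hx
      exact ⟨⟨hx, h.demand.mem x⟩, by simp [hp]⟩)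
    intro w hw
    linarith [(hsub hw).2]
  · have := h.demand.max x hx z hz
    simp only [hp]
    linarith

/-- Equilibrium output exceeds the output of every coupling of `F` with a distribution that costs no
more than `G` at equilibrium wages, by an amount quadratic in the distance. -/
lemma IsSorting.exists_output_gap (hab : a < b) (hcd : c < d)
    (hv : IsProductionFunction a b c d v) : ∃ κ : ℝ, 0 < κ ∧
    ∀ (F G H : Measure ℝ) (q Z : ℝ → ℝ) (J : Measure (ℝ × ℝ)), IsProbabilityMeasure F →
      F (Icc a b)ᶜ = 0 → IsProbabilityMeasure J → IsSorting a b c d v F G H q Z →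
      J.map Prod.fst = F → (J.map Prod.snd) (Icc c d)ᶜ = 0 →
      ∫ z, q z ∂(J.map Prod.snd) ≤ ∫ y, q y ∂G →
      Integrable (fun w => (w.2 - Z w.1) ^ 2) J ∧
      Integrable (fun w => v w.1 (Z w.1) - v w.1 w.2) J ∧
      κ * ∫ w, (w.2 - Z w.1) ^ 2 ∂J ≤ ∫ w, (v w.1 (Z w.1) - v w.1 w.2) ∂J := by
  obtain ⟨κ, hκ, hgap⟩ := exists_isDemand_gap hab hcd hv
  refine ⟨κ, hκ, fun F G H q Z J hFp hF hJp h hJF hJ2 hle => ?_⟩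
  have hHp := h.isProbabilityMeasure
  have hbox : ∀ᵐ w ∂J, w ∈ Icc a b ×ˢ Icc c d := ae_mem_box (by rwa [hJF]) hJ2
  have hZm : Measurable fun w : ℝ × ℝ => Z w.1 := h.demand.measurable.comp measurable_fst
  have hvZ : Integrable (fun w : ℝ × ℝ => v w.1 (Z w.1)) J := by
    have hm : Measurable fun w : ℝ × ℝ => (w.1, Z w.1) := measurable_fst.prodMk hZm
    have : IsProbabilityMeasure (J.map fun w => (w.1, Z w.1)) :=
      Measure.isProbabilityMeasure_map hm.aemeasurable
    refine (hv.contDiffOn.continuousOn.integrable_of_ae_mem_box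
      (J := J.map fun w => (w.1, Z w.1)) ?_).comp_aemeasurable hm.aemeasurable
    refine (ae_map_iff hm.aemeasurable (measurableSet_Icc.prod measurableSet_Icc)).2 ?_
    exact hbox.mono fun w hw => ⟨hw.1, h.demand.mem _⟩
  have hvJ := hv.contDiffOn.continuousOn.integrable_of_ae_mem_box hbox
  have hqJ : Integrable (fun w : ℝ × ℝ => q w.2) J :=
    (h.continuousOn.comp continuousOn_snd fun w hw => hw.2).integrable_of_ae_mem_box hbox
  have hqZ : Integrable (fun w : ℝ × ℝ => q (Z w.1)) J := by
    have := h.integrable_law q h.continuousOn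
    rw [← hJF] at this
    exact this.comp_aemeasurable measurable_fst.aemeasurable
  have hsq : Integrable (fun w : ℝ × ℝ => (w.2 - Z w.1) ^ 2) J := by
    refine Integrable.of_bound (C := (d - c) ^ 2)
      ((measurable_snd.sub hZm).pow_const 2).aestronglyMeasurable ?_
    filter_upwards [hbox] with w hw
    rw [Real.norm_of_nonneg (sq_nonneg _)]
    have h1 := hw.2
    have h2 := h.demand.mem w.1
    exact sq_le_sq' (by linarith [h1.1, h2.2]) (by linarith [h1.2, h2.1])
  have e1 : ∫ w, q (Z w.1) ∂J = ∫ y, q y ∂G := by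
    rw [← h.balance, h.integral_law q h.continuousOn, ← hJF,
      integral_map measurable_fst.aemeasurable]
    have := h.integrable_law q h.continuousOn
    rw [← hJF] at this
    exact this.aestronglyMeasurable
  have e2 : ∫ w, q w.2 ∂J = ∫ z, q z ∂(J.map Prod.snd) := by
    rw [integral_map measurable_snd.aemeasurable]
    have : IsProbabilityMeasure (J.map Prod.snd) :=
      Measure.isProbabilityMeasure_map measurable_snd.aemeasurable
    exact (h.continuousOn.integrable_of_compl_Icc hJ2).aestronglyMeasurable
  -- After integration the equilibrium wage bill is ∫ q dG by balance and that of J is no larger, so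
  -- the wage terms can be dropped.
  have hmono : ∫ w, (κ * (w.2 - Z w.1) ^ 2) ∂J ≤
      ∫ w, ((v w.1 (Z w.1) - v w.1 w.2) - (q (Z w.1) - q w.2)) ∂J := by
    refine integral_mono_ae (hsq.const_mul κ) ((hvZ.sub hvJ).sub (hqZ.sub hqJ)) ?_
    filter_upwards [hbox] with w hw
    have := hgap q Z h.convex h.demand w.1 hw.1 w.2 hw.2
    linarith
  rw [integral_const_mul, integral_sub (f := fun w : ℝ × ℝ => v w.1 (Z w.1) - v w.1 w.2)
    (g := fun w : ℝ × ℝ => q (Z w.1) - q w.2) (hvZ.sub hvJ) (hqZ.sub hqJ),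
    integral_sub hqZ hqJ, e1, e2] at hmono
  exact ⟨hsq, hvZ.sub hvJ, by linarith⟩

/-- Equilibrium workforce distributions are unique. -/
theorem IsSorting.unique (hab : a < b) (hcd : c < d) (hv : IsProductionFunction a b c d v)
    [IsProbabilityMeasure F] (hF : F (Icc a b)ᶜ = 0) {H' : Measure ℝ}
    (h : IsSorting a b c d v F G H q Z) (h' : IsSorting a b c d v F G H' q' Z') : H = H' := by
  obtain ⟨κ, hκ, hgap⟩ := IsSorting.exists_output_gap hab hcd hv
  -- H₂ is a contraction of G and q₁ is convex, so the second demand is affordable at the first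
  -- wages. With the roles exchanged, the two output differences are opposite and both nonnegative.
  have key : ∀ {H₁ H₂ : Measure ℝ} {q₁ q₂ Z₁ Z₂ : ℝ → ℝ}, IsSorting a b c d v F G H₁ q₁ Z₁ →
      IsSorting a b c d v F G H₂ q₂ Z₂ →
      Integrable (fun x => (Z₂ x - Z₁ x) ^ 2) F ∧ Integrable (fun x => v x (Z₁ x) - v x (Z₂ x)) F ∧
      κ * ∫ x, (Z₂ x - Z₁ x) ^ 2 ∂F ≤ ∫ x, (v x (Z₁ x) - v x (Z₂ x)) ∂F := by
    intro H₁ H₂ q₁ q₂ Z₁ Z₂ h₁ h₂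
    have hm : Measurable fun x => (x, Z₂ x) := measurable_id.prodMk h₂.demand.measurable
    have hH₂ := h₂.isProbabilityMeasure
    have hsnd : (F.map fun x => (x, Z₂ x)).map Prod.snd = H₂ := by
      rw [Measure.map_map measurable_snd hm]; exact h₂.law
    obtain ⟨i1, i2, hle⟩ := hgap F G H₁ q₁ Z₁ (F.map fun x => (x, Z₂ x)) inferInstance hF
      (Measure.isProbabilityMeasure_map hm.aemeasurable) h₁
      (by rw [Measure.map_map measurable_fst hm]; exact Measure.map_id)
      (by rw [hsnd]; exact h₂.splitting.compl_eq_zero.2)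
      (by rw [hsnd]; exact h₂.integral_le hcd.le h₁.convex h₁.continuousOn)
    rw [integral_map hm.aemeasurable i1.aestronglyMeasurable,
      integral_map hm.aemeasurable i2.aestronglyMeasurable] at hle
    exact ⟨i1.comp_aemeasurable hm.aemeasurable, i2.comp_aemeasurable hm.aemeasurable, hle⟩
  obtain ⟨i1, i2, h1⟩ := key h h'
  obtain ⟨-, i3, h2⟩ := key h' h
  have h3 : ∫ x, (v x (Z x) - v x (Z' x)) ∂F = - ∫ x, (v x (Z' x) - v x (Z x)) ∂F := by
    rw [← integral_neg]; simp
  have h4 : 0 ≤ ∫ x, (Z x - Z' x) ^ 2 ∂F := integral_nonneg fun x => sq_nonneg _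
  have h5 : 0 ≤ ∫ x, (Z' x - Z x) ^ 2 ∂F := integral_nonneg fun x => sq_nonneg _
  have h6 : ∫ x, (Z' x - Z x) ^ 2 ∂F = 0 := by nlinarith
  have hae : Z =ᵐ[F] Z' := by
    filter_upwards [(integral_eq_zero_iff_of_nonneg (fun x => sq_nonneg _) i1).1 h6] with x hx
    have := pow_eq_zero_iff two_ne_zero |>.1 hx
    linarith
  rw [← h.law, ← h'.law, Measure.map_congr hae]

end Equilibrium

/-! ### Quantile functions of finite measures. -/

section Quantile

/-- The quantile function of a finite measure on `ℝ`, on `(0, μ ℝ)`. -/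
noncomputable def quantile (μ : Measure ℝ) (t : ℝ) : ℝ :=
  open Classical in
  if t ∈ Ioo 0 (μ.real univ) then sInf {x | t ≤ μ.real (Iic x)} else 0

variable {μ : Measure ℝ} [IsFiniteMeasure μ]

/-- The infimum runs over an upward closed set that is nonempty as t is below the total mass,
bounded below as t > 0, and contains its infimum by right-continuity of the cdf. Measurability, law
and monotonicity of the quantile follow from this equivalence. -/
lemma quantile_le_iff {t x : ℝ} (ht : t ∈ Ioo 0 (μ.real univ)) :
    quantile μ t ≤ x ↔ t ≤ μ.real (Iic x) := by
  rw [quantile, if_pos ht]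
  set S := {x | t ≤ μ.real (Iic x)} with hS
  have hup : ∀ x ∈ S, ∀ y, x ≤ y → y ∈ S := fun x hx y hxy =>
    le_trans (α := ℝ) hx (measureReal_mono (Iic_subset_Iic.2 hxy))
  have hne : S.Nonempty := by
    have h := (ENNReal.tendsto_toReal (measure_ne_top μ univ)).comp (tendsto_measure_Iic_atTop μ)
    obtain ⟨x, hx⟩ := (h.eventually (lt_mem_nhds (show t < (μ univ).toReal from ht.2))).exists
    exact ⟨x, le_of_lt hx⟩
  have hbdd : BddBelow S := by
    have h0 : Filter.Tendsto (fun x => μ (Iic x)) Filter.atBot (nhds 0) := by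
      have h := tendsto_measure_iInter_atBot (μ := μ) (s := fun x : ℝ => Iic x)
        (fun i => measurableSet_Iic.nullMeasurableSet) (fun i j hij => Iic_subset_Iic.2 hij)
        ⟨0, measure_ne_top μ _⟩
      have hI : (⋂ x : ℝ, Iic x) = ∅ := by
        ext y
        simp only [mem_iInter, mem_Iic, mem_empty_iff_false, iff_false, not_forall, not_le]
        exact exists_lt y
      rwa [hI, measure_empty] at h
    have h := (ENNReal.tendsto_toReal ENNReal.zero_ne_top).comp h0
    obtain ⟨x, hx⟩ :=
      (h.eventually (gt_mem_nhds (show ENNReal.toReal 0 < t by simpa using ht.1))).exists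
    refine ⟨x, fun y hy => ?_⟩
    by_contra! hlt
    exact (lt_of_lt_of_le (α := ℝ) hx (hup y hy x hlt.le)).false
  have hmem : sInf S ∈ S := by
    have h : Filter.Tendsto (fun x => μ (Iic x)) (nhdsWithin (sInf S) (Ioi (sInf S)))
        (nhds (μ (⋂ r > sInf S, Iic r))) :=
      tendsto_measure_biInter_gt (fun r _ => measurableSet_Iic.nullMeasurableSet)
        (fun i j _ hij => Iic_subset_Iic.2 hij) ⟨sInf S + 1, by simp, measure_ne_top _ _⟩
    have hI : (⋂ r > sInf S, Iic r) = Iic (sInf S) := by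
      ext y
      simp only [mem_iInter, mem_Iic]
      exact ⟨fun h => le_of_forall_gt_imp_ge_of_dense h, fun h r hr => h.trans (le_of_lt hr)⟩
    rw [hI] at h
    have h' := (ENNReal.tendsto_toReal (measure_ne_top μ _)).comp h
    refine ge_of_tendsto h' (eventually_nhdsWithin_of_forall fun x hx => ?_)
    obtain ⟨y, hy, hyx⟩ := exists_lt_of_csInf_lt hne hx
    exact hup y hy x hyx.le
  exact ⟨fun h => hup _ hmem x h, fun h => csInf_le hbdd h⟩

lemma measurable_quantile : Measurable (quantile μ) := by
  refine measurable_of_Iic fun x => ?_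
  have : quantile μ ⁻¹' Iic x = (Ioo 0 (μ.real univ) ∩ Iic (μ.real (Iic x))) ∪
      ((Ioo 0 (μ.real univ))ᶜ ∩ {_t | 0 ≤ x}) := by
    ext t
    by_cases ht : t ∈ Ioo 0 (μ.real univ)
    · have := quantile_le_iff (x := x) ht
      simp only [mem_preimage, mem_Iic, mem_union, mem_inter_iff, mem_compl_iff, ht, this, true_and,
        not_true_eq_false, false_and, or_false]
    · have h0 : quantile μ t = 0 := by rw [quantile, if_neg ht]
      simp only [mem_preimage, mem_Iic, mem_union, mem_inter_iff, mem_compl_iff, ht, h0, false_and,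
        false_or, not_false_eq_true, true_and, mem_ofPred_eq]
  rw [this]
  exact (measurableSet_Ioo.inter measurableSet_Iic).union
    (measurableSet_Ioo.compl.inter (MeasurableSet.const _))

lemma map_quantile : (volume.restrict (Ioo 0 (μ.real univ))).map (quantile μ) = μ := by
  have : IsFiniteMeasure ((volume.restrict (Ioo 0 (μ.real univ))).map (quantile μ)) := by
    infer_instance
  refine Measure.ext_of_Iic _ _ fun x => ?_
  rw [Measure.map_apply measurable_quantile measurableSet_Iic,
    Measure.restrict_apply (measurable_quantile measurableSet_Iic)]
  have h1 : quantile μ ⁻¹' Iic x ∩ Ioo 0 (μ.real univ) =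
      Ioo 0 (μ.real univ) ∩ Iic (μ.real (Iic x)) := by
    ext t
    simp only [mem_inter_iff, mem_preimage, mem_Iic]
    constructor
    · exact fun h => ⟨h.2, (quantile_le_iff h.2).1 h.1⟩
    · exact fun h => ⟨(quantile_le_iff h.1).2 h.2, h.1⟩
  have hle : μ.real (Iic x) ≤ μ.real univ := measureReal_mono (subset_univ _)
  have h2 : volume (Ioo 0 (μ.real univ) ∩ Iic (μ.real (Iic x))) =
      ENNReal.ofReal (μ.real (Iic x)) := by
    rcases hle.eq_or_lt with h | h
    · have : Ioo 0 (μ.real univ) ∩ Iic (μ.real (Iic x)) = Ioo 0 (μ.real univ) := by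
        rw [h]; exact inter_eq_left.2 fun t ht => ht.2.le
      rw [this, Real.volume_Ioo, h, sub_zero]
    · have : Ioo 0 (μ.real univ) ∩ Iic (μ.real (Iic x)) = Ioc 0 (μ.real (Iic x)) := by
        ext t
        simp only [mem_inter_iff, mem_Ioo, mem_Iic, mem_Ioc]
        exact ⟨fun h => ⟨h.1.1, h.2⟩, fun h' => ⟨⟨h'.1, h'.2.trans_lt h⟩, h'.2⟩⟩
      rw [this, Real.volume_Ioc, sub_zero]
  rw [h1, h2, ofReal_measureReal]

lemma quantile_mono {s t : ℝ} (hs : s ∈ Ioo 0 (μ.real univ)) (ht : t ∈ Ioo 0 (μ.real univ))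
    (h : s ≤ t) : quantile μ s ≤ quantile μ t :=
  (quantile_le_iff hs).2 (h.trans ((quantile_le_iff ht).1 le_rfl))

lemma quantile_mem_Icc {c d t : ℝ} (hμ : μ (Icc c d)ᶜ = 0) (ht : t ∈ Ioo 0 (μ.real univ)) :
    quantile μ t ∈ Icc c d := by
  constructor
  · by_contra! h
    have h1 := (quantile_le_iff ht).1 le_rfl
    have h2 : μ.real (Iic (quantile μ t)) = 0 := by
      rw [measureReal_eq_zero_iff]
      exact measure_mono_null
        (fun s (hs : s ≤ quantile μ t) (hs' : s ∈ Icc c d) => (hs'.1.trans hs).not_gt h) hμ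
    linarith [ht.1]
  · rw [quantile_le_iff ht]
    have : μ.real (Iic d) = μ.real univ := by
      rw [measureReal_def, measureReal_def]
      congr 1
      refine measure_congr ?_
      filter_upwards [ae_mem_Icc hμ] with s hs
      exact propext ⟨fun _ => trivial, fun _ => hs.2⟩
    rw [this]; exact ht.2.le

/-- Integration along the quantile function of a measure with density `h`, weighted by `1 / h`. -/
lemma lintegral_quantile_withDensity {U : Measure ℝ} {h : ℝ → ℝ} (hh : Measurable h)
    [IsFiniteMeasure (U.withDensity fun u => ENNReal.ofReal (h u))] {g : ℝ → ENNReal}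
    (hg : Measurable g) :
    ∫⁻ t in Ioo 0 ((U.withDensity fun u => ENNReal.ofReal (h u)).real univ),
      ENNReal.ofReal (1 / h (quantile (U.withDensity fun u => ENNReal.ofReal (h u)) t)) *
        g (quantile (U.withDensity fun u => ENNReal.ofReal (h u)) t) =
    ∫⁻ u in {u | 0 < h u}, g u ∂U := by
  set μ := U.withDensity fun u => ENNReal.ofReal (h u) with hμ
  have hm : Measurable fun u => ENNReal.ofReal (1 / h u) * g u :=
    (measurable_const.div hh).ennreal_ofReal.mul hg
  rw [← lintegral_map (f := fun u => ENNReal.ofReal (1 / h u) * g u) hm measurable_quantile,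
    map_quantile, hμ, lintegral_withDensity_eq_lintegral_mul _ hh.ennreal_ofReal hm,
    ← lintegral_indicator (measurableSet_lt measurable_const hh)]
  refine lintegral_congr fun u => ?_
  simp only [Pi.mul_apply, indicator, mem_ofPred_eq]
  split_ifs with hu
  · rw [← mul_assoc, ← ENNReal.ofReal_mul hu.le, mul_one_div_cancel hu.ne', ENNReal.ofReal_one,
      one_mul]
  · rw [ENNReal.ofReal_of_nonpos (not_lt.1 hu), zero_mul]

/-- The quantile pushes Lebesgue measure to the given measure, which does not charge the zeros of
its density. -/
lemma ae_quantile_withDensity_pos {U : Measure ℝ} {h : ℝ → ℝ} (hh : Measurable h)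
    [IsFiniteMeasure (U.withDensity fun u => ENNReal.ofReal (h u))] {p : ℝ → Prop}
    (hpm : MeasurableSet {u | p u}) (hp : ∀ᵐ u ∂U, p u) :
    ∀ᵐ t ∂(volume.restrict (Ioo 0 ((U.withDensity fun u => ENNReal.ofReal (h u)).real univ))),
      p (quantile (U.withDensity fun u => ENNReal.ofReal (h u)) t) ∧
      0 < h (quantile (U.withDensity fun u => ENNReal.ofReal (h u)) t) := by
  have h1 : ∀ᵐ u ∂(U.withDensity fun u => ENNReal.ofReal (h u)), p u ∧ 0 < h u := by
    rw [ae_withDensity_iff hh.ennreal_ofReal]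
    filter_upwards [hp] with u hu hne
    exact ⟨hu, by simpa using hne⟩
  rw [← map_quantile (μ := U.withDensity fun u => ENNReal.ofReal (h u))] at h1
  exact (ae_map_iff measurable_quantile.aemeasurable
    (hpm.inter (measurableSet_lt measurable_const hh))).1 h1

end Quantile

/-! ### The mean as a measurable map, and two-point workforces. -/

section TwoPoint

/-- The Bochner integral is 0 when the identity is not integrable, so the difference of the two
one-sided moments is cut off where the absolute moment is infinite. -/
lemma measurable_integral_id : Measurable fun η : Measure ℝ => ∫ y, y ∂η := by
  have h1 : Measurable fun η : Measure ℝ => ∫⁻ y, ENNReal.ofReal y ∂η :=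
    Measure.measurable_lintegral measurable_id.ennreal_ofReal
  have h2 : Measurable fun η : Measure ℝ => ∫⁻ y, ENNReal.ofReal (-y) ∂η :=
    Measure.measurable_lintegral measurable_id.neg.ennreal_ofReal
  have h3 : Measurable fun η : Measure ℝ => ∫⁻ y, ‖y‖ₑ ∂η :=
    Measure.measurable_lintegral measurable_id.enorm
  have heq : (fun η : Measure ℝ => ∫ y, y ∂η) = {η | ∫⁻ y, ‖y‖ₑ ∂η < ⊤}.indicator fun η =>
      (∫⁻ y, ENNReal.ofReal y ∂η).toReal - (∫⁻ y, ENNReal.ofReal (-y) ∂η).toReal := by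
    ext η
    simp only [indicator, mem_ofPred_eq]
    split_ifs with h
    · exact integral_eq_lintegral_pos_part_sub_lintegral_neg_part
        ⟨measurable_id.aestronglyMeasurable, h⟩
    · exact integral_undef fun hi => h hi.2
  rw [heq]
  exact (h1.ennreal_toReal.sub h2.ennreal_toReal).indicator (measurableSet_lt h3 measurable_const)

/-- The distribution on `{p, s}` with mean `m`. -/
noncomputable def twoPoint (p s m : ℝ) : Measure ℝ :=
  ENNReal.ofReal ((s - m) / (s - p)) • Measure.dirac p +
    ENNReal.ofReal ((m - p) / (s - p)) • Measure.dirac s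

lemma twoPoint_apply (p s m : ℝ) {B : Set ℝ} (hB : MeasurableSet B) :
    twoPoint p s m B = ENNReal.ofReal ((s - m) / (s - p)) * B.indicator 1 p +
      ENNReal.ofReal ((m - p) / (s - p)) * B.indicator 1 s := by
  simp [twoPoint, Measure.dirac_apply' _ hB]

lemma measurable_twoPoint {p s m : ℝ → ℝ} (hp : Measurable p) (hs : Measurable s)
    (hm : Measurable m) : Measurable fun t => twoPoint (p t) (s t) (m t) := by
  refine Measure.measurable_of_measurable_coe _ fun B hB => ?_
  simp_rw [twoPoint_apply _ _ _ hB]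
  have h1 : Measurable (B.indicator (1 : ℝ → ENNReal)) := measurable_one.indicator hB
  exact (((hs.sub hm).div (hs.sub hp)).ennreal_ofReal.mul (h1.comp hp)).add
    (((hm.sub hp).div (hs.sub hp)).ennreal_ofReal.mul (h1.comp hs))

variable {p s m : ℝ}

lemma twoPoint_isProbabilityMeasure (hps : p < s) (hm : m ∈ Icc p s) :
    IsProbabilityMeasure (twoPoint p s m) := by
  have h0 : 0 < s - p := by linarith
  refine ⟨?_⟩
  rw [twoPoint_apply _ _ _ MeasurableSet.univ]
  simp only [indicator_univ, Pi.one_apply, mul_one]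
  rw [← ENNReal.ofReal_add (div_nonneg (by linarith [hm.2]) h0.le)
    (div_nonneg (by linarith [hm.1]) h0.le), ← ENNReal.ofReal_one]
  congr 1
  field_simp
  ring

lemma twoPoint_compl_Icc {c d : ℝ} (hp : p ∈ Icc c d) (hs : s ∈ Icc c d) :
    twoPoint p s m (Icc c d)ᶜ = 0 := by
  rw [twoPoint_apply _ _ _ measurableSet_Icc.compl]
  simp [indicator, hp.1, hp.2, hs.1, hs.2]

lemma integral_twoPoint (hps : p < s) (hm : m ∈ Icc p s) : ∫ y, y ∂(twoPoint p s m) = m := by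
  have h0 : 0 < s - p := by linarith
  rw [twoPoint, integral_add_measure, integral_smul_measure, integral_smul_measure, integral_dirac,
    integral_dirac, ENNReal.toReal_ofReal (div_nonneg (by linarith [hm.2]) h0.le),
    ENNReal.toReal_ofReal (div_nonneg (by linarith [hm.1]) h0.le)]
  · simp only [smul_eq_mul]
    field_simp
    ring
  · exact (integrable_dirac (by simp)).smul_measure ENNReal.ofReal_ne_top
  · exact (integrable_dirac (by simp)).smul_measure ENNReal.ofReal_ne_top

end TwoPoint

/-! ### Strassen's theorem on an interval. -/

section Strassen

variable {c d : ℝ} {G H : Measure ℝ}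

/-- Mass balance of one exchange: workforces on {p, s} with means q and r and sizes 1 / (q - p) and
1 / (s - r) together use 1 / (q - p) of skill p and 1 / (s - r) of skill s. -/
lemma twoPoint_exchange {p q r s : ℝ} (hpq : p < q) (hqr : q ≤ r) (hrs : r < s) (x y : ENNReal) :
    ENNReal.ofReal (1 / (q - p)) *
        (ENNReal.ofReal ((s - q) / (s - p)) * x + ENNReal.ofReal ((q - p) / (s - p)) * y) +
      ENNReal.ofReal (1 / (s - r)) *
        (ENNReal.ofReal ((s - r) / (s - p)) * x + ENNReal.ofReal ((r - p) / (s - p)) * y) =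
    ENNReal.ofReal (1 / (q - p)) * x + ENNReal.ofReal (1 / (s - r)) * y := by
  have h1 : 0 < q - p := by linarith
  have h2 : 0 < s - r := by linarith
  have h3 : 0 < s - p := by linarith
  have h4 : 0 < s - q := by linarith
  have h5 : 0 < r - p := by linarith
  have e1 : ENNReal.ofReal (1 / (q - p)) * ENNReal.ofReal ((s - q) / (s - p)) +
      ENNReal.ofReal (1 / (s - r)) * ENNReal.ofReal ((s - r) / (s - p)) =
      ENNReal.ofReal (1 / (q - p)) := by
    rw [← ENNReal.ofReal_mul (by positivity), ← ENNReal.ofReal_mul (by positivity),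
      ← ENNReal.ofReal_add (by positivity) (by positivity)]
    congr 1
    field_simp
    ring
  have e2 : ENNReal.ofReal (1 / (q - p)) * ENNReal.ofReal ((q - p) / (s - p)) +
      ENNReal.ofReal (1 / (s - r)) * ENNReal.ofReal ((r - p) / (s - p)) =
      ENNReal.ofReal (1 / (s - r)) := by
    rw [← ENNReal.ofReal_mul (by positivity), ← ENNReal.ofReal_mul (by positivity),
      ← ENNReal.ofReal_add (by positivity) (by positivity)]
    congr 1
    field_simp
    ring
  calc _ = (ENNReal.ofReal (1 / (q - p)) * ENNReal.ofReal ((s - q) / (s - p)) +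
      ENNReal.ofReal (1 / (s - r)) * ENNReal.ofReal ((s - r) / (s - p))) * x +
      (ENNReal.ofReal (1 / (q - p)) * ENNReal.ofReal ((q - p) / (s - p)) +
      ENNReal.ofReal (1 / (s - r)) * ENNReal.ofReal ((r - p) / (s - p))) * y := by ring
    _ = _ := by rw [e1, e2]

lemma lintegral_trichotomy {U : Measure ℝ} {φ ψ : ℝ → ℝ} (hφ : Measurable φ) (hψ : Measurable ψ)
    {g : ℝ → ENNReal} (hg : Measurable g) :
    ∫⁻ u in {u | φ u = ψ u}, g u ∂U + (∫⁻ u in {u | 0 < φ u - ψ u}, g u ∂U +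
      ∫⁻ u in {u | 0 < ψ u - φ u}, g u ∂U) = ∫⁻ u, g u ∂U := by
  have m1 : MeasurableSet {u | φ u = ψ u} := measurableSet_eq_fun hφ hψ
  have m2 : MeasurableSet {u | 0 < φ u - ψ u} := measurableSet_lt measurable_const (hφ.sub hψ)
  have m3 : MeasurableSet {u | 0 < ψ u - φ u} := measurableSet_lt measurable_const (hψ.sub hφ)
  rw [← lintegral_indicator m1, ← lintegral_indicator m2, ← lintegral_indicator m3,
    ← lintegral_add_left (hg.indicator m2), ← lintegral_add_left (hg.indicator m1)]
  refine lintegral_congr fun u => ?_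
  simp only [indicator, mem_ofPred_eq, sub_pos]
  rcases lt_trichotomy (φ u) (ψ u) with h | h | h
  · simp [h, h.ne, h.le.not_gt]
  · simp [h]
  · simp [h, h.ne', h.le.not_gt]

/-- A splitting can be constructed from two functions `φ`, `ψ` with laws `H`, `G`, by transporting
the positive part of `φ - ψ` monotonically to its negative part. -/
lemma isSplittingMeans_of_transport {U V : Measure ℝ} {φ ψ ξ ζ : ℝ → ℝ} (hφ : Measurable φ)
    (hψ : Measurable ψ) (hξ : Measurable ξ) (hζ : Measurable ζ)
    (hψU : ∀ᵐ u ∂U, ψ u ∈ Icc c d) (hG : U.map ψ = G) (hH : U.map φ = H) [IsProbabilityMeasure H]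
    (h1 : ∀ g : ℝ → ENNReal, Measurable g →
      ∫⁻ t, ENNReal.ofReal (1 / (φ (ξ t) - ψ (ξ t))) * g (ξ t) ∂V =
        ∫⁻ u in {u | 0 < φ u - ψ u}, g u ∂U)
    (h2 : ∀ g : ℝ → ENNReal, Measurable g →
      ∫⁻ t, ENNReal.ofReal (1 / (ψ (ζ t) - φ (ζ t))) * g (ζ t) ∂V =
        ∫⁻ u in {u | 0 < ψ u - φ u}, g u ∂U)
    (hV : ∀ᵐ t ∂V, ψ (ξ t) ∈ Icc c d ∧ ψ (ζ t) ∈ Icc c d ∧ ψ (ξ t) < φ (ξ t) ∧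
      φ (ξ t) ≤ φ (ζ t) ∧ φ (ζ t) < ψ (ζ t)) : IsSplittingMeans c d G H := by
  have mE : MeasurableSet {u | φ u = ψ u} := measurableSet_eq_fun hφ hψ
  set k1 : ℝ → ENNReal := fun t => ENNReal.ofReal (1 / (φ (ξ t) - ψ (ξ t))) with hk1
  set k2 : ℝ → ENNReal := fun t => ENNReal.ofReal (1 / (ψ (ζ t) - φ (ζ t))) with hk2
  have mk1 : Measurable k1 :=
    (measurable_const.div ((hφ.comp hξ).sub (hψ.comp hξ))).ennreal_ofReal
  have mk2 : Measurable k2 :=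
    (measurable_const.div ((hψ.comp hζ).sub (hφ.comp hζ))).ennreal_ofReal
  set m1 : ℝ → Measure ℝ := fun t => twoPoint (ψ (ξ t)) (ψ (ζ t)) (φ (ξ t)) with hm1
  set m2 : ℝ → Measure ℝ := fun t => twoPoint (ψ (ξ t)) (ψ (ζ t)) (φ (ζ t)) with hm2
  have mm1 : Measurable m1 := measurable_twoPoint (hψ.comp hξ) (hψ.comp hζ) (hφ.comp hξ)
  have mm2 : Measurable m2 := measurable_twoPoint (hψ.comp hξ) (hψ.comp hζ) (hφ.comp hζ)
  have mδ : Measurable fun u => Measure.dirac (ψ u) := Measure.measurable_dirac.comp hψ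
  -- Where φ = ψ workers stay unmixed. Elsewhere t pairs a point ξ t with φ > ψ and a point ζ t with
  -- φ < ψ, and the skills ψ (ξ t), ψ (ζ t) are mixed to the means φ (ξ t) and φ (ζ t). The weights
  -- k1, k2 undo the densities of the transported measures.
  set τ : Measure (Measure ℝ) := (U.restrict {u | φ u = ψ u}).map (fun u => Measure.dirac (ψ u)) +
    ((V.withDensity k1).map m1 + (V.withDensity k2).map m2) with hτ
  have wd : ∀ {k : ℝ → ENNReal} {Γ : ℝ → ENNReal}, Measurable k → Measurable Γ →
      ∫⁻ t, Γ t ∂(V.withDensity k) = ∫⁻ t, k t * Γ t ∂V := fun mk mΓ =>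
    lintegral_withDensity_eq_lintegral_mul _ mk mΓ
  have hint : ∀ Γ : Measure ℝ → ENNReal, Measurable Γ → ∫⁻ η, Γ η ∂τ =
      ∫⁻ u in {u | φ u = ψ u}, Γ (Measure.dirac (ψ u)) ∂U +
        (∫⁻ t, k1 t * Γ (m1 t) ∂V + ∫⁻ t, k2 t * Γ (m2 t) ∂V) := fun Γ hΓ => by
    rw [hτ, lintegral_add_measure, lintegral_add_measure, lintegral_map hΓ mδ,
      lintegral_map hΓ mm1, lintegral_map hΓ mm2,
      wd (Γ := fun t => Γ (m1 t)) mk1 (hΓ.comp mm1), wd (Γ := fun t => Γ (m2 t)) mk2 (hΓ.comp mm2)]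
  have hjoin : τ.join = G := by
    ext B hB
    have hg : Measurable (fun u => B.indicator (1 : ℝ → ENNReal) (ψ u)) :=
      (measurable_one.indicator hB).comp hψ
    have hGB : G B = ∫⁻ u, B.indicator (1 : ℝ → ENNReal) (ψ u) ∂U := by
      rw [← hG, ← lintegral_indicator_one hB, lintegral_map (measurable_one.indicator hB) hψ]
    rw [Measure.join_apply hB, hint _ (Measure.measurable_coe hB), hGB,
      ← lintegral_trichotomy hφ hψ hg]
    congr 1
    · exact lintegral_congr fun u => Measure.dirac_apply' _ hB
    · rw [← h1 _ hg, ← h2 _ hg,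
        ← lintegral_add_left (f := fun t => k1 t * m1 t B)
          (mk1.mul ((Measure.measurable_coe hB).comp mm1)),
        ← lintegral_add_left (f := fun t => k1 t * B.indicator 1 (ψ (ξ t)))
          (mk1.mul (hg.comp hξ))]
      refine lintegral_congr_ae (hV.mono fun t ⟨_, _, ht1, ht2, ht3⟩ => ?_)
      simp only [hm1, hm2, twoPoint_apply _ _ _ hB]
      exact twoPoint_exchange ht1 ht2 ht3 _ _
  have hmap : τ.map (fun η => ∫ y, y ∂η) = H := by
    ext B hB
    have hB1 : Measurable (B.indicator (1 : ℝ → ENNReal)) := measurable_one.indicator hB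
    have hg : Measurable (fun u => B.indicator (1 : ℝ → ENNReal) (φ u)) := hB1.comp hφ
    rw [← hH, ← lintegral_indicator_one hB, ← lintegral_indicator_one hB, lintegral_map hB1 hφ,
      lintegral_map hB1 measurable_integral_id, 
      hint (fun η => B.indicator 1 (∫ y, y ∂η)) (hB1.comp measurable_integral_id),
      ← lintegral_trichotomy hφ hψ hg, ← h1 _ hg, ← h2 _ hg]
    congr 1
    · refine setLIntegral_congr_fun mE fun u (hu : φ u = ψ u) => ?_
      simp only [integral_dirac, hu]
    congr 1
    · refine lintegral_congr_ae (hV.mono fun t ⟨_, _, ht1, ht2, ht3⟩ => ?_)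
      simp only [hm1, hk1]
      rw [integral_twoPoint (by linarith) ⟨by linarith, by linarith⟩]
    · refine lintegral_congr_ae (hV.mono fun t ⟨_, _, ht1, ht2, ht3⟩ => ?_)
      simp only [hm2, hk2]
      rw [integral_twoPoint (by linarith) ⟨by linarith, by linarith⟩]
  refine ⟨τ, ⟨?_⟩, ?_, hjoin, hmap⟩
  · have : H univ = 1 := measure_univ
    rwa [← hmap, Measure.map_apply measurable_integral_id MeasurableSet.univ] at this
  · have mS : MeasurableSet {η : Measure ℝ | IsProbabilityMeasure η ∧ η (Icc c d)ᶜ = 0} := by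
      simp_rw [isProbabilityMeasure_iff]
      exact (measurableSet_eq_fun (Measure.measurable_coe MeasurableSet.univ)
        measurable_const).inter
        (measurableSet_eq_fun (Measure.measurable_coe measurableSet_Icc.compl) measurable_const)
    rw [hτ, ae_add_measure_iff, ae_add_measure_iff]
    refine ⟨(ae_map_iff mδ.aemeasurable mS).2 (ae_restrict_of_ae (hψU.mono fun u hu =>
      ⟨inferInstance, ?_⟩)), (ae_map_iff mm1.aemeasurable mS).2
      ((withDensity_absolutelyContinuous V k1).ae_le (hV.mono fun t ⟨i1, i2, ht1, ht2, ht3⟩ =>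
        ⟨twoPoint_isProbabilityMeasure (by linarith) ⟨by linarith, by linarith⟩,
          twoPoint_compl_Icc i1 i2⟩)),
      (ae_map_iff mm2.aemeasurable mS).2
      ((withDensity_absolutelyContinuous V k2).ae_le (hV.mono fun t ⟨i1, i2, ht1, ht2, ht3⟩ =>
        ⟨twoPoint_isProbabilityMeasure (by linarith) ⟨by linarith, by linarith⟩,
          twoPoint_compl_Icc i1 i2⟩))⟩
    rw [Measure.dirac_apply' _ measurableSet_Icc.compl]
    simp [hu.1, hu.2]

lemma integral_quantile {μ : Measure ℝ} [IsProbabilityMeasure μ] {f : ℝ → ℝ} (hf : Continuous f) :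
    ∫ u in Ioo 0 1, f (quantile μ u) = ∫ s, f s ∂μ := by
  have h1 := map_quantile (μ := μ)
  rw [probReal_univ] at h1
  conv_rhs => rw [← h1]
  exact (integral_map measurable_quantile.aemeasurable hf.aestronglyMeasurable).symm

/-- Strassen's theorem on an interval: a mean-preserving contraction is the distribution of means of
a splitting. -/
theorem isSplittingMeans_of_integral_max_le [IsProbabilityMeasure G] [IsProbabilityMeasure H]
    (hG : G (Icc c d)ᶜ = 0) (hH : H (Icc c d)ᶜ = 0)
    (hle : ∀ y, ∫ s, max (y - s) 0 ∂H ≤ ∫ s, max (y - s) 0 ∂G)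
    (hmean : ∫ s, s ∂H = ∫ s, s ∂G) : IsSplittingMeans c d G H := by
  set U : Measure ℝ := volume.restrict (Ioo 0 1) with hU
  have hGI : ∀ u ∈ Ioo (0 : ℝ) 1, quantile G u ∈ Icc c d := fun u hu =>
    quantile_mem_Icc hG (by rwa [probReal_univ])
  have hHI : ∀ u ∈ Ioo (0 : ℝ) 1, quantile H u ∈ Icc c d := fun u hu =>
    quantile_mem_Icc hH (by rwa [probReal_univ])
  have hUmem : ∀ᵐ u ∂U, u ∈ Ioo (0 : ℝ) 1 := ae_restrict_mem measurableSet_Ioo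
  have mφ : Measurable (quantile H) := measurable_quantile
  have mψ : Measurable (quantile G) := measurable_quantile
  have iφ : Integrable (quantile H) U := Integrable.of_mem_Icc c d mφ.aemeasurable (hUmem.mono hHI)
  have iψ : Integrable (quantile G) U := Integrable.of_mem_Icc c d mψ.aemeasurable (hUmem.mono hGI)
  have hfα : IsFiniteMeasure (U.withDensity fun u =>
        ENNReal.ofReal (quantile H u - quantile G u)) :=
    isFiniteMeasure_withDensity_ofReal (iφ.sub iψ).2
  have hfβ : IsFiniteMeasure (U.withDensity fun u =>
        ENNReal.ofReal (quantile G u - quantile H u)) :=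
    isFiniteMeasure_withDensity_ofReal (iψ.sub iφ).2
  -- On (0, 1) the quantiles have laws H and G; α and β are the positive and negative parts of their
  -- difference, of equal mass because the means agree.
  set α := U.withDensity fun u => ENNReal.ofReal (quantile H u - quantile G u) with hα
  set β := U.withDensity fun u => ENNReal.ofReal (quantile G u - quantile H u) with hβ
  have iφψ : Integrable (fun u => quantile H u - quantile G u) U := iφ.sub iψ
  have mφψ : Measurable (fun u => quantile H u - quantile G u) := mφ.sub mψ
  have mψφ : Measurable (fun u => quantile G u - quantile H u) := mψ.sub mφ
  have hdiff : ∀ S, MeasurableSet S →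
      α.real S - β.real S = ∫ u in S, (quantile H u - quantile G u) ∂U := fun S hS => by
    rw [integral_eq_lintegral_pos_part_sub_lintegral_neg_part iφψ.integrableOn,
      measureReal_def, measureReal_def, hα, hβ, withDensity_apply _ hS, withDensity_apply _ hS]
    simp only [neg_sub]
  have hu0 : ∫ u, (quantile H u - quantile G u) ∂U = 0 := by
    rw [integral_sub iφ iψ, hU, integral_quantile (f := fun s => s) continuous_id,
      integral_quantile (f := fun s => s) continuous_id, hmean, sub_self]
  have huniv : α.real univ = β.real univ := by
    have := hdiff univ MeasurableSet.univ
    rw [Measure.restrict_univ, hu0] at this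
    linarith
  have hIic : ∀ x, β.real (Iic x) ≤ α.real (Iic x) := fun x => by
    rw [← sub_nonneg, hdiff _ measurableSet_Iic]
    rcases le_or_gt x 0 with hx | hx
    · refine le_of_eq (Eq.symm ?_)
      rw [Measure.restrict_restrict measurableSet_Iic]
      have : Iic x ∩ Ioo (0 : ℝ) 1 = ∅ := by
        ext u; simp only [mem_inter_iff, mem_Iic, mem_Ioo, mem_empty_iff_false, iff_false]
        exact fun h => by linarith [h.1, h.2.1]
      simp [this]
    rcases le_or_gt 1 x with hx1 | hx1
    · refine le_of_eq ?_
      rw [← hu0, Measure.restrict_eq_self_of_ae_mem (s := Iic x)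
         (hUmem.mono fun u hu => hu.2.le.trans hx1)]
    -- At this level the integral of y - quantile H up to x is at most the shortfall of H, hence
    -- that of G; the latter is exactly the integral of y - quantile G up to x, as that quantile is
    -- monotone.
    set y := quantile G x with hy
    have hc : ∀ μ : Measure ℝ, IsProbabilityMeasure μ → (∀ᵐ u ∂U, quantile μ u ∈ Icc c d) →
        Integrable (fun u => max (y - quantile μ u) 0) U ∧
        Integrable (fun u => y - quantile μ u) U := fun μ _ hμ => by
      have h0 : Integrable (fun u => y - quantile μ u) U := (integrable_const y).sub
        (Integrable.of_mem_Icc c d measurable_quantile.aemeasurable hμ)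
      exact ⟨h0.pos_part, h0⟩
    obtain ⟨i1, i2⟩ := hc H inferInstance (hUmem.mono hHI)
    obtain ⟨i3, i4⟩ := hc G inferInstance (hUmem.mono hGI)
    have e1 : ∫ u in Iic x, (y - quantile H u) ∂U ≤ ∫ u, max (y - quantile H u) 0 ∂U :=
      (integral_mono i2.integrableOn i1.integrableOn fun u => le_max_left _ _).trans
        (setIntegral_le_integral i1 (ae_of_all _ fun u => le_max_right _ _))
    have e2 : ∫ u, max (y - quantile G u) 0 ∂U = ∫ u in Iic x, (y - quantile G u) ∂U := by
      rw [← integral_indicator measurableSet_Iic]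
      refine integral_congr_ae (hUmem.mono fun u hu => ?_)
      simp only [indicator, mem_Iic]
      split_ifs with h
      · have := quantile_mono (μ := G) (by rwa [probReal_univ])
          (by rw [probReal_univ]; exact ⟨hx, hx1⟩) h
        exact max_eq_left (by linarith)
      · have := quantile_mono (μ := G) (by rw [probReal_univ]; exact ⟨hx, hx1⟩)
          (by rwa [probReal_univ]) (not_le.1 h).le
        exact max_eq_right (by linarith)
    have e3 := hle y
    rw [← integral_quantile (continuous_max_sub y),
      ← integral_quantile (continuous_max_sub y)] at e3
    have e4 : ∫ u in Iic x, (y - quantile G u) ∂U - ∫ u in Iic x, (y - quantile H u) ∂U =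
        ∫ u in Iic x, (quantile H u - quantile G u) ∂U := by
      rw [← integral_sub i4.integrableOn i2.integrableOn]
      exact integral_congr_ae (ae_of_all _ fun u => by simp only; ring)
    linarith
  -- Matched in order, the excess of H over G precedes its deficit; this gives φ (ξ t) ≤ φ (ζ t) in
  -- the transport.
  have hquant : ∀ t ∈ Ioo 0 (α.real univ), quantile α t ≤ quantile β t := fun t ht => by
    rw [quantile_le_iff ht]
    exact ((quantile_le_iff (huniv ▸ ht)).1 le_rfl).trans (hIic _)
  have hae1 := ae_quantile_withDensity_pos (U := U) mφψ measurableSet_Ioo hUmem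
  have hae2 := ae_quantile_withDensity_pos (U := U) mψφ measurableSet_Ioo hUmem
  rw [← hα] at hae1
  rw [← hβ, ← huniv] at hae2
  refine isSplittingMeans_of_transport (U := U) (V := volume.restrict (Ioo 0 (α.real univ)))
    (ξ := quantile α) (ζ := quantile β) mφ mψ measurable_quantile measurable_quantile
    (hUmem.mono hGI) ?_ ?_ (fun g hg => lintegral_quantile_withDensity mφψ hg)
    (fun g hg => ?_) ?_
  · simpa using map_quantile (μ := G)
  · simpa using map_quantile (μ := H)
  · rw [huniv]
    exact lintegral_quantile_withDensity mψφ hg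
  · filter_upwards [hae1, hae2, ae_restrict_mem measurableSet_Ioo] with t ⟨ht1, ht2⟩ ⟨ht3, ht4⟩ ht
    exact ⟨hGI _ ht1, hGI _ ht3, sub_pos.1 ht2, quantile_mono (by rwa [probReal_univ])
      (by rwa [probReal_univ]) (hquant t ht), sub_pos.1 ht4⟩

end Strassen

/-! ### Existence of equilibrium by duality. -/

section Profit

variable {a b c d : ℝ} {v : ℝ → ℝ → ℝ} {F G : Measure ℝ} {q r : ℝ → ℝ}

/-- The maximal profit of a firm of type `x` at wages `q`. -/
noncomputable def profit (c d : ℝ) (v : ℝ → ℝ → ℝ) (q : ℝ → ℝ) (x : ℝ) : ℝ :=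
  sSup ((fun z => v x z - q z) '' Icc c d)

/-- The dual objective: total wages plus total profits. -/
noncomputable def dualValue (c d : ℝ) (v : ℝ → ℝ → ℝ) (F G : Measure ℝ) (q : ℝ → ℝ) : ℝ :=
  ∫ y, q y ∂G + ∫ x, profit c d v q x ∂F

lemma profit_spec (hcd : c ≤ d) (hv : IsProductionFunction a b c d v)
    (hq : ContinuousOn q (Icc c d)) {x : ℝ} (hx : x ∈ Icc a b) :
    (∃ z ∈ Icc c d, profit c d v q x = v x z - q z) ∧
      ∀ y ∈ Icc c d, v x y - q y ≤ profit c d v q x := by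
  obtain ⟨z, hz, hmax⟩ := isCompact_Icc.exists_isMaxOn (nonempty_Icc.2 hcd)
    ((hv.continuousOn_snd hx).sub hq)
  have heq : profit c d v q x = v x z - q z :=
    IsGreatest.csSup_eq ⟨mem_image_of_mem _ hz, by rintro _ ⟨y, hy, rfl⟩; exact hmax hy⟩
  exact ⟨⟨z, hz, heq⟩, fun y hy => heq ▸ hmax hy⟩

/-- A maximum of functions with a common Lipschitz constant in x is Lipschitz. -/
lemma integrable_profit (hcd : c ≤ d) (hv : IsProductionFunction a b c d v)
    (hq : ContinuousOn q (Icc c d)) [IsProbabilityMeasure F] (hF : F (Icc a b)ᶜ = 0) :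
    Integrable (profit c d v q) F := by
  obtain ⟨L, hL, -, hLx⟩ := hv.exists_lipschitz_const
  have : LipschitzOnWith ⟨L, hL.le⟩ (profit c d v q) (Icc a b) := by
    refine LipschitzOnWith.of_le_add_mul _ fun x hx y hy => ?_
    obtain ⟨z, hz, hzx⟩ := (profit_spec hcd hv hq hx).1
    have h1 := (profit_spec hcd hv hq hy).2 z hz
    have h2 := (abs_le.1 (hLx x hx y hy z hz)).2
    change profit c d v q x ≤ profit c d v q y + L * |x - y|
    linarith
  exact this.continuousOn.integrable_of_compl_Icc hF

lemma dualValue_le_add (hcd : c ≤ d) (hv : IsProductionFunction a b c d v)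
    (hq : ContinuousOn q (Icc c d)) (hr : ContinuousOn r (Icc c d)) [IsProbabilityMeasure F]
    (hF : F (Icc a b)ᶜ = 0) [IsProbabilityMeasure G] (hG : G (Icc c d)ᶜ = 0) {e e' : ℝ}
    (h : ∀ z ∈ Icc c d, q z ≤ r z + e)
    (h' : ∀ x ∈ Icc a b, profit c d v q x ≤ profit c d v r x + e') :
    dualValue c d v F G q ≤ dualValue c d v F G r + (e + e') := by
  have h1 : ∫ y, q y ∂G ≤ ∫ y, (r y + e) ∂G :=
    integral_mono_ae (hq.integrable_of_compl_Icc hG)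
      ((hr.integrable_of_compl_Icc hG).add (integrable_const e)) ((ae_mem_Icc hG).mono h)
  have h2 : ∫ x, profit c d v q x ∂F ≤ ∫ x, (profit c d v r x + e') ∂F :=
    integral_mono_ae (integrable_profit hcd hv hq hF)
      ((integrable_profit hcd hv hr hF).add (integrable_const e')) ((ae_mem_Icc hF).mono h')
  rw [integral_add (hr.integrable_of_compl_Icc hG) (integrable_const e)] at h1
  rw [integral_add (integrable_profit hcd hv hr hF) (integrable_const e')] at h2
  simp only [integral_const, probReal_univ, one_smul] at h1 h2
  unfold dualValue
  linarith

/-- Wages can be replaced by `L`-Lipschitz wages that vanish at `c`, without raising the dual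
objective. -/
lemma exists_lipschitz_dualValue_le (hcd : c ≤ d) (hv : IsProductionFunction a b c d v)
    (hr : ConvexOn ℝ (Icc c d) r) (hrc : ContinuousOn r (Icc c d)) [IsProbabilityMeasure F]
    (hF : F (Icc a b)ᶜ = 0) [IsProbabilityMeasure G] (hG : G (Icc c d)ᶜ = 0) {L : ℝ} (hL : 0 ≤ L)
    (hvL : ∀ x ∈ Icc a b, ∀ z ∈ Icc c d, ∀ z' ∈ Icc c d, |v x z - v x z'| ≤ L * |z - z'|) :
    ∃ q, ConvexOn ℝ (Icc c d) q ∧ (∀ y ∈ Icc c d, ∀ z ∈ Icc c d, |q y - q z| ≤ L * |y - z|) ∧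
      q c = 0 ∧ dualValue c d v F G q ≤ dualValue c d v F G r := by
  have hex : ∀ z, ∃ y ∈ Icc c d, ∀ y' ∈ Icc c d, r y + L * |z - y| ≤ r y' + L * |z - y'| :=
    fun z => isCompact_Icc.exists_isMinOn (nonempty_Icc.2 hcd)
      (hrc.add (by fun_prop : Continuous fun y => L * |z - y|).continuousOn)
  choose Y hY hmin using hex
  -- The infimal convolution of r with L |·| is convex, L-Lipschitz and at most r. Profits do not
  -- rise: choosing Y z at wages r instead of z at wages s lowers output by at most L |z - Y z|, the
  -- wage saved.
  set s : ℝ → ℝ := fun z => r (Y z) + L * |z - Y z| with hs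
  have hsr : ∀ z ∈ Icc c d, s z ≤ r z := fun z hz => by simpa using hmin z z hz
  have hslip' : ∀ y z, s y ≤ s z + L * |y - z| := fun y z => by
    have h1 := hmin y _ (hY z)
    have h2 := abs_sub_le y z (Y z)
    simp only [hs]
    nlinarith
  have hslip : ∀ y z, |s y - s z| ≤ L * |y - z| := fun y z => by
    rw [abs_le]
    have h1 := hslip' y z
    have h2 := hslip' z y
    rw [abs_sub_comm] at h2
    constructor <;> linarith
  have hsconv : ConvexOn ℝ (Icc c d) s := by
    refine ⟨convex_Icc c d, fun x hx y hy α β hα hβ hαβ => ?_⟩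
    have h1 := hmin (α • x + β • y) _ ((convex_Icc c d) (hY x) (hY y) hα hβ hαβ)
    have h2 := hr.2 (hY x) (hY y) hα hβ hαβ
    have h3 : |α • x + β • y - (α • Y x + β • Y y)| ≤ α * |x - Y x| + β * |y - Y y| := by
      calc _ = |α * (x - Y x) + β * (y - Y y)| := by simp only [smul_eq_mul]; ring_nf
        _ ≤ |α * (x - Y x)| + |β * (y - Y y)| := abs_add_le _ _
        _ = _ := by rw [abs_mul, abs_mul, abs_of_nonneg hα, abs_of_nonneg hβ]
    have h4 := mul_le_mul_of_nonneg_left h3 hL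
    simp only [hs]
    refine h1.trans ?_
    simp only [smul_eq_mul] at h2 h4 ⊢
    linarith
  have hsc : Continuous s :=
    (LipschitzWith.of_le_add_mul (⟨L, hL⟩ : NNReal) fun x y => hslip' x y).continuous
  -- Subtracting a constant lowers total wages and raises total profits equally.
  refine ⟨fun z => s z - s c, hsconv.sub (concaveOn_const _ (convex_Icc c d)), fun y _ z _ => ?_,
    by simp, ?_⟩
  · rw [sub_sub_sub_cancel_right]; exact hslip y z
  · have hsc' : ContinuousOn (fun z => s z - s c) (Icc c d) :=
      (hsc.sub continuous_const).continuousOn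
    have := dualValue_le_add hcd hv hsc' hrc hF hG (e := - s c) (e' := s c) (F := F) (G := G)
      (fun z hz => by linarith [hsr z hz]) fun x hx => by
        obtain ⟨z, hz, hzx⟩ := (profit_spec hcd hv hsc' hx).1
        have h1 := (profit_spec hcd hv hrc hx).2 _ (hY z)
        have h2 := (abs_le.1 (hvL x hx z hz _ (hY z))).2
        rw [hzx]
        linarith
    simpa using this

open BoundedContinuousFunction in
/-- The dual objective attains its minimum among convex wages. -/
lemma exists_isMinOn_dualValue (hcd : c ≤ d) (hv : IsProductionFunction a b c d v)
    [IsProbabilityMeasure F] (hF : F (Icc a b)ᶜ = 0) [IsProbabilityMeasure G]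
    (hG : G (Icc c d)ᶜ = 0) :
    ∃ q, ConvexOn ℝ (Icc c d) q ∧ (∃ K, LipschitzOnWith K q (Icc c d)) ∧
      ∀ r, ConvexOn ℝ (Icc c d) r → ContinuousOn r (Icc c d) →
        dualValue c d v F G q ≤ dualValue c d v F G r := by
  obtain ⟨L, hL, hLz, -⟩ := hv.exists_lipschitz_const
  set ext : (Icc c d →ᵇ ℝ) → ℝ → ℝ := fun f y => f (projIcc c d hcd y) with hext
  have hextc : ∀ f, Continuous (ext f) := fun f => f.continuous.comp continuous_projIcc
  have hev : ∀ y, Continuous fun f : Icc c d →ᵇ ℝ => ext f y := fun y =>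
    continuous_eval_const (F := Icc c d →ᵇ ℝ) (projIcc c d hcd y)
  -- The Lipschitz bound and the normalization at c give compactness by Arzelà–Ascoli; convexity
  -- passes to pointwise limits.
  set A : Set (Icc c d →ᵇ ℝ) := {f | ConvexOn ℝ (Icc c d) (ext f) ∧
    (∀ y ∈ Icc c d, ∀ z ∈ Icc c d, |ext f y - ext f z| ≤ L * |y - z|) ∧ ext f c = 0} with hA
  have hAlip : ∀ f ∈ A, LipschitzWith ⟨L, hL.le⟩ f := fun f hf =>
    LipschitzWith.of_dist_le_mul fun y z => by
      have := hf.2.1 y y.2 z z.2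
      simp only [hext, projIcc_val] at this
      exact this
  have hcI : c ∈ Icc c d := left_mem_Icc.2 hcd
  have hcompact : IsCompact A := by
    refine arzela_ascoli₂ (Icc (-(L * (d - c))) (L * (d - c))) isCompact_Icc A ?_ ?_ ?_
    · refine IsClosed.inter ?_ (IsClosed.inter ?_ (isClosed_eq (hev c) continuous_const))
      · have : {f | ConvexOn ℝ (Icc c d) (ext f)} = ⋂ x ∈ Icc c d, ⋂ y ∈ Icc c d, ⋂ α : ℝ,
            ⋂ β : ℝ, ⋂ (_ : 0 ≤ α), ⋂ (_ : 0 ≤ β), ⋂ (_ : α + β = 1),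
            {f | ext f (α • x + β • y) ≤ α • ext f x + β • ext f y} := by
          ext f
          simp only [mem_ofPred_eq, mem_iInter]
          exact ⟨fun h x hx y hy α β hα hβ hs => h.2 hx hy hα hβ hs, fun h => ⟨convex_Icc c d,
            fun x hx y hy α β hα hβ hs => h x hx y hy α β hα hβ hs⟩⟩
        change IsClosed {f | ConvexOn ℝ (Icc c d) (ext f)}
        rw [this]
        exact isClosed_biInter fun x _ => isClosed_biInter fun y _ => isClosed_iInter fun α =>
          isClosed_iInter fun β => isClosed_iInter fun _ => isClosed_iInter fun _ =>
          isClosed_iInter fun _ => isClosed_le (hev (α • x + β • y))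
            (((hev x).const_smul α).add ((hev y).const_smul β))
      · have : {f | ∀ y ∈ Icc c d, ∀ z ∈ Icc c d, |ext f y - ext f z| ≤ L * |y - z|} =
            ⋂ y ∈ Icc c d, ⋂ z ∈ Icc c d, {f | |ext f y - ext f z| ≤ L * |y - z|} := by
          ext f
          simp only [mem_ofPred_eq, mem_iInter]
        change IsClosed {f | ∀ y ∈ Icc c d, ∀ z ∈ Icc c d, |ext f y - ext f z| ≤ L * |y - z|}
        rw [this]
        exact isClosed_biInter fun y _ => isClosed_biInter fun z _ =>
          isClosed_le ((hev y).sub (hev z)).abs continuous_const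
    · intro f y hf
      have h1 := hf.2.1 y y.2 c hcI
      rw [hf.2.2, sub_zero] at h1
      have h2 : ext f y = f y := by simp [hext]
      rw [h2, abs_of_nonneg (sub_nonneg.2 y.2.1)] at h1
      have h3 : L * (y - c) ≤ L * (d - c) := by
        have := y.2.2
        gcongr
      exact abs_le.1 (h1.trans h3)
    · exact (LipschitzWith.uniformEquicontinuous _ ⟨L, hL.le⟩
        fun f : A => hAlip f f.2).equicontinuous
  -- Wages and profits each move by at most the uniform distance, hence the constant 2.
  have hcont : Continuous fun f : Icc c d →ᵇ ℝ => dualValue c d v F G (ext f) := by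
    refine (LipschitzWith.of_le_add_mul (2 : NNReal) fun f g => ?_).continuous
    have hfg : ∀ y, |ext f y - ext g y| ≤ dist f g := fun y =>
      dist_coe_le_dist (f := f) (g := g) (projIcc c d hcd y)
    have := dualValue_le_add hcd hv (hextc f).continuousOn (hextc g).continuousOn hF hG
      (e := dist f g) (e' := dist f g) (F := F) (G := G)
      (fun z hz => by linarith [(abs_le.1 (hfg z)).2]) fun x hx => by
        obtain ⟨z, hz, hzx⟩ := (profit_spec hcd hv (hextc f).continuousOn hx).1
        have h1 := (profit_spec hcd hv (hextc g).continuousOn hx).2 z hz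
        linarith [(abs_le.1 (hfg z)).1]
    simp only [NNReal.coe_ofNat]
    linarith
  have hmemA : ∀ q, ConvexOn ℝ (Icc c d) q →
      (∀ y ∈ Icc c d, ∀ z ∈ Icc c d, |q y - q z| ≤ L * |y - z|) → q c = 0 →
      ∃ f ∈ A, ∀ y ∈ Icc c d, ext f y = q y := fun q hq hqL hq0 => by
    have hqc : LipschitzOnWith ⟨L, hL.le⟩ q (Icc c d) :=
      LipschitzOnWith.of_dist_le_mul fun y hy z hz => hqL y hy z hz
    have heq : ∀ y ∈ Icc c d, ext (mkOfCompact ⟨_, hqc.continuousOn.domRestrict⟩) y = q y :=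
      fun y hy => by simp [hext, projIcc_of_mem hcd hy]
    refine ⟨mkOfCompact ⟨_, hqc.continuousOn.domRestrict⟩, ⟨hq.congr fun y hy => (heq y hy).symm,
      fun y hy z hz => ?_, by rw [heq c hcI, hq0]⟩, heq⟩
    rw [heq y hy, heq z hz]
    exact hqL y hy z hz
  obtain ⟨f₁, hf₁, -⟩ := hmemA (fun _ => 0) (convexOn_const 0 (convex_Icc c d))
    (fun y _ z _ => by simpa using mul_nonneg hL.le (abs_nonneg _)) rfl
  obtain ⟨f, hf, hmin⟩ := hcompact.exists_isMinOn ⟨f₁, hf₁⟩ hcont.continuousOn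
  refine ⟨ext f, hf.1, ⟨⟨L, hL.le⟩, LipschitzOnWith.of_dist_le_mul fun y hy z hz =>
    hf.2.1 y hy z hz⟩, fun r hr hrc => ?_⟩
  obtain ⟨q, hq, hqL, hq0, hle⟩ := exists_lipschitz_dualValue_le hcd hv hr hrc hF hG hL.le hLz
  obtain ⟨g, hg, hgq⟩ := hmemA q hq hqL hq0
  have hqc : LipschitzOnWith ⟨L, hL.le⟩ q (Icc c d) :=
    LipschitzOnWith.of_dist_le_mul fun y hy z hz => hqL y hy z hz
  have hgle := dualValue_le_add hcd hv (hextc g).continuousOn hqc.continuousOn hF hG (e := 0)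
    (e' := 0) (F := F) (G := G) (fun z hz => by rw [hgq z hz, add_zero]) fun x hx => by
      obtain ⟨z, hz, hzx⟩ := (profit_spec hcd hv (hextc g).continuousOn hx).1
      rw [hzx, hgq z hz, add_zero]
      exact (profit_spec hcd hv hqc.continuousOn hx).2 z hz
  have := hmin hg
  simp only [mem_ofPred_eq] at this
  linarith

/-- First-order condition for the dual problem: a feasible perturbation `h` of minimizing wages has
a larger integral under the worker distribution than under the distribution of demands. -/
lemma integral_demand_le (hab : a < b) (hcd : c < d) (hv : IsProductionFunction a b c d v)
    [IsProbabilityMeasure F] (hF : F (Icc a b)ᶜ = 0) [IsProbabilityMeasure G]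
    (hG : G (Icc c d)ᶜ = 0) {Z h : ℝ → ℝ} (hq : ConvexOn ℝ (Icc c d) q)
    (hqc : ContinuousOn q (Icc c d)) (hZ : IsDemand a b c d v q Z)
    (hmin : ∀ r, ConvexOn ℝ (Icc c d) r → ContinuousOn r (Icc c d) →
      dualValue c d v F G q ≤ dualValue c d v F G r)
    (hh : ∃ K, LipschitzOnWith K h (Icc c d))
    (hconv : ∀ ε ∈ Ioc (0 : ℝ) 1, ConvexOn ℝ (Icc c d) fun y => q y + ε * h y) :
    ∫ x, h (Z x) ∂F ≤ ∫ y, h y ∂G := by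
  obtain ⟨κ, hκ, hgap⟩ := exists_isDemand_gap hab hcd hv
  obtain ⟨K, hK⟩ := hh
  have hhc := hK.continuousOn
  have hhG := hhc.integrable_of_compl_Icc hG
  have hqG := hqc.integrable_of_compl_Icc hG
  have hHp : IsProbabilityMeasure (F.map Z) :=
    Measure.isProbabilityMeasure_map hZ.measurable.aemeasurable
  have hhZ : Integrable (fun x => h (Z x)) F := by
    refine (hhc.integrable_of_compl_Icc (μ := F.map Z) ?_).comp_aemeasurable
      hZ.measurable.aemeasurable
    rw [Measure.map_apply hZ.measurable measurableSet_Icc.compl]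
    have : Z ⁻¹' (Icc c d)ᶜ = ∅ := by ext x; simpa using hZ.mem x
    simp [this]
  have hprof := integrable_profit hcd.le hv hqc hF
  -- Reoptimizing by a distance u gains at most εKu - κu² ≤ ε²C, so keeping Z is optimal to first
  -- order in ε.
  set C : ℝ := (K : ℝ) ^ 2 / (4 * κ) with hC
  have hC0 : 0 ≤ C := by positivity
  have key : ∀ ε ∈ Ioc (0 : ℝ) 1, ∫ x, h (Z x) ∂F ≤ ∫ y, h y ∂G + ε * C := fun ε hε => by
    have hrc : ContinuousOn (fun y => q y + ε * h y) (Icc c d) :=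
      hqc.add (continuousOn_const.mul hhc)
    have h1 := hmin _ (hconv ε hε) hrc
    unfold dualValue at h1
    rw [integral_add hqG (hhG.const_mul ε), integral_const_mul] at h1
    have hint : Integrable (fun x => profit c d v q x - ε * h (Z x)) F :=
      hprof.sub (hhZ.const_mul ε)
    have h2 : ∫ x, profit c d v (fun y => q y + ε * h y) x ∂F ≤
        ∫ x, ((profit c d v q x - ε * h (Z x)) + ε ^ 2 * C) ∂F := by
      refine integral_mono_ae (integrable_profit hcd.le hv hrc hF)
        (hint.add (integrable_const _)) ((ae_mem_Icc hF).mono fun x hx => ?_)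
      obtain ⟨z, hz, hzx⟩ := (profit_spec hcd.le hv hrc hx).1
      have e1 := hgap q Z hq hZ x hx z hz
      have e2 := (profit_spec hcd.le hv hqc hx).2 _ (hZ.mem x)
      have e3 : |h (Z x) - h z| ≤ K * |Z x - z| := hK.dist_le_mul _ (hZ.mem x) z hz
      have e4 := (abs_le.1 e3).2
      have e5 : ε * K * |Z x - z| ≤ ε ^ 2 * C + κ * (z - Z x) ^ 2 := by
        have e6 : (z - Z x) ^ 2 = |Z x - z| ^ 2 := by rw [sq_abs]; ring
        have e7 : ε ^ 2 * C + κ * |Z x - z| ^ 2 - ε * K * |Z x - z| =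
            (ε * K - 2 * κ * |Z x - z|) ^ 2 / (4 * κ) := by
          rw [hC]; field_simp; ring
        have e8 : 0 ≤ (ε * K - 2 * κ * |Z x - z|) ^ 2 / (4 * κ) := by positivity
        rw [e6]; linarith
      have e9 := mul_le_mul_of_nonneg_left e4 hε.1.le
      simp only [hzx]
      nlinarith
    rw [integral_add hint (integrable_const _), integral_sub hprof (hhZ.const_mul ε),
      integral_const_mul] at h2
    simp only [integral_const, probReal_univ, one_smul] at h2
    have h3 : ε * ∫ x, h (Z x) ∂F ≤ ε * (∫ y, h y ∂G + ε * C) := by nlinarith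
    exact le_of_mul_le_mul_left h3 hε.1
  refine le_of_forall_pos_le_add fun δ hδ => ?_
  have hmin1 : min 1 (δ / (C + 1)) ∈ Ioc (0 : ℝ) 1 :=
    ⟨lt_min one_pos (by positivity), min_le_left _ _⟩
  refine (key _ hmin1).trans ?_
  have : min 1 (δ / (C + 1)) * C ≤ δ / (C + 1) * C :=
    mul_le_mul_of_nonneg_right (min_le_right _ _) hC0
  have h2 : δ / (C + 1) * C ≤ δ := by
    rw [div_mul_eq_mul_div, div_le_iff₀ (by positivity)]; nlinarith
  linarith

/-- Competitive equilibria exist. -/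
theorem exists_isSorting (hab : a < b) (hcd : c < d) (hv : IsProductionFunction a b c d v)
    [IsProbabilityMeasure F] (hF : F (Icc a b)ᶜ = 0) [IsProbabilityMeasure G]
    (hG : G (Icc c d)ᶜ = 0) : ∃ H q Z, IsSorting a b c d v F G H q Z := by
  obtain ⟨q, hq, ⟨K, hK⟩, hmin⟩ := exists_isMinOn_dualValue (F := F) (G := G) hcd.le hv hF hG
  obtain ⟨Z, hZ⟩ := exists_isDemand hab hcd hv hK.continuousOn
  have hHp : IsProbabilityMeasure (F.map Z) :=
    Measure.isProbabilityMeasure_map hZ.measurable.aemeasurable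
  have hH : F.map Z (Icc c d)ᶜ = 0 := by
    rw [Measure.map_apply hZ.measurable measurableSet_Icc.compl]
    have : Z ⁻¹' (Icc c d)ᶜ = ∅ := by ext x; simpa using hZ.mem x
    simp [this]
  have key : ∀ h : ℝ → ℝ, (∃ K, LipschitzOnWith K h (Icc c d)) →
      (∀ ε ∈ Ioc (0 : ℝ) 1, ConvexOn ℝ (Icc c d) fun y => q y + ε * h y) →
      ∫ z, h z ∂(F.map Z) ≤ ∫ y, h y ∂G := fun h hh hconv => by
    obtain ⟨K', hK'⟩ := hh
    rw [integral_map hZ.measurable.aemeasurable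
      (hK'.continuousOn.integrable_of_compl_Icc hH).aestronglyMeasurable]
    exact integral_demand_le hab hcd hv hF hG hq hK.continuousOn hZ hmin ⟨K', hK'⟩ hconv
  have key' : ∀ h : ℝ → ℝ, (∃ K, LipschitzOnWith K h (Icc c d)) → ConvexOn ℝ (Icc c d) h →
      ∫ z, h z ∂(F.map Z) ≤ ∫ y, h y ∂G := fun h hh hconv =>
    key h hh fun ε hε => hq.add (hconv.smul hε.1.le)
  -- q - εq = (1 - ε) q is convex for ε ≤ 1, so -q is a feasible direction; with the direction q it
  -- yields the wage balance.
  have hqneg : ∫ z, -q z ∂(F.map Z) ≤ ∫ y, -q y ∂G := by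
    refine key _ ⟨K, hK.neg⟩ fun ε hε => ?_
    refine (hq.smul (sub_nonneg.2 hε.2)).congr fun y _ => ?_
    simp only [smul_eq_mul]; ring
  have hidneg : ∫ z, -z ∂(F.map Z) ≤ ∫ y, -y ∂G :=
    key' _ ⟨1, (LipschitzWith.id.neg).lipschitzOnWith⟩ (concaveOn_id (convex_Icc c d)).neg
  rw [integral_neg, integral_neg] at hqneg hidneg
  refine ⟨F.map Z, q, Z, hZ, hq, ⟨K, hK⟩, rfl, isSplittingMeans_of_integral_max_le hG hH
    (fun y => key' _ ⟨1, ?_⟩ (convexOn_max_sub _ (convex_Icc c d) y))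
    (le_antisymm (key' _ ⟨1, LipschitzWith.id.lipschitzOnWith⟩ (convexOn_id (convex_Icc c d)))
      (by linarith)), le_antisymm (key' _ ⟨K, hK⟩ hq) (by linarith)⟩
  refine (LipschitzWith.of_le_add_mul 1 fun s t => ?_).lipschitzOnWith
  simp only [NNReal.coe_one, one_mul, Real.dist_eq]
  have := abs_sub_comm s t
  have := le_abs_self (t - s)
  refine max_le ?_ (by positivity)
  linarith [le_max_left (y - t) 0]

end Profit

/-! ### Uniform distributions and densities bounded below. -/

section Densities

variable {a b : ℝ}

/-- The uniform distribution on `[a, b]`. -/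
noncomputable def uniformDistribution (a b : ℝ) : Measure ℝ :=
  (volume.restrict (Icc a b)).withDensity fun _ => ENNReal.ofReal (1 / (b - a))

lemma isProbabilityMeasure_uniformDistribution (hab : a < b) :
    IsProbabilityMeasure (uniformDistribution a b) := by
  have h0 : 0 < b - a := by linarith
  refine ⟨?_⟩
  rw [uniformDistribution, withDensity_apply _ MeasurableSet.univ, Measure.restrict_univ,
    lintegral_const, Measure.restrict_apply_univ, Real.volume_Icc,
    ← ENNReal.ofReal_mul (by positivity), one_div_mul_cancel h0.ne', ENNReal.ofReal_one]

lemma isTypeDistribution_uniformDistribution (hab : a < b) :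
    IsTypeDistribution a b (uniformDistribution a b) :=
  ⟨isProbabilityMeasure_uniformDistribution hab, fun _ => 1 / (b - a), continuousOn_const,
    fun _ _ => one_div_pos.2 (by linarith), rfl⟩

lemma uniformDistribution_Ioc_le (hab : a < b) {r s : ℝ} (hrs : r ≤ s) :
    (uniformDistribution a b).real (Ioc r s) ≤ (s - r) / (b - a) := by
  have h0 : 0 < b - a := by linarith
  have : uniformDistribution a b (Ioc r s) ≤ ENNReal.ofReal ((s - r) / (b - a)) := by
    rw [uniformDistribution, withDensity_apply _ measurableSet_Ioc, lintegral_const,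
      Measure.restrict_apply_univ]
    calc _ ≤ ENNReal.ofReal (1 / (b - a)) * volume (Ioc r s) := by
          gcongr; exact Measure.restrict_le_self
      _ = _ := by
        rw [Real.volume_Ioc, ← ENNReal.ofReal_mul (by positivity)]
        congr 1; ring
  rw [measureReal_def]
  exact ENNReal.toReal_le_of_le_ofReal (div_nonneg (by linarith) h0.le) this

/-- The density of a type distribution is bounded below. -/
lemma IsTypeDistribution.exists_le_cdf_sub {c d : ℝ} {G : Measure ℝ} (hcd : c ≤ d)
    (hG : IsTypeDistribution c d G) :
    ∃ g : ℝ, 0 < g ∧ ∀ y y', c ≤ y → y ≤ y' → y' ≤ d →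
      g * (y' - y) ≤ ProbabilityTheory.cdf G y' - ProbabilityTheory.cdf G y := by
  obtain ⟨hp, f, hf, hpos, hGf⟩ := hG
  obtain ⟨t, ht, hmin⟩ := isCompact_Icc.exists_isMinOn (nonempty_Icc.2 hcd) hf
  refine ⟨f t, hpos t ht, fun y y' hy hyy hy' => ?_⟩
  have h1 : ProbabilityTheory.cdf G y' - ProbabilityTheory.cdf G y = G.real (Ioc y y') := by
    rw [ProbabilityTheory.cdf_eq_real, ProbabilityTheory.cdf_eq_real, ← Iic_sdiff_Iic,
      measureReal_sdiff (Iic_subset_Iic.2 hyy) measurableSet_Iic]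
  rw [h1, measureReal_def, ← ENNReal.ofReal_le_iff_le_toReal (measure_ne_top G _), hGf,
    withDensity_apply _ measurableSet_Ioc, Measure.restrict_restrict measurableSet_Ioc]
  have h2 : Ioc y y' ∩ Icc c d = Ioc y y' := inter_eq_left.2 fun s hs =>
    ⟨hy.trans hs.1.le, hs.2.trans hy'⟩
  rw [h2, ENNReal.ofReal_mul (hpos t ht).le, ← Real.volume_Ioc, ← setLIntegral_const]
  exact setLIntegral_mono' measurableSet_Ioc fun s hs =>
    ENNReal.ofReal_le_ofReal (hmin ⟨hy.trans hs.1.le, hs.2.trans hy'⟩)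

end Densities

/-! ### Complete sorting under strong complementarity. -/

section Quadratic

variable {a b c d K : ℝ}

/-- A production function with complementarity `K`. -/
noncomputable def quadraticProduction (K x z : ℝ) : ℝ := K * x * z - z ^ 2 / 2

lemma marginalReturn_quadraticProduction (hcd : c < d) {x z : ℝ} (hz : z ∈ Icc c d) :
    marginalReturn c d (quadraticProduction K) x z = K * x - z := by
  have h : HasDerivAt (fun t => quadraticProduction K x t) (K * x - z) z := by
    have := ((hasDerivAt_id z).const_mul (K * x)).sub (((hasDerivAt_id z).pow 2).div_const 2)
    refine this.congr_deriv ?_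
    simp
  exact h.hasDerivWithinAt.derivWithin (uniqueDiffOn_Icc hcd z hz)

lemma isProductionFunction_quadraticProduction (hab : a < b) (hcd : c < d) (hK : 0 < K) :
    IsProductionFunction a b c d (quadraticProduction K) where
  contDiffOn := by
    unfold quadraticProduction
    fun_prop
  increasing_differences x hx z hz := by
    simp_rw [marginalReturn_quadraticProduction hcd hz]
    have h : HasDerivAt (fun s => K * s - z) K x := by
      simpa using ((hasDerivAt_id x).const_mul K).sub_const z
    rwa [h.hasDerivWithinAt.derivWithin (uniqueDiffOn_Icc hab x hx)]
  decreasing_returns x hx z hz := by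
    rw [derivWithin_congr (f := fun t => K * x - t)
      (fun t ht => marginalReturn_quadraticProduction hcd ht)
      (marginalReturn_quadraticProduction hcd hz)]
    have h : HasDerivAt (fun t => K * x - t) (-1) z := by
      simpa using (hasDerivAt_id z).const_sub (K * x)
    rw [h.hasDerivWithinAt.derivWithin (uniqueDiffOn_Icc hcd z hz)]
    norm_num

/-- If complementarities are strong, then workers are completely sorted in equilibrium. -/
lemma IsTypeDistribution.exists_forall_integral_max_le (hab : a < b) (hcd : c < d) {G : Measure ℝ}
    (hG : IsTypeDistribution c d G) : ∃ K₀ : ℝ, 0 < K₀ ∧ ∀ K, K₀ ≤ K → ∀ H q Z,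
      IsSorting a b c d (quadraticProduction K) (uniformDistribution a b) G H q Z →
      ∀ w ∈ Icc c d, ∫ s, max (w - s) 0 ∂G ≤ ∫ s, max (w - s) 0 ∂H := by
  obtain ⟨g, hg, hgc⟩ := hG.exists_le_cdf_sub hcd.le
  have h0 : 0 < b - a := by linarith
  -- Where q has slope l, the first-order condition reads Z x = K x - l, so H charges (y, y'] with
  -- at most (y' - y) / (K (b - a)). For K this large that is at most g (y' - y), a lower bound for
  -- G, whereas a crossing needs more H-mass than G-mass.
  refine ⟨1 / ((b - a) * g), by positivity, fun K hK H q Z h w hw => ?_⟩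
  have hK0 : 0 < K := lt_of_lt_of_le (by positivity) hK
  have hv := isProductionFunction_quadraticProduction hab hcd hK0
  have hF := isTypeDistribution_uniformDistribution hab
  have hFp := hF.1
  have hGp := hG.1
  have hHp := h.isProbabilityMeasure
  obtain ⟨hG0, hH0⟩ := h.splitting.compl_eq_zero
  by_contra! hlt
  obtain ⟨y₀, y₁, y, y', hy₀, hyy, hy₁, hc, hd, hslack, hcdf, hcdf'⟩ :=
    exists_crossing hH0 hG0 (h.integral_id hcd.le) hw hlt
  obtain ⟨l, hl⟩ := h.exists_common_subgradient hcd.le hslack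
  have h1 := hgc y y' (by linarith) hyy.le (by linarith)
  have h2 : ProbabilityTheory.cdf H y' - ProbabilityTheory.cdf H y ≤ (y' - y) / K / (b - a) := by
    have hsub : {x | Z x ≤ y} ⊆ {x | Z x ≤ y'} := fun x (hx : Z x ≤ y) => hx.trans hyy.le
    rw [h.cdf_eq, h.cdf_eq, ← measureReal_sdiff hsub (h.demand.measurable measurableSet_Iic)]
    have hle : (uniformDistribution a b).real ({x | Z x ≤ y'} \ {x | Z x ≤ y}) ≤
        (uniformDistribution a b).real (Ioc ((l + y) / K) ((l + y') / K)) := by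
      rw [measureReal_def, measureReal_def]
      refine ENNReal.toReal_mono (measure_ne_top _ _) (measure_mono_ae ?_)
      filter_upwards [ae_mem_Icc hF.compl_eq_zero] with x hx hxZ
      obtain ⟨hx1, hx2⟩ := hxZ
      simp only [mem_ofPred_eq, not_le] at hx1 hx2
      have e1 := h.le_marginalReturn hcd hv ⟨by linarith, by linarith⟩
        (hl y ⟨hy₀, by linarith⟩) hx hx2
      have e2 := h.marginalReturn_le hcd hv (w := (y' + y₁) / 2) ⟨by linarith, by linarith⟩
        (hl _ ⟨by linarith, by linarith⟩) hx (by linarith)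
      rw [marginalReturn_quadraticProduction hcd (h.demand.mem x)] at e1 e2
      change (l + y) / K < x ∧ x ≤ (l + y') / K
      rw [div_lt_iff₀ hK0, le_div_iff₀ hK0]
      constructor <;> linarith
    refine hle.trans ((uniformDistribution_Ioc_le hab (by gcongr)).trans (le_of_eq ?_))
    rw [← sub_div]; congr 2; ring
  have h3 : (y' - y) / K / (b - a) ≤ g * (y' - y) := by
    rw [div_div, div_le_iff₀ (by positivity)]
    rw [div_le_iff₀ (by positivity)] at hK
    have : 0 < y' - y := by linarith
    nlinarith
  linarith

end Quadratic

/-! ### Type distributions concentrated near two points. -/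

section Concentrated

variable {a b : ℝ}

/-- `μ` is a probability distribution on `[a, b]` with continuous nonnegative density `f`. -/
structure HasContDensity (a b : ℝ) (μ : Measure ℝ) (f : ℝ → ℝ) : Prop where
  prob : IsProbabilityMeasure μ
  continuous : Continuous f
  nonneg : ∀ t, 0 ≤ f t
  eq : μ = (volume.restrict (Icc a b)).withDensity fun t => ENNReal.ofReal (f t)

/-- There are distributions with continuous density concentrated near any interior point. -/
lemma exists_hasContDensity_concentrated {x ε : ℝ} (hε : 0 < ε) (ha : a ≤ x - ε) (hb : x + ε ≤ b) :
    ∃ μ f, HasContDensity a b μ f ∧ μ (Icc (x - ε) (x + ε))ᶜ = 0 := by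
  let φ : ContDiffBump x := ⟨ε / 2, ε, by positivity, by linarith⟩
  set f := φ.normed volume with hf
  have hcont : Continuous f := φ.continuous_normed
  have hnn : ∀ t, 0 ≤ f t := φ.nonneg_normed
  have hball : Metric.ball x ε ⊆ Icc (x - ε) (x + ε) := by
    rw [Real.ball_eq_Ioo]; exact Ioo_subset_Icc_self
  have hsub : Icc (x - ε) (x + ε) ⊆ Icc a b := Icc_subset_Icc ha hb
  have hzero : ∀ t, t ∉ Icc (x - ε) (x + ε) → f t = 0 := fun t ht => by
    by_contra hne
    have : t ∈ Function.support f := hne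
    rw [hf, φ.support_normed_eq] at this
    exact ht (hball this)
  refine ⟨_, f, ⟨⟨?_⟩, hcont, hnn, rfl⟩, ?_⟩
  · rw [withDensity_apply _ MeasurableSet.univ, Measure.restrict_univ,
      ← ofReal_integral_eq_lintegral_ofReal φ.integrable_normed.integrableOn (ae_of_all _ hnn),
      setIntegral_eq_integral_of_forall_compl_eq_zero fun t ht => hzero t fun h => ht (hsub h),
      φ.integral_normed, ENNReal.ofReal_one]
  · rw [withDensity_apply _ measurableSet_Icc.compl]
    refine (setLIntegral_congr_fun measurableSet_Icc.compl fun t ht => ?_).trans (lintegral_zero)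
    rw [hzero t ht, ENNReal.ofReal_zero]

/-- The uniform component supplies the strict positivity that the two concentrated densities lack.
-/
lemma isTypeDistribution_mixture (hab : a < b) {μ ν : Measure ℝ} {f g : ℝ → ℝ}
    (hμ : HasContDensity a b μ f) (hν : HasContDensity a b ν g) {e w : ℝ} (he : 0 < e)
    (hw : 0 ≤ w) (hsum : w + w + e = 1) :
    IsTypeDistribution a b (ENNReal.ofReal w • μ + ENNReal.ofReal w • ν +
      ENNReal.ofReal e • uniformDistribution a b) := by
  have h0 : 0 < b - a := by linarith
  have := hμ.prob
  have := hν.prob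
  have := isProbabilityMeasure_uniformDistribution hab
  refine ⟨⟨?_⟩, fun t => w * f t + w * g t + e * (1 / (b - a)), ?_, fun t _ => ?_, ?_⟩
  · simp only [Measure.add_apply, Measure.smul_apply, measure_univ, smul_eq_mul, mul_one]
    rw [← ENNReal.ofReal_add hw hw, ← ENNReal.ofReal_add (by positivity) he.le, hsum,
      ENNReal.ofReal_one]
  · have := hμ.continuous
    have := hν.continuous
    fun_prop
  · have := mul_nonneg hw (hμ.nonneg t)
    have := mul_nonneg hw (hν.nonneg t)
    positivity
  · have hfm : Measurable fun t => ENNReal.ofReal (f t) := hμ.continuous.measurable.ennreal_ofReal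
    have hgm : Measurable fun t => ENNReal.ofReal (g t) := hν.continuous.measurable.ennreal_ofReal
    rw [hμ.eq, hν.eq, uniformDistribution, ← withDensity_smul _ hfm, ← withDensity_smul _ hgm,
      ← withDensity_smul _ measurable_const, ← withDensity_add_left (hfm.const_smul _),
      ← withDensity_add_left ((hfm.const_smul _).add (hgm.const_smul _))]
    congr 1
    ext t
    have h1 := hμ.nonneg t
    have h2 := hν.nonneg t
    simp only [Pi.add_apply, Pi.smul_apply, smul_eq_mul]
    rw [← ENNReal.ofReal_mul hw, ← ENNReal.ofReal_mul hw, ← ENNReal.ofReal_mul he.le,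
      ← ENNReal.ofReal_add (by positivity) (by positivity),
      ← ENNReal.ofReal_add (by positivity) (by positivity)]

/-- There are type distributions of firms and workers, and a coupling of them, concentrated near two
given pairs. -/
lemma exists_concentrated_coupling {c d x x' z z' ε e : ℝ} (hab : a < b) (hcd : c < d)
    (hε : 0 < ε) (hx : a ≤ x - ε) (hx' : x + ε < x' - ε) (hxb : x' + ε ≤ b) (hz : c ≤ z - ε)
    (hz' : z + ε < z' - ε) (hzd : z' + ε ≤ d) (he : 0 < e) (he1 : e ≤ 1) :
    ∃ (F G : Measure ℝ) (J : Measure (ℝ × ℝ)), IsTypeDistribution a b F ∧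
      IsTypeDistribution c d G ∧ J.map Prod.fst = F ∧ J.map Prod.snd = G ∧
      J.real (Icc (x - ε) (x + ε) ×ˢ Icc (z - ε) (z + ε) ∪
        Icc (x' - ε) (x' + ε) ×ˢ Icc (z' - ε) (z' + ε))ᶜ ≤ e ∧
      (1 - e) / 2 ≤ J.real (Icc (x - ε) (x + ε) ×ˢ Icc (z - ε) (z + ε)) ∧
      (1 - e) / 2 ≤ J.real (Icc (x' - ε) (x' + ε) ×ˢ Icc (z' - ε) (z' + ε)) := by
  obtain ⟨μ, f, hμ, hμ0⟩ := exists_hasContDensity_concentrated (a := a) (b := b) hε hx (by linarith)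
  obtain ⟨μ', f', hμ', hμ0'⟩ :=
    exists_hasContDensity_concentrated (a := a) (b := b) hε (by linarith : a ≤ x' - ε) hxb
  obtain ⟨ν, g, hν, hν0⟩ := exists_hasContDensity_concentrated (a := c) (b := d) hε hz (by linarith)
  obtain ⟨ν', g', hν', hν0'⟩ :=
    exists_hasContDensity_concentrated (a := c) (b := d) hε (by linarith : c ≤ z' - ε) hzd
  have := hμ.prob
  have := hμ'.prob
  have := hν.prob
  have := hν'.prob
  have := isProbabilityMeasure_uniformDistribution hab
  have := isProbabilityMeasure_uniformDistribution hcd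
  set w : ℝ := (1 - e) / 2 with hw
  have hw0 : 0 ≤ w := by linarith
  have hF := isTypeDistribution_mixture hab hμ hμ' he hw0 (by linarith)
  have hG := isTypeDistribution_mixture hcd hν hν' he hw0 (by linarith)
  set E := Icc (x - ε) (x + ε) ×ˢ Icc (z - ε) (z + ε)
  set E' := Icc (x' - ε) (x' + ε) ×ˢ Icc (z' - ε) (z' + ε)
  have mE : MeasurableSet E := measurableSet_Icc.prod measurableSet_Icc
  have mE' : MeasurableSet E' := measurableSet_Icc.prod measurableSet_Icc
  have hp : ∀ {α β : Measure ℝ} {S T : Set ℝ}, IsProbabilityMeasure α → IsProbabilityMeasure β →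
      MeasurableSet S → MeasurableSet T → α Sᶜ = 0 → β Tᶜ = 0 → (α.prod β) (S ×ˢ T) = 1 :=
    fun {α β S T} _ _ hS hT h1 h2 => by
      rw [Measure.prod_prod, (prob_compl_eq_zero_iff hS).1 h1, (prob_compl_eq_zero_iff hT).1 h2,
        one_mul]
  have hE : (μ.prod ν) E = 1 := hp hμ.prob hν.prob measurableSet_Icc measurableSet_Icc hμ0 hν0
  have hE' : (μ'.prod ν') E' = 1 :=
    hp hμ'.prob hν'.prob measurableSet_Icc measurableSet_Icc hμ0' hν0'
  -- Each firm bump is coupled with the worker bump of the same pair; the uniform remainders of mass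
  -- e are coupled independently.
  set J : Measure (ℝ × ℝ) := ENNReal.ofReal w • μ.prod ν + ENNReal.ofReal w • μ'.prod ν' +
    ENNReal.ofReal e • (uniformDistribution a b).prod (uniformDistribution c d) with hJ
  have hJp : J univ = 1 := by
    simp only [hJ, Measure.add_apply, Measure.smul_apply, measure_univ, smul_eq_mul, mul_one]
    rw [← ENNReal.ofReal_add hw0 hw0, ← ENNReal.ofReal_add (by positivity) he.le,
      ← ENNReal.ofReal_one]
    congr 1; linarith
  have hJp' : IsProbabilityMeasure J := ⟨hJp⟩
  refine ⟨_, _, J, hF, hG, ?_, ?_, ?_, ?_, ?_⟩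
  · rw [hJ, Measure.map_add _ _ measurable_fst, Measure.map_add _ _ measurable_fst,
      Measure.map_smul, Measure.map_smul, Measure.map_smul, Measure.map_fst_prod,
      Measure.map_fst_prod, Measure.map_fst_prod]
    simp
  · rw [hJ, Measure.map_add _ _ measurable_snd, Measure.map_add _ _ measurable_snd,
      Measure.map_smul, Measure.map_smul, Measure.map_smul, Measure.map_snd_prod,
      Measure.map_snd_prod, Measure.map_snd_prod]
    simp
  · rw [measureReal_def]
    refine ENNReal.toReal_le_of_le_ofReal he.le ?_
    have h1 : (μ.prod ν) (E ∪ E')ᶜ = 0 :=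
      measure_mono_null (compl_subset_compl.2 subset_union_left) ((prob_compl_eq_zero_iff mE).2 hE)
    have h2 : (μ'.prod ν') (E ∪ E')ᶜ = 0 :=
      measure_mono_null (compl_subset_compl.2 subset_union_right)
        ((prob_compl_eq_zero_iff mE').2 hE')
    simp only [hJ, Measure.add_apply, Measure.smul_apply, h1, h2, smul_eq_mul, mul_zero, zero_add]
    exact mul_le_of_le_one_right' prob_le_one
  · rw [measureReal_def, ← ENNReal.ofReal_le_iff_le_toReal (measure_ne_top _ _)]
    simp only [hJ, Measure.add_apply, Measure.smul_apply, hE, smul_eq_mul, mul_one]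
    exact le_add_right (le_add_right le_rfl)
  · rw [measureReal_def, ← ENNReal.ofReal_le_iff_le_toReal (measure_ne_top _ _)]
    simp only [hJ, Measure.add_apply, Measure.smul_apply, hE', smul_eq_mul, mul_one]
    exact le_add_right (le_add_left le_rfl)

end Concentrated

/-! ### Near sorting for concentrated distributions. -/

section NearlySorted

variable {a b c d : ℝ} {v : ℝ → ℝ → ℝ} {F G H : Measure ℝ} {q Z : ℝ → ℝ} {J : Measure (ℝ × ℝ)}

lemma IsSorting.integral_coupling [IsProbabilityMeasure F] [IsProbabilityMeasure J]
    (hJF : J.map Prod.fst = F) (h : IsSorting a b c d v F G H q Z) {k : ℝ → ℝ}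
    (hk : Continuous k) :
    Integrable (fun w => k (Z w.1)) J ∧ ∫ w, k (Z w.1) ∂J = ∫ z, k z ∂H := by
  have hi := h.integrable_law k hk.continuousOn
  rw [h.integral_law k hk.continuousOn]
  rw [← hJF] at hi ⊢
  exact ⟨hi.comp_aemeasurable measurable_fst.aemeasurable,
    (integral_map measurable_fst.aemeasurable hi.aestronglyMeasurable).symm⟩

lemma integral_coupling_snd [IsProbabilityMeasure G] (hG : G (Icc c d)ᶜ = 0)
    (hJG : J.map Prod.snd = G) {k : ℝ → ℝ} (hk : Continuous k) :
    Integrable (fun w => k w.2) J ∧ ∫ w, k w.2 ∂J = ∫ y, k y ∂G := by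
  have hi : Integrable k G := hk.continuousOn.integrable_of_compl_Icc hG
  rw [← hJG] at hi ⊢
  exact ⟨hi.comp_aemeasurable measurable_snd.aemeasurable,
    (integral_map measurable_snd.aemeasurable hi.aestronglyMeasurable).symm⟩

/-- If marginal returns are nearly increasing along a coupling concentrated on two boxes, then
equilibrium output is nearly attained at that coupling. -/
lemma IsSorting.output_le (hab : a < b) (hcd : c < d) (hv : IsProductionFunction a b c d v)
    {M : ℝ} (hM : ∀ s ∈ Icc a b, ∀ t ∈ Icc c d, |marginalReturn c d v s t| ≤ M)
    {y₀ A B ω : ℝ} (hAB : A ≤ B) (hA : |A| ≤ M) (hB : |B| ≤ M) (hω : 0 ≤ ω)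
    {E E' : Set (ℝ × ℝ)} (mE : MeasurableSet E) (mE' : MeasurableSet E')
    (hE : ∀ w ∈ E, w ∈ Icc a b ×ˢ Icc c d → |marginalReturn c d v w.1 w.2 - A| ≤ ω ∧ w.2 ≤ y₀)
    (hE' : ∀ w ∈ E', w ∈ Icc a b ×ˢ Icc c d → |marginalReturn c d v w.1 w.2 - B| ≤ ω ∧ y₀ ≤ w.2)
    [IsProbabilityMeasure F] (hF : F (Icc a b)ᶜ = 0) [IsProbabilityMeasure G]
    (hG : G (Icc c d)ᶜ = 0)
    [IsProbabilityMeasure J] (hJF : J.map Prod.fst = F) (hJG : J.map Prod.snd = G)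
    (h : IsSorting a b c d v F G H q Z)
    (hint : Integrable (fun w => v w.1 (Z w.1) - v w.1 w.2) J) :
    ∫ w, (v w.1 (Z w.1) - v w.1 w.2) ∂J ≤
      (d - c) * (ω + 4 * M * J.real (E ∪ E')ᶜ) := by
  obtain ⟨κ, hκ, hconc⟩ := hv.exists_strongly_concave hab hcd
  have hbox : ∀ᵐ w ∂J, w ∈ Icc a b ×ˢ Icc c d := ae_mem_box (by rwa [hJF]) (by rwa [hJG])
  obtain ⟨i1, e1⟩ := h.integral_coupling hJF continuous_id
  obtain ⟨i2, e2⟩ := integral_coupling_snd hG hJG continuous_id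
  obtain ⟨i3, e3⟩ := h.integral_coupling hJF (continuous_max_sub y₀)
  obtain ⟨i4, e4⟩ := integral_coupling_snd hG hJG (continuous_max_sub y₀)
  simp only [id] at i1 e1 i2 e2
  have hm := h.integral_id hcd.le
  have hle := h.integral_le hcd.le (convexOn_max_sub _ (convex_Icc c d) y₀)
    (continuous_max_sub y₀).continuousOn
  have mS : MeasurableSet (E ∪ E')ᶜ := (mE.union mE').compl
  have j1 : Integrable (fun w : ℝ × ℝ => B * (Z w.1 - w.2)) J := (i1.sub i2).const_mul B
  have j2 : Integrable (fun w : ℝ × ℝ =>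
      (B - A) * (max (y₀ - Z w.1) 0 - max (y₀ - w.2) 0)) J := (i3.sub i4).const_mul _
  have j3 : Integrable ((E ∪ E')ᶜ.indicator fun _ => (d - c) * (4 * M)) J :=
    (integrable_const _).indicator mS
  -- Skill is priced by the function B t + (B - A) max (y₀ - t) 0, with slope A below y₀ and B
  -- above, which matches v_z up to ω on the boxes. It is convex as A ≤ B, so its integral under H
  -- is at most that under G and only the error terms remain.
  have hmono : ∫ w, (v w.1 (Z w.1) - v w.1 w.2) ∂J ≤ ∫ w, (B * (Z w.1 - w.2) +
      (B - A) * (max (y₀ - Z w.1) 0 - max (y₀ - w.2) 0) + (d - c) * ω +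
      (E ∪ E')ᶜ.indicator (fun _ => (d - c) * (4 * M)) w) ∂J := by
    refine integral_mono_ae hint (((j1.add j2).add (integrable_const _)).add j3) ?_
    filter_upwards [hbox] with w hw
    have f1 := hconc w.1 hw.1 w.2 hw.2 _ (h.demand.mem w.1)
    have f2 : |Z w.1 - w.2| ≤ d - c := abs_sub_le_iff.2
      ⟨by linarith [(h.demand.mem w.1).2, hw.2.1], by linarith [(h.demand.mem w.1).1, hw.2.2]⟩
    have f3 : v w.1 (Z w.1) - v w.1 w.2 ≤ marginalReturn c d v w.1 w.2 * (Z w.1 - w.2) := by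
      nlinarith [sq_nonneg (Z w.1 - w.2)]
    have f4 : ∀ C, |marginalReturn c d v w.1 w.2 - C| ≤ ω →
        marginalReturn c d v w.1 w.2 * (Z w.1 - w.2) ≤ C * (Z w.1 - w.2) + (d - c) * ω :=
      fun C hC => by
        have := mul_le_mul hC f2 (abs_nonneg _) hω
        rw [← abs_mul] at this
        linarith [le_abs_self ((marginalReturn c d v w.1 w.2 - C) * (Z w.1 - w.2))]
    have f5 : (E ∪ E')ᶜ.indicator (fun _ => (d - c) * (4 * M)) w ≥ 0 := by
      have : 0 ≤ M := (abs_nonneg A).trans hA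
      have : 0 ≤ d - c := by linarith
      exact indicator_nonneg (fun _ _ => by positivity) w
    have f6 : 0 ≤ B - A := by linarith
    by_cases hwE : w ∈ E
    · obtain ⟨g1, g2⟩ := hE w hwE hw
      have g3 := f4 A g1
      have g4 : max (y₀ - w.2) 0 = y₀ - w.2 := max_eq_left (by linarith)
      have g5 := le_max_left (y₀ - Z w.1) 0
      have g6 : 0 ≤ (B - A) * ((Z w.1 - w.2) + (max (y₀ - Z w.1) 0 - max (y₀ - w.2) 0)) :=
        mul_nonneg f6 (by rw [g4]; linarith)
      linarith
    by_cases hwE' : w ∈ E'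
    · obtain ⟨g1, g2⟩ := hE' w hwE' hw
      have g3 := f4 B g1
      have g4 : max (y₀ - w.2) 0 = 0 := max_eq_right (by linarith)
      have g6 : 0 ≤ (B - A) * (max (y₀ - Z w.1) 0 - max (y₀ - w.2) 0) :=
        mul_nonneg f6 (by rw [g4]; linarith [le_max_right (y₀ - Z w.1) 0])
      linarith
    · have g0 : w ∈ (E ∪ E')ᶜ := fun hw' => hw'.elim hwE hwE'
      rw [indicator_of_mem g0]
      have g1 : |(marginalReturn c d v w.1 w.2 - B) * (Z w.1 - w.2)| ≤ (2 * M) * (d - c) := by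
        rw [abs_mul]
        refine mul_le_mul ((abs_sub _ _).trans ?_) f2 (abs_nonneg _) (by linarith [abs_nonneg A])
        linarith [hM w.1 hw.1 w.2 hw.2]
      have g2 : |(B - A) * (max (y₀ - Z w.1) 0 - max (y₀ - w.2) 0)| ≤ (2 * M) * (d - c) := by
        rw [abs_mul]
        refine mul_le_mul ((abs_sub _ _).trans (by linarith))
          ((abs_max_sub_max_le_abs _ _ _).trans ?_) (abs_nonneg _) (by linarith [abs_nonneg A])
        rw [sub_sub_sub_cancel_left, abs_sub_comm]
        exact f2
      have g3 := le_abs_self ((marginalReturn c d v w.1 w.2 - B) * (Z w.1 - w.2))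
      have g4 := neg_abs_le ((B - A) * (max (y₀ - Z w.1) 0 - max (y₀ - w.2) 0))
      have g5 : 0 ≤ (d - c) * ω := mul_nonneg (by linarith) hω
      linarith
  have j12 : Integrable (fun w : ℝ × ℝ => B * (Z w.1 - w.2) +
      (B - A) * (max (y₀ - Z w.1) 0 - max (y₀ - w.2) 0)) J := j1.add j2
  have j123 : Integrable (fun w : ℝ × ℝ => B * (Z w.1 - w.2) +
      (B - A) * (max (y₀ - Z w.1) 0 - max (y₀ - w.2) 0) + (d - c) * ω) J :=
    j12.add (integrable_const _)
  rw [integral_add j123 j3,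
    integral_add j12 (integrable_const _), integral_add j1 j2, integral_const_mul,
    integral_const_mul, integral_sub i1 i2, integral_sub i3 i4, e1, e2, e3, e4, hm,
    integral_indicator mS] at hmono
  simp only [integral_const, probReal_univ, measureReal_restrict_apply MeasurableSet.univ,
    univ_inter, smul_eq_mul, sub_self, mul_zero, zero_add] at hmono
  have : (B - A) * (∫ z, max (y₀ - z) 0 ∂H - ∫ z, max (y₀ - z) 0 ∂G) ≤ 0 :=
    mul_nonpos_of_nonneg_of_nonpos (by linarith) (by linarith)
  linarith

lemma IsProductionFunction.exists_bound (hab : a < b) (hcd : c < d)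
    (hv : IsProductionFunction a b c d v) :
    ∃ M : ℝ, 0 < M ∧ ∀ s ∈ Icc a b, ∀ t ∈ Icc c d, |marginalReturn c d v s t| ≤ M := by
  obtain ⟨M, hM⟩ := (isCompact_Icc.prod isCompact_Icc).exists_bound_of_continuousOn
    (hv.continuousOn_marginalReturn hab hcd)
  exact ⟨|M| + 1, by positivity, fun s hs t ht =>
    (hM (s, t) ⟨hs, ht⟩).trans ((le_abs_self M).trans (by linarith))⟩

lemma IsProductionFunction.exists_forall_near (hab : a < b) (hcd : c < d)
    (hv : IsProductionFunction a b c d v) {x z : ℝ} (hx : x ∈ Icc a b) (hz : z ∈ Icc c d) {ω : ℝ}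
    (hω : 0 < ω) : ∃ δ : ℝ, 0 < δ ∧ ∀ s ∈ Icc a b, ∀ t ∈ Icc c d, |s - x| ≤ δ → |t - z| ≤ δ →
      |marginalReturn c d v s t - marginalReturn c d v x z| ≤ ω := by
  obtain ⟨δ, hδ, H⟩ := Metric.continuousOn_iff.1 (hv.continuousOn_marginalReturn hab hcd)
    (x, z) ⟨hx, hz⟩ ω hω
  refine ⟨δ / 2, by positivity, fun s hs t ht h1 h2 => (H (s, t) ⟨hs, ht⟩ ?_).le⟩
  rw [Prod.dist_eq]
  exact max_lt (by rw [Real.dist_eq]; linarith) (by rw [Real.dist_eq]; linarith)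

/-- If marginal returns are larger at `(x', z')` than at `(x, z)`, then workers are nearly sorted
for suitable type distributions concentrated near these pairs. -/
lemma IsProductionFunction.exists_nearly_sorted (hab : a < b) (hcd : c < d)
    (hv : IsProductionFunction a b c d v) {x x' z z' σ ε₀ : ℝ} (hax : a < x) (hxx : x < x')
    (hxb : x' < b) (hcz : c < z) (hzz : z < z') (hzd : z' < d)
    (hm : marginalReturn c d v x z < marginalReturn c d v x' z') (hσ : 0 < σ) (hε₀ : 0 < ε₀) :
    ∃ ε : ℝ, 0 < ε ∧ ε ≤ ε₀ ∧ ∃ (F G : Measure ℝ) (J : Measure (ℝ × ℝ)),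
      IsTypeDistribution a b F ∧ IsTypeDistribution c d G ∧ J.map Prod.fst = F ∧
      J.map Prod.snd = G ∧
      J.real (Icc (x - ε) (x + ε) ×ˢ Icc (z - ε) (z + ε) ∪
        Icc (x' - ε) (x' + ε) ×ˢ Icc (z' - ε) (z' + ε))ᶜ ≤ σ ∧
      1 / 4 ≤ J.real (Icc (x - ε) (x + ε) ×ˢ Icc (z - ε) (z + ε)) ∧
      1 / 4 ≤ J.real (Icc (x' - ε) (x' + ε) ×ˢ Icc (z' - ε) (z' + ε)) ∧
      ∀ H q Z, IsSorting a b c d v F G H q Z →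
        ∀ t, ∫ s, max (t - s) 0 ∂G ≤ ∫ s, max (t - s) 0 ∂H + σ := by
  obtain ⟨κ, hκ, hgap⟩ := IsSorting.exists_output_gap hab hcd hv
  obtain ⟨M, hM0, hM⟩ := hv.exists_bound hab hcd
  have hD : 0 < d - c := by linarith
  -- With these θ, ω, e the output gap is at most 2κθ², so the mean squared distance is at most 2θ²;
  -- then |u| ≤ θ + u² / θ bounds the mean distance by 3θ = σ.
  set θ : ℝ := σ / 3 with hθ
  have hθ0 : 0 < θ := by positivity
  set ω : ℝ := κ * θ ^ 2 / (d - c) with hω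
  have hω0 : 0 < ω := by positivity
  set e : ℝ := min (min (1 / 2) σ) (κ * θ ^ 2 / ((d - c) * (4 * M))) with he
  have he0 : 0 < e := by positivity
  have he1 : e ≤ 1 / 2 := (min_le_left _ _).trans (min_le_left _ _)
  have he2 : e ≤ σ := (min_le_left _ _).trans (min_le_right _ _)
  have he3 : (d - c) * (4 * M) * e ≤ κ * θ ^ 2 := by
    have : e ≤ κ * θ ^ 2 / ((d - c) * (4 * M)) := min_le_right _ _
    rw [le_div_iff₀ (by positivity)] at this
    linarith
  obtain ⟨δ, hδ, hδm⟩ := hv.exists_forall_near hab hcd (x := x) (z := z) ⟨by linarith, by linarith⟩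
    ⟨by linarith, by linarith⟩ hω0
  obtain ⟨δ', hδ', hδm'⟩ := hv.exists_forall_near hab hcd (x := x') (z := z')
    ⟨by linarith, by linarith⟩ ⟨by linarith, by linarith⟩ hω0
  obtain ⟨ε, hε, hεs⟩ : ∃ ε : ℝ, 0 < ε ∧ ∀ u ∈ ({ε₀, δ, δ', x - a, (x' - x) / 4, b - x', z - c,
      (z' - z) / 4, d - z'} : Finset ℝ), ε ≤ u := by
    refine ⟨Finset.min' {ε₀, δ, δ', x - a, (x' - x) / 4, b - x', z - c, (z' - z) / 4, d - z'}
      ⟨ε₀, by simp⟩, ?_, fun u hu => Finset.min'_le _ u hu⟩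
    refine (Finset.lt_min'_iff _ _).2 fun u hu => ?_
    simp only [Finset.mem_insert, Finset.mem_singleton] at hu
    rcases hu with rfl | rfl | rfl | rfl | rfl | rfl | rfl | rfl | rfl <;> linarith
  simp only [Finset.mem_insert, Finset.mem_singleton, forall_eq_or_imp, forall_eq] at hεs
  obtain ⟨k1, k2, k3, k4, k5, k6, k7, k8, k9⟩ := hεs
  obtain ⟨F, G, J, hF, hG, hJF, hJG, hJ, hJ1, hJ2⟩ := exists_concentrated_coupling (x := x)
    (x' := x') (z := z) (z' := z') hab hcd hε (by linarith) (by linarith) (by linarith)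
    (by linarith) (by linarith) (by linarith) he0 (by linarith)
  refine ⟨ε, hε, k1, F, G, J, hF, hG, hJF, hJG, hJ.trans he2, by linarith, by linarith,
    fun H q Z h t => ?_⟩
  have hFp := hF.1
  have hGp := hG.1
  have hJp : IsProbabilityMeasure J := by
    refine ⟨?_⟩
    have : F univ = 1 := measure_univ
    rwa [← hJF, Measure.map_apply measurable_fst MeasurableSet.univ] at this
  obtain ⟨i1, i2, hle⟩ := hgap F G H q Z J hFp hF.compl_eq_zero hJp h hJF
    (by rw [hJG]; exact hG.compl_eq_zero) (by rw [hJG])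
  have hout := h.output_le hab hcd hv hM (y₀ := (z + z') / 2) hm.le
    (hM x ⟨by linarith, by linarith⟩ z ⟨by linarith, by linarith⟩)
    (hM x' ⟨by linarith, by linarith⟩ z' ⟨by linarith, by linarith⟩) hω0.le
    (measurableSet_Icc.prod measurableSet_Icc) (measurableSet_Icc.prod measurableSet_Icc)
    (E := Icc (x - ε) (x + ε) ×ˢ Icc (z - ε) (z + ε))
    (E' := Icc (x' - ε) (x' + ε) ×ˢ Icc (z' - ε) (z' + ε))
    (fun w hw hb => ⟨hδm w.1 hb.1 w.2 hb.2 (abs_sub_le_iff.2 ⟨by linarith [hw.1.2],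
      by linarith [hw.1.1]⟩) (abs_sub_le_iff.2 ⟨by linarith [hw.2.2], by linarith [hw.2.1]⟩),
      by linarith [hw.2.2]⟩)
    (fun w hw hb => ⟨hδm' w.1 hb.1 w.2 hb.2 (abs_sub_le_iff.2 ⟨by linarith [hw.1.2],
      by linarith [hw.1.1]⟩) (abs_sub_le_iff.2 ⟨by linarith [hw.2.2], by linarith [hw.2.1]⟩),
      by linarith [hw.2.1]⟩) hF.compl_eq_zero hG.compl_eq_zero hJF hJG i2
  have hS : ∫ w, (w.2 - Z w.1) ^ 2 ∂J ≤ 2 * θ ^ 2 := by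
    have e1 : (d - c) * ω = κ * θ ^ 2 := by rw [hω]; field_simp
    have e2 : (d - c) * (4 * M * J.real (Icc (x - ε) (x + ε) ×ˢ Icc (z - ε) (z + ε) ∪
        Icc (x' - ε) (x' + ε) ×ˢ Icc (z' - ε) (z' + ε))ᶜ) ≤ (d - c) * (4 * M) * e := by
      rw [← mul_assoc]
      gcongr
    have e3 : κ * ∫ w, (w.2 - Z w.1) ^ 2 ∂J ≤ κ * (2 * θ ^ 2) := by linarith
    exact le_of_mul_le_mul_left e3 hκ
  obtain ⟨i3, e3⟩ := h.integral_coupling hJF (continuous_max_sub t)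
  obtain ⟨i4, e4⟩ := integral_coupling_snd hG.compl_eq_zero hJG (continuous_max_sub t)
  have hmono : ∫ w, (max (t - w.2) 0 - max (t - Z w.1) 0) ∂J ≤
      ∫ w, (θ + (w.2 - Z w.1) ^ 2 / θ) ∂J := by
    refine integral_mono (i4.sub i3) ((integrable_const _).add (i1.div_const θ)) fun w => ?_
    have f1 := (le_abs_self _).trans (abs_max_sub_max_le_abs (t - w.2) (t - Z w.1) 0)
    rw [sub_sub_sub_cancel_left, abs_sub_comm] at f1
    refine f1.trans ?_
    change |w.2 - Z w.1| ≤ θ + (w.2 - Z w.1) ^ 2 / θ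
    rw [← sq_abs (w.2 - Z w.1)]
    have f2 : 0 ≤ (|w.2 - Z w.1| - θ) ^ 2 / θ := by positivity
    have f3 : (|w.2 - Z w.1| - θ) ^ 2 / θ = |w.2 - Z w.1| ^ 2 / θ - 2 * |w.2 - Z w.1| + θ := by
      field_simp; ring
    linarith [abs_nonneg (w.2 - Z w.1)]
  rw [integral_sub i4 i3, e3, e4, integral_add (integrable_const _) (i1.div_const θ)] at hmono
  simp only [integral_const, probReal_univ, one_smul, integral_div] at hmono
  have : (∫ w, (w.2 - Z w.1) ^ 2 ∂J) / θ ≤ 2 * θ := by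
    rw [div_le_iff₀ hθ0]; linarith
  linarith

end NearlySorted

/-! ### Necessity of the two orders. -/

section Necessity

variable {a b c d : ℝ} {v v' : ℝ → ℝ → ℝ} {F G H : Measure ℝ} {q Z : ℝ → ℝ}

lemma IsProductionFunction.exists_forall_near_lt (hab : a < b) (hcd : c < d)
    (hv : IsProductionFunction a b c d v) {x x' z z' : ℝ} (hx : x ∈ Icc a b) (hx' : x' ∈ Icc a b)
    (hz : z ∈ Icc c d) (hz' : z' ∈ Icc c d)
    (h : marginalReturn c d v x z < marginalReturn c d v x' z') :
    ∃ δ : ℝ, 0 < δ ∧ ∀ s ∈ Icc a b, ∀ s' ∈ Icc a b, ∀ t ∈ Icc c d, ∀ t' ∈ Icc c d,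
      |s - x| ≤ δ → |s' - x'| ≤ δ → |t - z| ≤ δ → |t' - z'| ≤ δ →
      marginalReturn c d v s t < marginalReturn c d v s' t' := by
  have hω : 0 < (marginalReturn c d v x' z' - marginalReturn c d v x z) / 3 := by linarith
  obtain ⟨δ, hδ, k⟩ := hv.exists_forall_near hab hcd hx hz hω
  obtain ⟨δ', hδ', k'⟩ := hv.exists_forall_near hab hcd hx' hz' hω
  refine ⟨min δ δ', lt_min hδ hδ', fun s hs s' hs' t ht t' ht' h1 h2 h3 h4 => ?_⟩
  have e1 := (abs_le.1 (k s hs t ht (h1.trans (min_le_left _ _)) (h3.trans (min_le_left _ _)))).2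
  have e2 := (abs_le.1 (k' s' hs' t' ht' (h2.trans (min_le_right _ _))
    (h4.trans (min_le_right _ _)))).1
  linarith

/-- Moving z up and z' down makes the weak inequality for v strict by decreasing returns; continuity
then lets the firm types move inwards too. -/
lemma exists_interior_reversal (hab : a < b) (hcd : c < d) (hv : IsProductionFunction a b c d v)
    (hv' : IsProductionFunction a b c d v') {x x' z z' : ℝ} (hx : x ∈ Icc a b) (hx' : x' ∈ Icc a b)
    (hz : z ∈ Icc c d) (hz' : z' ∈ Icc c d) (hxx : x < x') (hzz : z < z')
    (h : marginalReturn c d v x z ≤ marginalReturn c d v x' z')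
    (h' : marginalReturn c d v' x' z' < marginalReturn c d v' x z) :
    ∃ y y' w w' : ℝ, a < y ∧ y < y' ∧ y' < b ∧ c < w ∧ w < w' ∧ w' < d ∧
      marginalReturn c d v y w < marginalReturn c d v y' w' ∧
      marginalReturn c d v' y' w' < marginalReturn c d v' y w := by
  obtain ⟨δ, hδ, k⟩ := hv'.exists_forall_near_lt hab hcd hx' hx hz' hz h'
  obtain ⟨r, hr, hrδ, hrz⟩ : ∃ r : ℝ, 0 < r ∧ r ≤ δ ∧ r ≤ (z' - z) / 4 :=
    ⟨min δ ((z' - z) / 4), lt_min hδ (by linarith), min_le_left _ _, min_le_right _ _⟩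
  have mw : z + r ∈ Icc c d := ⟨by linarith [hz.1], by linarith [hz'.2]⟩
  have mw' : z' - r ∈ Icc c d := ⟨by linarith [hz.1], by linarith [hz'.2]⟩
  have n1 : marginalReturn c d v x (z + r) < marginalReturn c d v x' (z' - r) :=
    ((hv.marginalReturn_lt_of_lt hab hcd hx hz mw (by linarith)).trans_le h).trans
      (hv.marginalReturn_lt_of_lt hab hcd hx' mw' hz' (by linarith))
  have n2 : marginalReturn c d v' x' (z' - r) < marginalReturn c d v' x (z + r) :=
    k x' hx' x hx _ mw' _ mw (by simpa using hδ.le) (by simpa using hδ.le)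
      (by rw [sub_sub_cancel_left, abs_neg, abs_of_pos hr]; exact hrδ)
      (by rw [add_sub_cancel_left, abs_of_pos hr]; exact hrδ)
  obtain ⟨δ₁, hδ₁, k₁⟩ := hv.exists_forall_near_lt hab hcd hx hx' mw mw' n1
  obtain ⟨δ₂, hδ₂, k₂⟩ := hv'.exists_forall_near_lt hab hcd hx' hx mw' mw n2
  obtain ⟨u, hu, hu1, hu2, hux⟩ : ∃ u : ℝ, 0 < u ∧ u ≤ δ₁ ∧ u ≤ δ₂ ∧ u ≤ (x' - x) / 4 :=
    ⟨min (min δ₁ δ₂) ((x' - x) / 4), lt_min (lt_min hδ₁ hδ₂) (by linarith),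
      (min_le_left _ _).trans (min_le_left _ _), (min_le_left _ _).trans (min_le_right _ _),
      min_le_right _ _⟩
  have my : x + u ∈ Icc a b := ⟨by linarith [hx.1], by linarith [hx'.2]⟩
  have my' : x' - u ∈ Icc a b := ⟨by linarith [hx.1], by linarith [hx'.2]⟩
  have f1 : |x + u - x| = u := by rw [add_sub_cancel_left, abs_of_pos hu]
  have f2 : |x' - u - x'| = u := by rw [sub_sub_cancel_left, abs_neg, abs_of_pos hu]
  exact ⟨x + u, x' - u, z + r, z' - r, by linarith [hx.1], by linarith, by linarith [hx'.2],
    by linarith [hz.1], by linarith, by linarith [hz'.2],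
    k₁ _ my _ my' _ mw _ mw' (f1.le.trans hu1) (f2.le.trans hu1) (by simpa using hδ₁.le)
      (by simpa using hδ₁.le),
    k₂ _ my' _ my _ mw' _ mw (f2.le.trans hu2) (f1.le.trans hu2) (by simpa using hδ₂.le)
      (by simpa using hδ₂.le)⟩

lemma integral_max_sub_swap {μ : Measure ℝ} [IsProbabilityMeasure μ] (hμ : μ (Icc c d)ᶜ = 0)
    (t : ℝ) : ∫ s, max (s - t) 0 ∂μ = ∫ s, max (t - s) 0 ∂μ + (∫ s, s ∂μ - t) := by
  have i1 : Integrable (fun s => max (t - s) 0) μ :=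
    (continuous_max_sub t).continuousOn.integrable_of_compl_Icc hμ
  have i2 : Integrable (fun s : ℝ => s) μ := continuousOn_id.integrable_of_compl_Icc hμ
  have e : ∫ s, (s - t) ∂μ = ∫ s, s ∂μ - t := by
    rw [integral_sub i2 (integrable_const _)]; simp
  have i3 : Integrable (fun s => s - t) μ := i2.sub (integrable_const _)
  rw [← e, ← integral_add i1 i3]
  refine integral_congr_ae (.of_forall fun s => ?_)
  change max (s - t) 0 = max (t - s) 0 + (s - t)
  rcases le_total s t with hs | hs
  · rw [max_eq_right (by linarith), max_eq_left (by linarith)]; ring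
  · rw [max_eq_left (by linarith), max_eq_right (by linarith)]; ring

namespace IsSorting

/-- If Z x > w, only firms below x can fall short of w, each by at most d - c. -/
lemma demand_le [IsProbabilityMeasure F] (h : IsSorting a b c d v F G H q Z) {x w : ℝ} (hw : w ≤ d)
    (hlt : F.real (Iio x) * (d - c) < ∫ z, max (w - z) 0 ∂H) : Z x ≤ w := by
  by_contra! hx
  refine hlt.not_ge ?_
  have hk := continuous_max_sub w
  rw [h.integral_law _ hk.continuousOn, ← smul_eq_mul,
    ← integral_indicator_const _ measurableSet_Iio]
  refine integral_mono (h.integrable_law _ hk.continuousOn)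
    ((integrable_const _).indicator measurableSet_Iio) fun s => ?_
  have hs := h.demand.mem s
  rcases lt_or_ge s x with hsx | hsx
  · rw [indicator_of_mem (mem_Iio.2 hsx)]
    exact max_le (by linarith [hs.1]) (by linarith [hs.1, hs.2])
  · rw [indicator_of_notMem (notMem_Iio.2 hsx)]
    exact max_le (by linarith [h.demand.mono hsx]) le_rfl

lemma le_demand [IsProbabilityMeasure F] (h : IsSorting a b c d v F G H q Z) {x w : ℝ} (hw : c ≤ w)
    (hlt : F.real (Ioi x) * (d - c) < ∫ z, max (z - w) 0 ∂H) : w ≤ Z x := by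
  by_contra! hx
  refine hlt.not_ge ?_
  have hk : Continuous fun z : ℝ => max (z - w) 0 := by fun_prop
  rw [h.integral_law _ hk.continuousOn, ← smul_eq_mul,
    ← integral_indicator_const _ measurableSet_Ioi]
  refine integral_mono (h.integrable_law _ hk.continuousOn)
    ((integrable_const _).indicator measurableSet_Ioi) fun s => ?_
  have hs := h.demand.mem s
  rcases lt_or_ge x s with hsx | hsx
  · rw [indicator_of_mem (mem_Ioi.2 hsx)]
    exact max_le (by linarith [hs.2]) (by linarith [hs.1, hs.2])
  · rw [indicator_of_notMem (notMem_Ioi.2 hsx)]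
    exact max_le (by linarith [h.demand.mono hsx]) le_rfl

end IsSorting

/-- If the ranking of marginal returns at two interior pairs is reversed between two production
functions, then some type distributions have equilibria that are not ranked by majorization. -/
lemma exists_not_majorizes (hab : a < b) (hcd : c < d) (hv : IsProductionFunction a b c d v)
    (hv' : IsProductionFunction a b c d v') {x x' z z' : ℝ} (hax : a < x) (hxx : x < x')
    (hxb : x' < b) (hcz : c < z) (hzz : z < z') (hzd : z' < d)
    (h : marginalReturn c d v x z < marginalReturn c d v x' z')
    (h' : marginalReturn c d v' x' z' < marginalReturn c d v' x z) :
    ∃ F G H H' : Measure ℝ, IsTypeDistribution a b F ∧ IsTypeDistribution c d G ∧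
      IsEquilibriumWorkforceDistribution a b c d v F G H ∧
      IsEquilibriumWorkforceDistribution a b c d v' F G H' ∧ ¬ Majorizes c d H H' := by
  have mx : x ∈ Icc a b := ⟨hax.le, by linarith⟩
  have mx' : x' ∈ Icc a b := ⟨by linarith, hxb.le⟩
  have mz : z ∈ Icc c d := ⟨hcz.le, by linarith⟩
  have mz' : z' ∈ Icc c d := ⟨by linarith, hzd.le⟩
  obtain ⟨δ, hδ, k⟩ := hv'.exists_forall_near_lt hab hcd mx' mx mz' mz h'
  obtain ⟨η, hη, g1, g2, g3, g4, g5, g6⟩ : ∃ η : ℝ, 0 < η ∧ η ≤ δ ∧ η ≤ x - a ∧ η ≤ b - x' ∧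
      η ≤ z - c ∧ η ≤ d - z' ∧ η ≤ (z' - z) / 4 := by
    refine ⟨min δ (min (x - a) (min (b - x') (min (z - c) (min (d - z') ((z' - z) / 4))))),
      by simp only [lt_min_iff]; refine ⟨hδ, ?_, ?_, ?_, ?_, ?_⟩ <;> linarith, ?_⟩
    simp
  have my : x - η ∈ Icc a b := ⟨by linarith, by linarith⟩
  have my' : x' + η ∈ Icc a b := ⟨by linarith, by linarith⟩
  have mw : z + η ∈ Icc c d := ⟨by linarith, by linarith⟩
  have mw' : z' - η ∈ Icc c d := ⟨by linarith, by linarith⟩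
  have hD : 0 < d - c := by linarith
  -- σ (d - c) will cover the firms outside the boxes and σ the deviation from sorting; η / 8 is a
  -- quarter of the mass times a shortfall of η / 2.
  obtain ⟨σ, hσ, hσD⟩ : ∃ σ : ℝ, 0 < σ ∧ σ * (d - c) + σ < η / 8 := by
    refine ⟨η / (16 * (d - c + 1)), by positivity, ?_⟩
    have : η / (16 * (d - c + 1)) * (d - c) + η / (16 * (d - c + 1)) = η / 16 := by field_simp
    linarith
  obtain ⟨ε, hε, hεη, F, G, J, hF, hG, hJF, hJG, hJ, hE, hE', hnear⟩ :=
    hv.exists_nearly_sorted hab hcd hax hxx hxb hcz hzz hzd h hσ (half_pos hη)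
  have hFp := hF.1
  have hGp := hG.1
  obtain ⟨H, q, Z, hs⟩ := exists_isSorting hab hcd hv hF.compl_eq_zero hG.compl_eq_zero
  obtain ⟨H', q', Z', hs'⟩ := exists_isSorting hab hcd hv' hF.compl_eq_zero hG.compl_eq_zero
  refine ⟨F, G, H, H', hF, hG, hs.isEquilibriumWorkforceDistribution hv hF.compl_eq_zero,
    hs'.isEquilibriumWorkforceDistribution hv' hF.compl_eq_zero, fun hmaj => ?_⟩
  have hHp := hs.isProbabilityMeasure
  have hHp' := hs'.isProbabilityMeasure
  have hJp : IsProbabilityMeasure J := by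
    refine ⟨?_⟩
    have : F univ = 1 := measure_univ
    rwa [← hJF, Measure.map_apply measurable_fst MeasurableSet.univ] at this
  have hG0 := hG.compl_eq_zero
  have hH0 : H (Icc c d)ᶜ = 0 := hs.splitting.compl_eq_zero.2
  have hH0' : H' (Icc c d)ᶜ = 0 := hs'.splitting.compl_eq_zero.2
  obtain ⟨hmaj, hmean⟩ := (majorizes_iff hcd.le hH0 hH0').1 hmaj
  have hmeanG : ∫ s, s ∂H = ∫ s, s ∂G := hs.integral_id hcd.le
  have hlow : η / 8 ≤ ∫ s, max (z + η - s) 0 ∂G := by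
    obtain ⟨i, e⟩ := integral_coupling_snd hG0 hJG (continuous_max_sub (z + η))
    rw [← e]
    refine le_trans ?_ (mul_meas_ge_le_integral_of_nonneg
      (.of_forall fun w => le_max_right _ _) i (η / 2))
    have := hE.trans (measureReal_mono (μ := J) (s₂ := {w | η / 2 ≤ max (z + η - w.2) 0})
      fun w hw => show η / 2 ≤ max (z + η - w.2) 0 from
        le_max_of_le_left (by
          have : w.2 ≤ z + ε := hw.2.2
          linarith))
    change 1 / 4 ≤ J.real {w | η / 2 ≤ max (z + η - w.2) 0} at this
    change η / 8 ≤ η / 2 * J.real {w | η / 2 ≤ max (z + η - w.2) 0}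
    nlinarith
  have hhigh : η / 8 ≤ ∫ s, max (s - (z' - η)) 0 ∂G := by
    obtain ⟨i, e⟩ := integral_coupling_snd hG0 hJG (k := fun s => max (s - (z' - η)) 0)
      (by fun_prop)
    rw [← e]
    refine le_trans ?_ (mul_meas_ge_le_integral_of_nonneg
      (.of_forall fun w => le_max_right _ _) i (η / 2))
    have := hE'.trans (measureReal_mono (μ := J) (s₂ := {w | η / 2 ≤ max (w.2 - (z' - η)) 0})
      fun w hw => show η / 2 ≤ max (w.2 - (z' - η)) 0 from
        le_max_of_le_left (by
          have : z' - ε ≤ w.2 := hw.2.1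
          linarith))
    change 1 / 4 ≤ J.real {w | η / 2 ≤ max (w.2 - (z' - η)) 0} at this
    change η / 8 ≤ η / 2 * J.real {w | η / 2 ≤ max (w.2 - (z' - η)) 0}
    nlinarith
  have hl : F.real (Iio (x - ε)) ≤ σ := by
    rw [← hJF, map_measureReal_apply measurable_fst measurableSet_Iio]
    refine (measureReal_mono fun w hw => ?_).trans hJ
    replace hw : w.1 < x - ε := hw
    rintro (hw' | hw') <;> linarith [hw'.1.1]
  have hr : F.real (Ioi (x' + ε)) ≤ σ := by
    rw [← hJF, map_measureReal_apply measurable_fst measurableSet_Ioi]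
    refine (measureReal_mono fun w hw => ?_).trans hJ
    replace hw : x' + ε < w.1 := hw
    rintro (hw' | hw') <;> linarith [hw'.1.2]
  -- If H' is at least as dispersed as H, which is nearly G, its shortfall below z + η exceeds what
  -- the few firms below x - ε can produce. The other tail is symmetric.
  have c1 : Z' (x - ε) ≤ z + η := hs'.demand_le mw.2 <| by
    have := mul_le_mul_of_nonneg_right hl hD.le
    linarith [hnear H q Z hs (z + η), hmaj _ mw]
  have c2 : z' - η ≤ Z' (x' + ε) := hs'.le_demand mw'.1 <| by
    have := mul_le_mul_of_nonneg_right hr hD.le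
    rw [integral_max_sub_swap hH0']
    rw [integral_max_sub_swap hG0] at hhigh
    linarith [hnear H q Z hs (z' - η), hmaj _ mw']
  have ml : x - ε ∈ Icc a b := ⟨by linarith, by linarith⟩
  have mr : x' + ε ∈ Icc a b := ⟨by linarith, by linarith⟩
  -- Marginal returns under v' increase along Z', and decreasing returns transfer this to the skills
  -- z + η and z' - η, against the reversal near the two pairs.
  have e1 := marginalReturn_le_of_lt hcd hv' hs'.convex ml (hs'.demand.mem _) mr (hs'.demand.mem _)
    (hs'.demand.max _ ml) (hs'.demand.max _ mr) (by linarith)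
  have e2 := hv'.marginalReturn_anti hab hcd ml (hs'.demand.mem _) mw c1
  have e3 := hv'.marginalReturn_anti hab hcd mr mw' (hs'.demand.mem _) c2
  have e4 := k _ mr _ ml _ mw' _ mw (by rw [abs_le]; constructor <;> linarith)
    (by rw [abs_le]; constructor <;> linarith) (by rw [abs_le]; constructor <;> linarith)
    (by rw [abs_le]; constructor <;> linarith)
  linarith

lemma HigherMRS.of_majorizes (hab : a < b) (hcd : c < d) (hv : IsProductionFunction a b c d v)
    (hv' : IsProductionFunction a b c d v')
    (hmaj : ∀ F G : Measure ℝ, IsTypeDistribution a b F → IsTypeDistribution c d G →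
      ∀ H H' : Measure ℝ, IsEquilibriumWorkforceDistribution a b c d v F G H →
        IsEquilibriumWorkforceDistribution a b c d v' F G H' → Majorizes c d H H') :
    HigherMRS a b c d v' v := by
  intro x hx x' hx' z hz z' hz' hxx hzz h
  by_contra! h'
  -- Ties are harmless: decreasing returns of v settle x = x', and increasing differences of v'
  -- settle z = z'.
  have hxx : x < x' := hxx.lt_of_ne <| by
    rintro rfl
    rcases hzz.eq_or_lt with rfl | hzz
    · exact h'.false
    · exact h.not_gt (hv.marginalReturn_lt_of_lt hab hcd hx hz hz' hzz)
  have hzz : z < z' := hzz.lt_of_ne <| by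
    rintro rfl
    exact h'.not_gt (hv'.marginalReturn_lt hab hcd hx hx' hz hxx)
  obtain ⟨y, y', w, w', h1, h2, h3, h4, h5, h6, h7, h8⟩ :=
    exists_interior_reversal hab hcd hv hv' hx hx' hz hz' hxx hzz h h'
  obtain ⟨F, G, H, H', hF, hG, hH, hH', hn⟩ :=
    exists_not_majorizes hab hcd hv hv' h1 h2 h3 h4 h5 h6 h7 h8
  exact hn (hmaj F G hF hG H H' hH hH')

lemma Majorizes.of_forall_majorizes (hab : a < b) (hcd : c < d) {G G' : Measure ℝ}
    (hG : IsTypeDistribution c d G) (hG' : IsTypeDistribution c d G')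
    (hmaj : ∀ (v : ℝ → ℝ → ℝ) (F : Measure ℝ), IsProductionFunction a b c d v →
      IsTypeDistribution a b F → ∀ H H' : Measure ℝ,
        IsEquilibriumWorkforceDistribution a b c d v F G H →
        IsEquilibriumWorkforceDistribution a b c d v F G' H' → Majorizes c d H H') :
    Majorizes c d G G' := by
  obtain ⟨K₁, hK₁, k₁⟩ := hG.exists_forall_integral_max_le hab hcd
  obtain ⟨K₂, hK₂, -⟩ := hG'.exists_forall_integral_max_le hab hcd
  have hF := isTypeDistribution_uniformDistribution hab
  have hGp := hG.1
  have hGp' := hG'.1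
  have hFp := hF.1
  have hv := isProductionFunction_quadraticProduction (a := a) (b := b) hab hcd hK₁
  obtain ⟨H, q, Z, hs⟩ := exists_isSorting hab hcd hv hF.compl_eq_zero hG.compl_eq_zero
  obtain ⟨H', q', Z', hs'⟩ := exists_isSorting hab hcd hv hF.compl_eq_zero hG'.compl_eq_zero
  have hHp := hs.isProbabilityMeasure
  have hHp' := hs'.isProbabilityMeasure
  obtain ⟨e, hmean⟩ := (majorizes_iff hcd.le hs.splitting.compl_eq_zero.2
    hs'.splitting.compl_eq_zero.2).1 (hmaj _ _ hv hF H H'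
      (hs.isEquilibriumWorkforceDistribution hv hF.compl_eq_zero)
      (hs'.isEquilibriumWorkforceDistribution hv hF.compl_eq_zero))
  refine (majorizes_iff hcd.le hG.compl_eq_zero hG'.compl_eq_zero).2 ⟨fun y hy => ?_, ?_⟩
  -- The chain is G ≤ H ≤ H' ≤ G' in shortfalls; complete sorting matters only for G, because H' is
  -- always a contraction of G'.
  · exact ((k₁ K₁ le_rfl H q Z hs y hy).trans (e y hy)).trans (hs'.integral_le hcd.le
      (convexOn_max_sub _ (convex_Icc c d) y) (continuous_max_sub y).continuousOn)
  · rw [← hs.integral_id hcd.le, ← hs'.integral_id hcd.le, hmean]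

end Necessity

theorem mainTheorem6 (a b c d : ℝ) (hab : a < b) (hcd : c < d) :
    -- the equilibrium workforce distribution is well defined
    (∀ (v : ℝ → ℝ → ℝ) (F G : Measure ℝ), IsProductionFunction a b c d v →
      IsTypeDistribution a b F → IsTypeDistribution c d G →
      ∃! H : Measure ℝ, IsEquilibriumWorkforceDistribution a b c d v F G H) ∧
    -- changes of the production function
    (∀ v v' : ℝ → ℝ → ℝ, IsProductionFunction a b c d v → IsProductionFunction a b c d v' →
      ((∀ F G : Measure ℝ, IsTypeDistribution a b F → IsTypeDistribution c d G →
          ∀ H H' : Measure ℝ, IsEquilibriumWorkforceDistribution a b c d v F G H →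
            IsEquilibriumWorkforceDistribution a b c d v' F G H' → Majorizes c d H H') ↔
        HigherMRS a b c d v' v)) ∧
    -- changes of the worker distribution
    (∀ G G' : Measure ℝ, IsTypeDistribution c d G → IsTypeDistribution c d G' →
      ((∀ (v : ℝ → ℝ → ℝ) (F : Measure ℝ), IsProductionFunction a b c d v →
          IsTypeDistribution a b F →
          ∀ H H' : Measure ℝ, IsEquilibriumWorkforceDistribution a b c d v F G H →
            IsEquilibriumWorkforceDistribution a b c d v F G' H' → Majorizes c d H H') ↔
        Majorizes c d G G')) := by
  refine ⟨fun v F G hv hF hG => ?_, fun v v' hv hv' => ⟨HigherMRS.of_majorizes hab hcd hv hv',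
    fun hmrs F G hF hG H H' hH hH' => ?_⟩, fun G G' hG hG' =>
    ⟨Majorizes.of_forall_majorizes hab hcd hG hG', fun hmaj v F hv hF H H' hH hH' => ?_⟩⟩
  all_goals
    have hF0 := hF.compl_eq_zero
    have hFp := hF.1
    have hGp := hG.1
  · obtain ⟨H, q, Z, hs⟩ := exists_isSorting hab hcd hv hF0 hG.compl_eq_zero
    refine ⟨H, hs.isEquilibriumWorkforceDistribution hv hF0, fun H' hH' => ?_⟩
    obtain ⟨q', Z', hs'⟩ := hH'.exists_isSorting hab hcd hv hF0
    exact hs'.unique hab hcd hv hF0 hs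
  · obtain ⟨q, Z, hs⟩ := hH.exists_isSorting hab hcd hv hF0
    obtain ⟨q', Z', hs'⟩ := hH'.exists_isSorting hab hcd hv' hF0
    exact hs.majorizes hab hcd hv hv' hmrs hF0 (Majorizes.refl c d G) hs'
  · have hGp' := hG'.1
    obtain ⟨q, Z, hs⟩ := hH.exists_isSorting hab hcd hv hF0
    obtain ⟨q', Z', hs'⟩ := hH'.exists_isSorting hab hcd hv hF0
    exact hs.majorizes hab hcd hv hv (HigherMRS.refl a b c d v) hF0 hmaj hs'
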